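/- Let $1\le N\le 4$, let $\Omega\subset\mathbb R^N$ be a bounded, connected, nonempty open set with Lipschitz boundary. Let $H^1_0(\Omega;\mathbb R^N)$ carry the inner product $\int_\Omega\nabla u:\nabla v\,dx$ and norm $\|u\|=\|\nabla u\|_{L^2}$, let $H^{-1}(\Omega;\mathbb R^N)$ be its dual with the dual norm, and let $\mathbb D=\{u\in H^1_0(\Omega;\mathbb R^N):\operatorname{div}u=0 \text{ in }\Omega\}$. For $\nu>0$, $f\in H^{-1}(\Omega;\mathbb R^N)$ and $u\in\mathbb D$, the residual of $u$ is the minimizer $U\in\mathbb D$ over $V\in\mathbb D$ of $$\int_\Omega\Big[\tfrac12|\nabla V|^2+(\nu\nabla u-u\otimes u):\nabla V\Big]dx-\langle f,V\rangle ,$$ and $E(u)=\frac12\int_\Omega|\nabla U|^2dx$. A weak solution of the steady Navier–Stokes system $-\nu\Delta u+\operatorname{div}(u\otimes u)+\nabla p=f$, $\operatorname{div}u=0$ in $\Omega$, is a pair $u\in\mathbb D$, $p\in L^2(\Omega)$ with $\int_\Omega p\,dx=0$ such that $$\int_\Omega\big[\nu\nabla u:\nabla v-(u\otimes u):\nabla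 v-p\operatorname{div}v\big]dx=\langle f,v\rangle\qquad\text{for all }v\in H^1_0(\Omega;\mathbb R^N).$$ **Theorem.** For all $\nu>0$, $f\in H^{-1}(\Omega;\mathbb R^N)$ and $u\in\mathbb D$ the residual of $u$ exists and is unique. Moreover, there is $\delta>0$, depending only on $\Omega$ (and $N$), such that for all $\nu>0$ and $f\in H^{-1}(\Omega;\mathbb R^N)$ with $\|f\|_{H^{-1}}/\nu^2\le\delta$ there are $c\in(0,\infty]$ and $C>0$ for which the following hold. 1. $E:\mathbb D\to[0,\infty)$ is an error functional with constants $c$ and $C$, that is: $E$ is nonnegative and of class $C^1$; for every bounded set $S\subset\mathbb D$, $E(u)\to0$ as $\|E'(u)\|\to0$ with $u\in S$; and $\|u-v\|^2\le C\,(E(u)+E(v))$ for all $u,v\in\mathbb D$ with $E(u)\le c$ and $E(v)\le c$. 2. The steady Navier–Stokes system has a unique weak solution $(u,p)$, $u\in\mathbb D$. 3. This $u$ satisfies $\|u-v\|^2\le C\,E(v)$ for every $v\in\mathbb D$ with $E(v)\le c$. -/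

import Mathlib

open MeasureTheory Topology Filter
open scoped ENNReal NNReal Distributions

noncomputable section

namespace SteadyNS

/-! ### Domains -/

/-- `ℝ^N` with the Euclidean norm. -/
abbrev Vec (N : ℕ) : Type := EuclideanSpace ℝ (Fin N)

/-- `N × N` real matrices with the Frobenius inner product, stored as `N`-tuples of vectors. For the
gradient of a vector field `u`, the entry `(∇u) j i` is `∂u_i/∂x_j`. -/
abbrev Mat (N : ℕ) : Type := PiLp 2 (fun _ : Fin N => Vec N)

/-- `Ω` has Lipschitz boundary: near every boundary point, after a choice of a vertical direction
`e`, the set `Ω` is the region strictly above the graph of a Lipschitz function defined on the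
hyperplane orthogonal to `e`. -/
def HasLipschitzBoundary {N : ℕ} (Ω : Set (Vec N)) : Prop :=
  ∀ x ∈ frontier Ω, ∃ r : ℝ, 0 < r ∧ ∃ e : Vec N, ‖e‖ = 1 ∧
    ∃ (K : ℝ≥0) (g : (Submodule.span ℝ {e})ᗮ → ℝ), LipschitzWith K g ∧
      ∀ y ∈ Metric.ball x r,
        (y ∈ Ω ↔ g ((Submodule.span ℝ {e})ᗮ.orthogonalProjectionOnto y) < inner ℝ e y)

/-- Bounded, Lipschitz, connected (nonempty) open subsets of `ℝ^N`. -/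
structure BoundedLipschitzDomain (N : ℕ) where
  toOpens : TopologicalSpace.Opens (Vec N)
  bounded : Bornology.IsBounded (toOpens : Set (Vec N))
  connected : IsConnected (toOpens : Set (Vec N))
  lipschitz : HasLipschitzBoundary (toOpens : Set (Vec N))

variable {N : ℕ} (Ω : BoundedLipschitzDomain N)

/-- Lebesgue measure on `Ω`. -/
abbrev vol : Measure (Vec N) := volume.restrict (Ω.toOpens : Set (Vec N))

/-! ### The space `H^1_0(Ω; ℝ^N)` -/

/-- The classical gradient of a vector field, `(∇φ) j i = ∂φ_i/∂x_j`. -/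
def classicalGrad (φ : Vec N → Vec N) (x : Vec N) : Mat N :=
  WithLp.toLp 2 fun j => fderiv ℝ φ x (EuclideanSpace.single j 1)

variable {Ω} in
theorem continuous_classicalGrad (φ : 𝓓(Ω.toOpens, Vec N)) : Continuous (classicalGrad φ) := by
  have h : Continuous (fderiv ℝ φ) :=
    φ.contDiff.continuous_fderiv (by simp)
  refine (PiLp.continuous_toLp 2 _).comp (continuous_pi fun j => ?_)
  exact h.clm_apply continuous_const

variable {Ω} in
theorem hasCompactSupport_classicalGrad (φ : 𝓓(Ω.toOpens, Vec N)) :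
    HasCompactSupport (classicalGrad φ) := by
  refine (φ.hasCompactSupport.fderiv (𝕜 := ℝ)).mono fun x hx => ?_
  contrapose! hx
  simp only [Function.mem_support, ne_eq, not_not] at hx ⊢
  ext j i
  simp [classicalGrad, hx]

variable {Ω} in
theorem memLp_test (φ : 𝓓(Ω.toOpens, Vec N)) : MemLp φ 2 (vol Ω) :=
  φ.continuous.memLp_of_hasCompactSupport φ.hasCompactSupport

variable {Ω} in
theorem memLp_classicalGrad (φ : 𝓓(Ω.toOpens, Vec N)) : MemLp (classicalGrad φ) 2 (vol Ω) :=
  (continuous_classicalGrad φ).memLp_of_hasCompactSupport (hasCompactSupport_classicalGrad φ)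

/-- The map `φ ↦ (φ, ∇φ)` from smooth compactly supported vector fields in `Ω` to `L² × L²`. -/
def testGraph : 𝓓(Ω.toOpens, Vec N) →ₗ[ℝ] Lp (Vec N) 2 (vol Ω) × Lp (Mat N) 2 (vol Ω) where
  toFun φ := ((memLp_test φ).toLp φ, (memLp_classicalGrad φ).toLp (classicalGrad φ))
  map_add' φ ψ := by
    have hadd : classicalGrad (φ + ψ : 𝓓(Ω.toOpens, Vec N)) =
        classicalGrad φ + classicalGrad ψ := by
      ext x j i
      have h1 := (φ.contDiff.differentiable (by simp)) x
      have h2 := (ψ.contDiff.differentiable (by simp)) x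
      simp [classicalGrad, fderiv_add h1 h2]
    refine Prod.ext (MemLp.toLp_add (memLp_test φ) (memLp_test ψ)) ?_
    refine Eq.trans ?_ (MemLp.toLp_add (memLp_classicalGrad φ) (memLp_classicalGrad ψ))
    simp only [hadd]
  map_smul' c φ := by
    have hsmul : classicalGrad (c • φ : 𝓓(Ω.toOpens, Vec N)) = c • classicalGrad φ := by
      ext x j i
      have h1 := (φ.contDiff.differentiable (by simp)) x
      simp [classicalGrad, fderiv_const_smul h1 c]
    refine Prod.ext (MemLp.toLp_const_smul c (memLp_test φ)) ?_
    refine Eq.trans ?_ (MemLp.toLp_const_smul c (memLp_classicalGrad φ))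
    simp only [hsmul]

/-- `H^1_0(Ω; ℝ^N)` as a set of pairs `(u, ∇u)`: the closure in `L² × L²` of the pairs `(φ, ∇φ)`
with `φ ∈ C_c^∞(Ω; ℝ^N)`. The second component is the weak gradient of the first one. -/
def H10Graph : Submodule ℝ (Lp (Vec N) 2 (vol Ω) × Lp (Mat N) 2 (vol Ω)) :=
  (LinearMap.range (testGraph Ω)).topologicalClosure

/-- `H^1_0(Ω; ℝ^N)`. This type carries the inner product `∫_Ω ∇u : ∇v`. -/
structure H10 where
  /-- the pair `(u, ∇u)` -/
  pair : H10Graph Ω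

namespace H10

variable {Ω}

/-- The vector field `u`. -/
def field (u : H10 Ω) : Lp (Vec N) 2 (vol Ω) := u.pair.1.1

/-- The weak gradient `∇u`. -/
def grad (u : H10 Ω) : Lp (Mat N) 2 (vol Ω) := u.pair.1.2

variable (Ω) in
/-- `H10 Ω` is a one-field structure around `H10Graph Ω`. -/
def equivGraph : H10 Ω ≃ H10Graph Ω where
  toFun := H10.pair
  invFun := H10.mk
  left_inv _ := rfl
  right_inv _ := rfl

instance : AddCommGroup (H10 Ω) := (equivGraph Ω).addCommGroup

instance : Module ℝ (H10 Ω) := (equivGraph Ω).module ℝ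

end H10

/-- **Poincaré inequality** for smooth compactly supported fields. -/
theorem poincare_test : ∃ C : ℝ, 0 ≤ C ∧ ∀ φ : 𝓓(Ω.toOpens, Vec N),
    ‖(testGraph Ω φ).1‖ ≤ C * ‖(testGraph Ω φ).2‖ := by
  rcases Nat.eq_zero_or_pos N with hN | hN
  · subst hN
    refine ⟨0, le_rfl, fun φ => ?_⟩
    have h0 : (testGraph Ω φ).1 = 0 :=
      Lp.ext (Eventually.of_forall fun x => Subsingleton.elim _ _)
    rw [h0, norm_zero, zero_mul]
  obtain ⟨R, hRpos, hR⟩ := Ω.bounded.exists_pos_norm_le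
  refine ⟨2 * R, by positivity, fun φ => ?_⟩
  let k : Fin N := ⟨0, hN⟩
  let e : Vec N := EuclideanSpace.single k 1
  let ℓ : Vec N →L[ℝ] ℝ := EuclideanSpace.proj k
  have hℓe : ℓ e = 1 := by simp [ℓ, e]
  have hℓ : ∀ x, |ℓ x| ≤ ‖x‖ := fun x => PiLp.norm_apply_le x k
  have hd : Differentiable ℝ φ := φ.contDiff.differentiable (by simp)
  have hfc : Continuous (fderiv ℝ φ) := φ.contDiff.continuous_fderiv (by simp)
  have hdc : Continuous fun x => fderiv ℝ φ x e := hfc.clm_apply continuous_const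
  have hcs := φ.hasCompactSupport
  have hzero : ∀ x, φ x = 0 ∨ ‖x‖ ≤ R := fun x => by
    by_cases hx : x ∈ tsupport φ
    · exact Or.inr (hR x (φ.tsupport_subset hx))
    · exact Or.inl (image_eq_zero_of_notMem_tsupport hx)
  -- the derivative of `‖φ‖²` in direction `e`
  have hg : ∀ x, HasFDerivAt (fun y => ‖φ y‖ ^ 2)
      (2 • (innerSL ℝ (φ x)).comp (fderiv ℝ φ x)) x := fun x => (hd x).hasFDerivAt.norm_sq
  have hcφ : HasCompactSupport fun x => ‖φ x‖ ^ 2 := by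
    refine hcs.mono fun x hx => ?_
    contrapose! hx
    simp only [Function.mem_support, ne_eq, not_not] at hx ⊢
    simp [hx]
  have hcφ' : HasCompactSupport fun x => ℓ x * (2 * inner ℝ (φ x) (fderiv ℝ φ x e)) := by
    refine hcs.mono fun x hx => ?_
    contrapose! hx
    simp only [Function.mem_support, ne_eq, not_not] at hx ⊢
    simp [hx]
  have hcℓ : HasCompactSupport fun x => ℓ x * ‖φ x‖ ^ 2 := hcφ.mul_left
  have i1 : Integrable fun x => ‖φ x‖ ^ 2 :=
    (φ.continuous.norm.pow 2).integrable_of_hasCompactSupport hcφ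
  have i2 : Integrable fun x => ℓ x * (2 * inner ℝ (φ x) (fderiv ℝ φ x e)) :=
    (ℓ.continuous.mul (continuous_const.mul (φ.continuous.inner hdc))).integrable_of_hasCompactSupport
      hcφ'
  have i3 : Integrable fun x => ℓ x * ‖φ x‖ ^ 2 :=
    (ℓ.continuous.mul (φ.continuous.norm.pow 2)).integrable_of_hasCompactSupport hcℓ
  have hce : HasCompactSupport fun x => ‖classicalGrad φ x‖ ^ 2 := by
    refine (hasCompactSupport_classicalGrad φ).mono fun x hx => ?_
    contrapose! hx
    simp only [Function.mem_support, ne_eq, not_not] at hx ⊢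
    simp [hx]
  have i4 : Integrable fun x => ‖classicalGrad φ x‖ ^ 2 :=
    ((continuous_classicalGrad φ).norm.pow 2).integrable_of_hasCompactSupport hce
  have key : ∫ x, ℓ x * (2 * inner ℝ (φ x) (fderiv ℝ φ x e)) = - ∫ x, ‖φ x‖ ^ 2 := by
    have := integral_bilinear_hasFDerivAt_right_eq_neg_left_of_integrable
      (μ := (volume : Measure (Vec N))) (B := ContinuousLinearMap.mul ℝ ℝ) (v := e)
      (f := fun x => ℓ x) (f' := fun _ => ℓ) (g := fun x => ‖φ x‖ ^ 2)
      (g' := fun x => 2 • (innerSL ℝ (φ x)).comp (fderiv ℝ φ x))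
      (by simpa [hℓe] using i1) (by simpa using i2) (by simpa using i3)
      (fun x _ => ℓ.hasFDerivAt) (fun x _ => hg x)
    simpa [hℓe] using this
  have hgrad : ∀ x, ‖fderiv ℝ φ x e‖ ≤ ‖classicalGrad φ x‖ := fun x =>
    PiLp.norm_apply_le (classicalGrad φ x) k
  have hpt : ∀ x, -(ℓ x * (2 * inner ℝ (φ x) (fderiv ℝ φ x e))) ≤
      1 / 2 * ‖φ x‖ ^ 2 + 2 * R ^ 2 * ‖classicalGrad φ x‖ ^ 2 := fun x => by
    rcases hzero x with h | h
    · simp only [h, inner_zero_left, mul_zero, neg_zero, norm_zero]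
      positivity
    · have h1 : |ℓ x * inner ℝ (φ x) (fderiv ℝ φ x e)| ≤
          R * (‖φ x‖ * ‖classicalGrad φ x‖) := by
        rw [abs_mul]
        refine mul_le_mul ((hℓ x).trans h) ?_ (abs_nonneg _) hRpos.le
        exact (abs_real_inner_le_norm _ _).trans
          (mul_le_mul_of_nonneg_left (hgrad x) (norm_nonneg _))
      have h2 := neg_le_of_abs_le h1
      nlinarith [sq_nonneg (‖φ x‖ - 2 * R * ‖classicalGrad φ x‖)]
  have hint : ∫ x, ‖φ x‖ ^ 2 ≤
      1 / 2 * (∫ x, ‖φ x‖ ^ 2) + 2 * R ^ 2 * ∫ x, ‖classicalGrad φ x‖ ^ 2 := by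
    calc ∫ x, ‖φ x‖ ^ 2 = ∫ x, -(ℓ x * (2 * inner ℝ (φ x) (fderiv ℝ φ x e))) := by
          rw [integral_neg, key, neg_neg]
      _ ≤ ∫ x, (1 / 2 * ‖φ x‖ ^ 2 + 2 * R ^ 2 * ‖classicalGrad φ x‖ ^ 2) :=
          integral_mono i2.neg ((i1.const_mul _).add (i4.const_mul _)) hpt
      _ = _ := by
          rw [integral_add (i1.const_mul _) (i4.const_mul _), integral_const_mul,
            integral_const_mul]
  have n1 : ‖(testGraph Ω φ).1‖ ^ 2 = ∫ x, ‖φ x‖ ^ 2 := by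
    rw [← real_inner_self_eq_norm_sq, L2.inner_def]
    have : ∀ᵐ x ∂(vol Ω), inner ℝ ((testGraph Ω φ).1 x) ((testGraph Ω φ).1 x) = ‖φ x‖ ^ 2 := by
      filter_upwards [(memLp_test φ).coeFn_toLp] with x hx
      change inner ℝ ((memLp_test φ).toLp φ x) ((memLp_test φ).toLp φ x) = _
      rw [hx, real_inner_self_eq_norm_sq]
    rw [integral_congr_ae this]
    refine setIntegral_eq_integral_of_forall_compl_eq_zero fun x hx => ?_
    have : φ x = 0 := image_eq_zero_of_notMem_tsupport fun h => hx (φ.tsupport_subset h)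
    simp [this]
  have n2 : ‖(testGraph Ω φ).2‖ ^ 2 = ∫ x, ‖classicalGrad φ x‖ ^ 2 := by
    rw [← real_inner_self_eq_norm_sq, L2.inner_def]
    have : ∀ᵐ x ∂(vol Ω), inner ℝ ((testGraph Ω φ).2 x) ((testGraph Ω φ).2 x) =
        ‖classicalGrad φ x‖ ^ 2 := by
      filter_upwards [(memLp_classicalGrad φ).coeFn_toLp] with x hx
      change inner ℝ ((memLp_classicalGrad φ).toLp _ x) ((memLp_classicalGrad φ).toLp _ x) = _
      rw [hx, real_inner_self_eq_norm_sq]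
    rw [integral_congr_ae this]
    refine setIntegral_eq_integral_of_forall_compl_eq_zero fun x hx => ?_
    have h0 : fderiv ℝ φ x = 0 := image_eq_zero_of_notMem_tsupport fun h =>
      hx (φ.tsupport_subset (tsupport_fderiv_subset ℝ h))
    have : classicalGrad φ x = 0 := by
      ext j i
      simp [classicalGrad, h0]
    simp [this]
  rw [← n1, ← n2] at hint
  refine abs_le_of_sq_le_sq' ?_ (by positivity) |>.2
  nlinarith

/-- **Poincaré inequality** in `H^1_0`. -/
theorem poincare : ∃ C : ℝ, 0 ≤ C ∧ ∀ u : H10 Ω, ‖u.field‖ ≤ C * ‖u.grad‖ := by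
  obtain ⟨C, hC, h⟩ := poincare_test Ω
  refine ⟨C, hC, fun u => ?_⟩
  have hcl : IsClosed {z : Lp (Vec N) 2 (vol Ω) × Lp (Mat N) 2 (vol Ω) | ‖z.1‖ ≤ C * ‖z.2‖} :=
    isClosed_le (by fun_prop) (by fun_prop)
  have hsub : ((LinearMap.range (testGraph Ω)) : Set _) ⊆
      {z : Lp (Vec N) 2 (vol Ω) × Lp (Mat N) 2 (vol Ω) | ‖z.1‖ ≤ C * ‖z.2‖} := by
    rintro _ ⟨φ, rfl⟩
    exact h φ
  exact closure_minimal hsub hcl u.pair.2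

namespace H10

variable {Ω}

/-- The inner product `⟨u, v⟩ = ∫_Ω ∇u : ∇v` on `H^1_0(Ω; ℝ^N)`. -/
instance instCore : InnerProductSpace.Core ℝ (H10 Ω) where
  inner u v := ∫ x, inner ℝ (u.grad x) (v.grad x) ∂(vol Ω)
  conj_inner_symm u v := by
    simp only [real_inner_comm, conj_trivial]
  re_inner_nonneg u := integral_nonneg fun x => real_inner_self_nonneg
  add_left u v w := by
    have h := inner_add_left (𝕜 := ℝ) u.grad v.grad w.grad
    simp only [L2.inner_def] at h
    exact h
  smul_left u v r := by
    have h := inner_smul_left (𝕜 := ℝ) u.grad v.grad r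
    simp only [L2.inner_def] at h
    exact h
  definite u hu := by
    have h : inner ℝ u.grad u.grad = 0 := by
      rw [L2.inner_def]; exact hu
    have hg : u.grad = 0 := inner_self_eq_zero.mp h
    obtain ⟨C, -, hC⟩ := poincare Ω
    have hf : u.field = 0 := by
      have := hC u
      rw [hg, norm_zero, mul_zero] at this
      exact norm_le_zero_iff.mp this
    exact (equivGraph Ω).injective (Subtype.ext (Prod.ext hf hg))

instance : NormedAddCommGroup (H10 Ω) := InnerProductSpace.Core.toNormedAddCommGroup (𝕜 := ℝ)

instance : InnerProductSpace ℝ (H10 Ω) := InnerProductSpace.ofCore _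

theorem inner_def (u v : H10 Ω) :
    inner ℝ u v = ∫ x, inner ℝ (u.grad x) (v.grad x) ∂(vol Ω) := rfl

theorem norm_grad (u : H10 Ω) : ‖u.grad‖ = ‖u‖ := by
  have h : inner ℝ u.grad u.grad = inner ℝ u u := by rw [L2.inner_def, inner_def]
  rw [real_inner_self_eq_norm_sq, real_inner_self_eq_norm_sq] at h
  exact (sq_eq_sq₀ (norm_nonneg _) (norm_nonneg _)).mp h

theorem norm_sq_eq (u : H10 Ω) : ‖u‖ ^ 2 = ∫ x, ‖u.grad x‖ ^ 2 ∂(vol Ω) := by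
  rw [← real_inner_self_eq_norm_sq, inner_def]
  simp only [real_inner_self_eq_norm_sq]

/-- `u ↦ ∇u` as a linear isometry. -/
def gradL : H10 Ω →ₗᵢ[ℝ] Lp (Mat N) 2 (vol Ω) where
  toFun := grad
  map_add' _ _ := rfl
  map_smul' _ _ := rfl
  norm_map' := norm_grad

instance : CompleteSpace (H10 Ω) := by
  obtain ⟨C, hC0, hC⟩ := poincare Ω
  let e : H10 Ω ≃ₗ[ℝ] H10Graph Ω :=
    { equivGraph Ω with
      map_add' := fun _ _ => rfl
      map_smul' := fun _ _ => rfl }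
  have h1 : ∀ u, ‖e u‖ ≤ max C 1 * ‖u‖ := fun u => by
    change max ‖u.field‖ ‖u.grad‖ ≤ _
    have := hC u
    rw [norm_grad] at this ⊢
    refine max_le (this.trans ?_) ?_
    · exact mul_le_mul_of_nonneg_right (le_max_left _ _) (norm_nonneg _)
    · exact le_mul_of_one_le_left (norm_nonneg _) (le_max_right _ _)
  have h2 : ∀ z, ‖e.symm z‖ ≤ 1 * ‖z‖ := fun z => by
    rw [← norm_grad, one_mul]
    exact le_max_right ‖(e.symm z).field‖ ‖(e.symm z).grad‖
  let e' := e.toContinuousLinearEquivOfBounds _ _ h1 h2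
  have : CompleteSpace (H10Graph Ω) :=
    (Submodule.isClosed_topologicalClosure _).completeSpace_coe
  exact (completeSpace_congr (e := e'.toEquiv) e'.isUniformEmbedding).mpr this

end H10

/-! ### Divergence-free fields -/

/-- The trace of a matrix, as a continuous linear functional. -/
def traceL (N : ℕ) : Mat N →L[ℝ] ℝ :=
  ∑ i : Fin N, (EuclideanSpace.proj i : Vec N →L[ℝ] ℝ) ∘L PiLp.proj 2 (fun _ : Fin N => Vec N) i

theorem traceL_apply (A : Mat N) : traceL N A = ∑ i, A i i := by
  simp [traceL]

/-- The weak divergence `div u = ∑ i, ∂u_i/∂x_i` of a field in `H^1_0(Ω; ℝ^N)`. -/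
def divL : H10 Ω →L[ℝ] Lp ℝ 2 (vol Ω) :=
  ((traceL N).compLpL 2 (vol Ω)) ∘L H10.gradL.toContinuousLinearMap

/-- `𝔻 = H^1_{0,div}(Ω; ℝ^N) = {u ∈ H^1_0(Ω; ℝ^N) : div u = 0 in Ω}`. -/
def Solenoidal : Submodule ℝ (H10 Ω) := LinearMap.ker (divL Ω : H10 Ω →ₗ[ℝ] Lp ℝ 2 (vol Ω))

instance : CompleteSpace (Solenoidal Ω) :=
  (ContinuousLinearMap.isClosed_ker (divL Ω)).completeSpace_coe

/-- `H^{-1}(Ω; ℝ^N)`, the dual of `H^1_0(Ω; ℝ^N)`, with the dual norm. -/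
abbrev HNegOne : Type := H10 Ω →L[ℝ] ℝ

/-! ### The steady Navier–Stokes system and the residual -/

/-- The tensor product `a ⊗ b`. -/
def tensor (a b : Vec N) : Mat N := WithLp.toLp 2 fun j => a j • b

variable {Ω}

/-- `(u, p)` is a weak solution of `-ν Δu + div (u ⊗ u) + ∇p = f`, `div u = 0` in `Ω`, with
`p ∈ L²(Ω)` of vanishing average. -/
def IsWeakSolution (ν : ℝ) (f : HNegOne Ω) (u : Solenoidal Ω) (p : Lp ℝ 2 (vol Ω)) : Prop :=
  ∫ x, p x ∂(vol Ω) = 0 ∧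
  ∀ v : H10 Ω,
    ∫ x, (ν * inner ℝ (u.1.grad x) (v.grad x)
        - inner ℝ (tensor (u.1.field x) (u.1.field x)) (v.grad x)
        - p x * divL Ω v x) ∂(vol Ω) = f v

/-- The functional minimized by the residual of `u`:
`V ↦ ∫_Ω [½ |∇V|² + (ν ∇u - u ⊗ u) : ∇V] - ⟨f, V⟩`. -/
def residualFunctional (ν : ℝ) (f : HNegOne Ω) (u V : Solenoidal Ω) : ℝ :=
  ∫ x, (1 / 2 * ‖V.1.grad x‖ ^ 2
      + inner ℝ (ν • u.1.grad x - tensor (u.1.field x) (u.1.field x)) (V.1.grad x)) ∂(vol Ω)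
    - f V

/-- `U` minimizes the above functional over `𝔻`. -/
def IsResidual (ν : ℝ) (f : HNegOne Ω) (u U : Solenoidal Ω) : Prop :=
  ∀ V : Solenoidal Ω, residualFunctional ν f u U ≤ residualFunctional ν f u V

/-- The residual `U` of `u` (a choice of a minimizer). -/
def residual (ν : ℝ) (f : HNegOne Ω) (u : Solenoidal Ω) : Solenoidal Ω :=
  Classical.epsilon (IsResidual ν f u)

/-- `E(u) = ½ ∫_Ω |∇U|²` where `U` is the residual of `u`. -/
def energy (ν : ℝ) (f : HNegOne Ω) (u : Solenoidal Ω) : ℝ :=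
  1 / 2 * ∫ x, ‖(residual ν f u).1.grad x‖ ^ 2 ∂(vol Ω)

/-! ### Error functionals -/

/-- `E` is an error functional on the Hilbert space `H`, with threshold `c ∈ (0, ∞]` and coercivity
constant `C`: it is nonnegative and `C¹`, `E(u) → 0` as `E'(u) → 0` over bounded sets, and
`‖u - v‖² ≤ C (E(u) + E(v))` on the sub-level set `{E ≤ c}`. -/
structure IsErrorFunctionalWith {H : Type*} [NormedAddCommGroup H] [InnerProductSpace ℝ H]
    [CompleteSpace H] (E : H → ℝ) (c : ℝ≥0∞) (C : ℝ) : Prop where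
  nonneg : ∀ u, 0 ≤ E u
  contDiff : ContDiff ℝ 1 E
  threshold_pos : 0 < c
  const_pos : 0 < C
  tendsto_of_deriv : ∀ S : Set H, Bornology.IsBounded S →
    Tendsto E (comap (fun u => ‖fderiv ℝ E u‖) (𝓝 0) ⊓ 𝓟 S) (𝓝 0)
  coercive : ∀ u v, ENNReal.ofReal (E u) ≤ c → ENNReal.ofReal (E v) ≤ c →
    ‖u - v‖ ^ 2 ≤ C * (E u + E v)

end SteadyNS

end

/-! On `𝔻`, let `F` be the Riesz representative of `f` and let `B` be the bilinear map with
`⟨B(u,v), w⟩ = ∫ (u ⊗ v) : ∇w`. Completing the square in the functional shows that its only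
minimizer is `X(u) = F - ν u + B(u,u)` (`residualFunctional_eq`). So `E = ½‖X‖²`, and the velocities
of weak solutions are exactly the zeros of `X`. Two properties of `B` carry everything: `‖B(u,v)‖ ≤
K‖u‖‖v‖`, from the embedding of `H¹₀` into `L⁴` for `N ≤ 4`, and `⟨B(u,v), v⟩ = 0`, since `(u ⊗ v) :
∇v = u · ∇(|v|²/2)` and `div u = 0`.

Under `‖F‖ ≤ ν²/(8K)` the error functional is then a matter of Hilbert space algebra. Pairing `X(u)`
with `u` makes `u` small on a sublevel set, and pairing `X(u) - X(v)` with `u - v` gives coercivity.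
For the derivative, `E'(u)u` controls `‖u‖` whatever its size, and once `u` is small, `E'(u)X(u) ≤
-(ν/2)‖X(u)‖²`, so a small derivative forces a small residual. A zero of `X` exists by contraction;
its uniqueness and claim 3 are coercivity at zero energy.

The pressure rests on `‖p‖ ≤ C‖∇p‖` (the norm of `H⁻¹` on the right) for `p` of vanishing average
(`exists_norm_le_norm_gradAdj`). Let `w` in `H¹₀` satisfy `⟨w, v⟩ = ∫ p div v`. Then `div w` is
controlled by `w`, and `h = p - div w` is harmonic. The value of `|∇h|²` at `x` is bounded by
`r^{-(N+2)}` times the integral of `|∇w|²` over `B(x, r)`. Near the boundary, `∇h` weighted by the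
height above the graph is therefore in `L²`; a Hardy inequality on segments transversal to the
boundary compares `h` with its values in a compact subset, and connectedness handles the interior.
The estimate gives closed range, hence a pressure, and injectivity, hence its uniqueness. -/

noncomputable section

namespace SteadyNS

section

/-! ### The residual energy of a quadratic equation in a Hilbert space -/

section QuadraticEquation

variable {H : Type*} [NormedAddCommGroup H] [InnerProductSpace ℝ H]

/-- The residual `F - ν u + B(u, u)` of the equation `ν u = F + B(u, u)`. -/
def quadResidual (ν : ℝ) (F : H) (B : H →L[ℝ] H →L[ℝ] H) (u : H) : H := F - ν • u + B u u

variable {ν : ℝ} {F : H} {B : H →L[ℝ] H →L[ℝ] H}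

theorem hasFDerivAt_quadResidual (u : H) :
    HasFDerivAt (quadResidual ν F B)
      (-(ν • ContinuousLinearMap.id ℝ H) + (B u + B.flip u)) u := by
  have h1 : HasFDerivAt (fun u => B u u) (B u + B.flip u) u := by
    have := B.hasFDerivAt_of_bilinear (hasFDerivAt_id u) (hasFDerivAt_id u)
    refine this.congr_fderiv ?_
    ext h
    simp [ContinuousLinearMap.precompR, ContinuousLinearMap.precompL]
  have h2 : HasFDerivAt (fun u : H => F - ν • u) (-(ν • ContinuousLinearMap.id ℝ H)) u :=
    ((hasFDerivAt_id u).const_smul ν).const_sub F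
  exact h2.add h1

theorem contDiff_quadResidual_energy :
    ContDiff ℝ 1 fun u => 1 / 2 * ‖quadResidual ν F B u‖ ^ 2 := by
  have : ContDiff ℝ 1 (quadResidual ν F B) :=
    (contDiff_const.sub (contDiff_const.smul contDiff_id)).add
      ((B.contDiff.comp contDiff_id).clm_apply contDiff_id)
  exact contDiff_const.mul (this.norm_sq ℝ)

theorem fderiv_quadResidual_energy (u h : H) :
    fderiv ℝ (fun u => 1 / 2 * ‖quadResidual ν F B u‖ ^ 2) u h =
      inner ℝ (quadResidual ν F B u) (-(ν • h) + (B u h + B h u)) := by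
  have h1 := ((hasFDerivAt_quadResidual (ν := ν) (F := F) (B := B) u).norm_sq).const_mul (1 / 2)
  rw [h1.fderiv]
  simp [inner_add_right, inner_neg_right, inner_smul_right]

variable {K : ℝ} (hν : 0 < ν) (hK : 0 < K) (hB : ∀ u v, ‖B u v‖ ≤ K * ‖u‖ * ‖v‖)
  (hB0 : ∀ u v, inner ℝ (B u v) v = 0)

include hB0 in
-- The energy estimate: pairing `F - X(u) = ν u - B(u,u)` with `u` removes the quadratic term. The
-- residual acts as an additional force, and `u` need not be small.
theorem norm_le_of_quadResidual (u : H) : ν * ‖u‖ ≤ ‖F‖ + ‖quadResidual ν F B u‖ := by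
  rcases eq_or_ne u 0 with rfl | hu
  · rw [norm_zero, mul_zero]; positivity
  have hu' : 0 < ‖u‖ := norm_pos_iff.mpr hu
  have h1 : inner ℝ (F - quadResidual ν F B u) u = ν * ‖u‖ ^ 2 := by
    have : F - quadResidual ν F B u = ν • u - B u u := by simp only [quadResidual]; abel
    rw [this, inner_sub_left, hB0, inner_smul_left, real_inner_self_eq_norm_sq]
    simp
  have h2 := real_inner_le_norm (F - quadResidual ν F B u) u
  have h3 := norm_sub_le F (quadResidual ν F B u)
  rw [h1] at h2
  have h4 : ν * ‖u‖ ≤ ‖F - quadResidual ν F B u‖ := by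
    refine le_of_mul_le_mul_right ?_ hu'
    linarith
  linarith

include hB hB0 in
-- With `w = u - v`, `X(u) - X(v) = -ν w + B(w,u) + B(v,w)`, and pairing with `w` removes `B(v,w)`.
-- Only `u` has to be small; `v` is arbitrary.
theorem norm_sub_le_of_quadResidual {u v : H} (hu : K * ‖u‖ ≤ ν / 2) :
    ν * ‖u - v‖ ≤ 2 * (‖quadResidual ν F B u‖ + ‖quadResidual ν F B v‖) := by
  rcases eq_or_ne (u - v) 0 with h0 | h0
  · rw [h0, norm_zero, mul_zero]; positivity
  set w := u - v with hw
  have hw' : 0 < ‖w‖ := norm_pos_iff.mpr h0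
  have h1 : inner ℝ (quadResidual ν F B u - quadResidual ν F B v) w =
      -(ν * ‖w‖ ^ 2) + inner ℝ (B w u) w := by
    have : quadResidual ν F B u - quadResidual ν F B v = -(ν • w) + (B w u + B v w) := by
      simp only [quadResidual, hw, map_sub, smul_sub, sub_apply]; abel
    rw [this, inner_add_left, inner_add_left, hB0, inner_neg_left, inner_smul_left,
      real_inner_self_eq_norm_sq]
    simp
  have h2 := neg_le_of_abs_le (abs_real_inner_le_norm (quadResidual ν F B u - quadResidual ν F B v) w)
  have h3 := norm_sub_le (quadResidual ν F B u) (quadResidual ν F B v)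
  have h4 : inner ℝ (B w u) w ≤ ν / 2 * ‖w‖ ^ 2 := by
    calc inner ℝ (B w u) w ≤ ‖B w u‖ * ‖w‖ := real_inner_le_norm _ _
      _ ≤ (K * ‖w‖ * ‖u‖) * ‖w‖ := by gcongr; exact hB w u
      _ = (K * ‖u‖) * ‖w‖ ^ 2 := by ring
      _ ≤ _ := by gcongr
  have h5 : ν / 2 * ‖w‖ ≤ ‖quadResidual ν F B u - quadResidual ν F B v‖ := by
    refine le_of_mul_le_mul_right ?_ hw'
    rw [h1] at h2
    nlinarith
  linarith

include hν hB0 in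
-- In the direction `u` the products of `u` with `B(u,u)` vanish. The remaining quartic term
-- `2‖B(u,u)‖²` has the good sign and absorbs `2⟨F, B(u,u)⟩` by completing the square, so the
-- derivative is coercive for `u` of any size.
theorem fderiv_quadResidual_energy_self (u : H) :
    ν ^ 2 * ‖u‖ ^ 2 - ν * ‖F‖ * ‖u‖ - ‖F‖ ^ 2 / 2 ≤
      fderiv ℝ (fun u => 1 / 2 * ‖quadResidual ν F B u‖ ^ 2) u u := by
  have h0 := hB0 u u
  have h0' : inner ℝ u (B u u) = 0 := by rw [real_inner_comm]; exact h0
  have e : fderiv ℝ (fun u => 1 / 2 * ‖quadResidual ν F B u‖ ^ 2) u u =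
      ν ^ 2 * ‖u‖ ^ 2 - ν * inner ℝ F u + 2 * ‖B u u‖ ^ 2 + 2 * inner ℝ F (B u u) := by
    rw [fderiv_quadResidual_energy]
    simp only [quadResidual, inner_add_left, inner_sub_left, inner_add_right, inner_neg_right,
      inner_smul_left, inner_smul_right, h0, h0', real_inner_self_eq_norm_sq, conj_trivial]
    ring
  have h2 := neg_le_of_abs_le (abs_real_inner_le_norm F (B u u))
  have h3 : ν * inner ℝ F u ≤ ν * (‖F‖ * ‖u‖) := by gcongr; exact real_inner_le_norm F u
  rw [e]
  nlinarith [sq_nonneg (‖F‖ - 2 * ‖B u u‖)]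

include hν hK hB hB0 in
/-- Small derivatives of the energy at bounded points force small residuals. -/
theorem quadResidual_le_of_fderiv_small (hF : ‖F‖ ≤ ν ^ 2 / (8 * K)) {u : H}
    {R ε : ℝ} (hR : ‖u‖ ≤ R) (hε : ‖fderiv ℝ (fun u => 1 / 2 * ‖quadResidual ν F B u‖ ^ 2) u‖ ≤ ε)
    (hεR : ε * R ≤ ν ^ 4 / (16 * K ^ 2)) : ν * ‖quadResidual ν F B u‖ ≤ 2 * ε := by
  set E' := fderiv ℝ (fun u => 1 / 2 * ‖quadResidual ν F B u‖ ^ 2) u with hE'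
  have hε0 : 0 ≤ ε := (norm_nonneg _).trans hε
  have hle : ∀ h, |E' h| ≤ ε * ‖h‖ := fun h => E'.le_of_opNorm_le hε h
  have h1 := fderiv_quadResidual_energy_self (ν := ν) (F := F) hν hB0 u
  rw [← hE'] at h1
  have h2 : E' u ≤ ν ^ 4 / (16 * K ^ 2) := by
    refine (le_abs_self _).trans ((hle u).trans (le_trans ?_ hεR))
    gcongr
  have hF2 : ‖F‖ ^ 2 ≤ ν ^ 4 / (64 * K ^ 2) := by
    calc ‖F‖ ^ 2 ≤ (ν ^ 2 / (8 * K)) ^ 2 := by gcongr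
      _ = _ := by rw [div_pow]; ring
  -- Young's inequality on `ν‖F‖‖u‖` leaves `ν²‖u‖²` at most `5/2` times `ν⁴/(16K²)`. The rounded
  -- factor 4 is what `K‖u‖ ≤ ν/2` requires.
  have h3 : ν ^ 2 * ‖u‖ ^ 2 ≤ ν ^ 4 / (4 * K ^ 2) := by
    have e1 : ν ^ 4 / (4 * K ^ 2) = 4 * (ν ^ 4 / (16 * K ^ 2)) := by field_simp; norm_num
    have e2 : ν ^ 4 / (64 * K ^ 2) = 1 / 4 * (ν ^ 4 / (16 * K ^ 2)) := by field_simp; norm_num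
    have e3 : 0 ≤ ν ^ 4 / (16 * K ^ 2) := by positivity
    rw [e2] at hF2
    rw [e1]
    nlinarith [sq_nonneg (ν * ‖u‖ - ‖F‖)]
  have h4 : K * ‖u‖ ≤ ν / 2 := by
    refine abs_le_of_sq_le_sq' ?_ (by positivity) |>.2
    have : (K * ‖u‖) ^ 2 = K ^ 2 / ν ^ 2 * (ν ^ 2 * ‖u‖ ^ 2) := by field_simp
    rw [this]
    calc _ ≤ K ^ 2 / ν ^ 2 * (ν ^ 4 / (4 * K ^ 2)) := by gcongr
      _ = _ := by field_simp; norm_num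
  set U := quadResidual ν F B u with hU
  rcases eq_or_ne U 0 with hU0 | hU0
  · rw [hU0, norm_zero, mul_zero]; positivity
  have hU' : 0 < ‖U‖ := norm_pos_iff.mpr hU0
  -- The second test direction is the residual itself: `B u U` is orthogonal to `U`, and `K‖u‖ ≤
  -- ν/2` lets `-ν‖U‖²` dominate `⟨U, B U u⟩`.
  have h5 : E' U = -(ν * ‖U‖ ^ 2) + inner ℝ U (B U u) := by
    rw [hE', fderiv_quadResidual_energy, ← hU]
    have : inner ℝ U (B u U) = 0 := by rw [real_inner_comm]; exact hB0 _ _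
    simp only [inner_add_right, inner_neg_right, inner_smul_right, this,
      real_inner_self_eq_norm_sq, zero_add]
  have h6 : inner ℝ U (B U u) ≤ ν / 2 * ‖U‖ ^ 2 := by
    calc inner ℝ U (B U u) ≤ ‖U‖ * ‖B U u‖ := real_inner_le_norm _ _
      _ ≤ ‖U‖ * (K * ‖U‖ * ‖u‖) := by gcongr; exact hB U u
      _ = (K * ‖u‖) * ‖U‖ ^ 2 := by ring
      _ ≤ _ := by gcongr
  have h7 := neg_le_of_abs_le (hle U)
  refine le_of_mul_le_mul_right ?_ hU'
  rw [h5] at h7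
  nlinarith

include hν hK hB hB0 in
-- The threshold is the level at which `‖X(u)‖` obeys the bound imposed on `‖F‖`. The energy
-- estimate then yields `K‖u‖ ≤ ν/4`, half of what stability allows. The constant comes from `ν²‖u -
-- v‖² ≤ 4(a + b)² ≤ 8(a² + b²)` with `a² = 2E(u)` and `b² = 2E(v)`.
theorem isErrorFunctionalWith_quadResidual [CompleteSpace H] (hF : ‖F‖ ≤ ν ^ 2 / (8 * K)) :
    IsErrorFunctionalWith (fun u => 1 / 2 * ‖quadResidual ν F B u‖ ^ 2)
      (ENNReal.ofReal (1 / 2 * (ν ^ 2 / (8 * K)) ^ 2)) (16 / ν ^ 2) where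
  nonneg u := by positivity
  contDiff := contDiff_quadResidual_energy
  threshold_pos := ENNReal.ofReal_pos.mpr (by positivity)
  const_pos := by positivity
  tendsto_of_deriv S hS := by
    obtain ⟨R, hR0, hR⟩ := hS.exists_pos_norm_le
    rw [Metric.tendsto_nhds]
    intro η hη
    -- The first bound makes the derivative estimate applicable on `S`; the second turns its
    -- conclusion into `‖X(u)‖ ≤ √η`, hence `E(u) ≤ η/2`.
    obtain ⟨ε, hε, h1, h2⟩ : ∃ ε : ℝ, 0 < ε ∧ ε * R ≤ ν ^ 4 / (16 * K ^ 2) ∧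
        2 * ε ≤ ν * Real.sqrt η := by
      have a1 : 0 < ν ^ 4 / (16 * K ^ 2) / R := by positivity
      have a2 : 0 < ν * Real.sqrt η / 2 := by positivity
      refine ⟨min _ _, lt_min a1 a2, ?_, ?_⟩
      · rw [← le_div_iff₀ hR0]; exact min_le_left _ _
      · have := min_le_right (ν ^ 4 / (16 * K ^ 2) / R) (ν * Real.sqrt η / 2)
        linarith
    have hcomap : ∀ᶠ u in comap (fun u => ‖fderiv ℝ
        (fun u => 1 / 2 * ‖quadResidual ν F B u‖ ^ 2) u‖) (𝓝 0) ⊓ 𝓟 S,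
        ‖fderiv ℝ (fun u => 1 / 2 * ‖quadResidual ν F B u‖ ^ 2) u‖ ≤ ε ∧ u ∈ S := by
      refine Filter.Eventually.and ?_ ?_
      · exact Filter.Eventually.filter_mono inf_le_left
          ((eventually_le_nhds hε).comap _)
      · exact Filter.Eventually.filter_mono inf_le_right (mem_principal_self S)
    filter_upwards [hcomap] with u hu
    have h3 := quadResidual_le_of_fderiv_small hν hK hB hB0 hF (hR u hu.2) hu.1 h1
    have h4 : ‖quadResidual ν F B u‖ ≤ Real.sqrt η :=
      le_of_mul_le_mul_left (h3.trans h2) hν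
    have h5 : ‖quadResidual ν F B u‖ ^ 2 ≤ η := by
      calc _ ≤ Real.sqrt η ^ 2 := by gcongr
        _ = η := Real.sq_sqrt hη.le
    rw [Real.dist_eq, sub_zero, abs_of_nonneg (by positivity)]
    linarith
  coercive u v hu _ := by
    rw [ENNReal.ofReal_le_ofReal_iff (by positivity)] at hu
    have h1 : ‖quadResidual ν F B u‖ ≤ ν ^ 2 / (8 * K) :=
      abs_le_of_sq_le_sq' (by linarith) (by positivity) |>.2
    have h2 := norm_le_of_quadResidual (ν := ν) (F := F) hB0 u
    have h3 : K * ‖u‖ ≤ ν / 2 := by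
      have e : ν ^ 2 / (8 * K) + ν ^ 2 / (8 * K) = ν / K * (ν / 4) := by field_simp; norm_num
      have h4 : ν * ‖u‖ ≤ ν / K * (ν / 4) := by linarith
      have h5 : K / ν * (ν * ‖u‖) ≤ K / ν * (ν / K * (ν / 4)) := by gcongr
      have e1 : K / ν * (ν * ‖u‖) = K * ‖u‖ := by field_simp
      have e2 : K / ν * (ν / K * (ν / 4)) = ν / 4 := by field_simp
      rw [e1, e2] at h5
      linarith
    have h4 := norm_sub_le_of_quadResidual (F := F) (v := v) hB hB0 h3
    set a := ‖quadResidual ν F B u‖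
    set b := ‖quadResidual ν F B v‖
    have h5 : (ν * ‖u - v‖) ^ 2 ≤ 8 * (a ^ 2 + b ^ 2) := by
      calc (ν * ‖u - v‖) ^ 2 ≤ (2 * (a + b)) ^ 2 := by gcongr
        _ ≤ _ := by nlinarith [sq_nonneg (a - b)]
    have e : ‖u - v‖ ^ 2 = (ν * ‖u - v‖) ^ 2 / ν ^ 2 := by field_simp
    rw [e, div_mul_eq_mul_div]
    gcongr
    linarith

include hν hK hB in
-- Banach's fixed point theorem for `u ↦ ν⁻¹(F + B(u,u))` on the ball of radius `r = ν/(4K)`. The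
-- ball is preserved because `‖F‖ + K r² ≤ 3ν²/(16K) ≤ ν r`, and the contraction factor is `2 K r/ν
-- = 1/2`.
theorem exists_quadResidual_eq_zero [CompleteSpace H] (hF : ‖F‖ ≤ ν ^ 2 / (8 * K)) :
    ∃ u, quadResidual ν F B u = 0 := by
  set r := ν / (4 * K) with hr
  have hr0 : 0 < r := by positivity
  let s : Set H := Metric.closedBall 0 r
  let T : H → H := fun u => ν⁻¹ • (F + B u u)
  have hmaps : Set.MapsTo T s s := fun u hu => by
    simp only [s, mem_closedBall_zero_iff] at hu ⊢
    have h1 : ‖B u u‖ ≤ K * r * r := (hB u u).trans (by gcongr)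
    have h2 := norm_add_le F (B u u)
    rw [norm_smul, norm_inv, Real.norm_of_nonneg hν.le, inv_mul_le_iff₀ hν]
    have e1 : K * r * r = ν ^ 2 / (16 * K) := by rw [hr]; field_simp; norm_num
    have e2 : ν * r = ν ^ 2 / (8 * K) + 2 * (ν ^ 2 / (16 * K)) := by
      rw [hr]; field_simp; norm_num
    have e3 : 0 ≤ ν ^ 2 / (16 * K) := by positivity
    linarith
  have hlip : ∀ u ∈ s, ∀ v ∈ s, ‖T u - T v‖ ≤ 1 / 2 * ‖u - v‖ := fun u hu v hv => by
    simp only [s, mem_closedBall_zero_iff] at hu hv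
    have e : T u - T v = ν⁻¹ • (B (u - v) u + B v (u - v)) := by
      simp only [T, ← smul_sub, map_sub, sub_apply]; congr 1; abel
    rw [e, norm_smul, norm_inv, Real.norm_of_nonneg hν.le, inv_mul_le_iff₀ hν]
    have h1 : ‖B (u - v) u‖ ≤ K * ‖u - v‖ * r := (hB _ _).trans (by gcongr)
    have h2 : ‖B v (u - v)‖ ≤ K * r * ‖u - v‖ := (hB _ _).trans (by gcongr)
    have h3 := norm_add_le (B (u - v) u) (B v (u - v))
    have e1 : K * r = ν / 4 := by rw [hr]; field_simp
    rw [e1] at h2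
    rw [mul_right_comm, e1] at h1
    linarith
  have hc : ContractingWith (1 / 2) (hmaps.restrict T s s) := by
    refine ⟨by rw [← NNReal.coe_lt_coe]; norm_num, LipschitzWith.of_dist_le_mul fun u v => ?_⟩
    simp only [Subtype.dist_eq, dist_eq_norm, Set.MapsTo.val_restrict_apply]
    simpa using hlip u u.2 v v.2
  obtain ⟨u, -, hu, -⟩ := hc.exists_fixedPoint' (Metric.isClosed_closedBall.isComplete) hmaps
    (Metric.mem_closedBall_self hr0.le) (edist_ne_top _ _)
  refine ⟨u, ?_⟩
  have h : ν⁻¹ • (F + B u u) = u := hu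
  have h' : F + B u u = ν • u := by rw [← h, smul_smul, mul_inv_cancel₀ hν.ne', one_smul]; simp [h]
  simp only [quadResidual]
  rw [sub_add_eq_add_sub, h', sub_self]

end QuadraticEquation

end

section

/-! ### A Hardy inequality along rays -/

/-- One of the two weight integrals behind the Hardy inequality; the bound is uniform in the length
`ρ`. -/
theorem lintegral_rpow_neg_three_halves_le {τ ρ : ℝ} (hτ : 0 < τ) (hρ : 0 ≤ ρ) :
    ∫⁻ s in Set.Ioc 0 ρ, ENNReal.ofReal ((τ + s) ^ (-(3 / 2) : ℝ)) ≤
      ENNReal.ofReal (2 * τ ^ (-(1 / 2) : ℝ)) := by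
  have hne : (0 : ℝ) ∉ Set.uIcc τ (τ + ρ) := by
    rw [Set.uIcc_of_le (by linarith)]; intro h; linarith [h.1]
  have hint : IntervalIntegrable (fun s : ℝ => (τ + s) ^ (-(3 / 2) : ℝ)) volume 0 ρ := by
    have := (intervalIntegral.intervalIntegrable_rpow (μ := volume) (r := (-(3 / 2) : ℝ))
      (Or.inr hne)).comp_add_left τ
    simpa using this
  rw [← ofReal_integral_eq_lintegral_ofReal hint.1
    ((ae_restrict_mem measurableSet_Ioc).mono fun s hs => by have := hs.1; positivity)]
  refine ENNReal.ofReal_le_ofReal ?_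
  rw [← intervalIntegral.integral_of_le hρ,
    intervalIntegral.integral_comp_add_left (fun s : ℝ => s ^ (-(3 / 2) : ℝ)) τ,
    integral_rpow (Or.inr ⟨by norm_num, by simpa using hne⟩)]
  have : 0 ≤ (τ + ρ) ^ (-(1 / 2) : ℝ) := by positivity
  norm_num at this ⊢
  linarith

theorem lintegral_rpow_neg_half_le {T : ℝ} (hT : 0 ≤ T) :
    ∫⁻ s in Set.Ioc 0 T, ENNReal.ofReal ((T - s) ^ (-(1 / 2) : ℝ)) ≤
      ENNReal.ofReal (2 * T ^ (1 / 2 : ℝ)) := by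
  have hint : IntervalIntegrable (fun s : ℝ => (T - s) ^ (-(1 / 2) : ℝ)) volume 0 T := by
    have := (intervalIntegral.intervalIntegrable_rpow' (a := T) (b := 0) (r := (-(1 / 2) : ℝ))
      (by norm_num)).comp_sub_left T
    simpa using this
  rw [← ofReal_integral_eq_lintegral_ofReal hint.1
    ((ae_restrict_mem measurableSet_Ioc).mono fun s hs => by
      have := sub_nonneg.mpr hs.2; positivity)]
  refine ENNReal.ofReal_le_ofReal ?_
  rw [← intervalIntegral.integral_of_le hT,
    intervalIntegral.integral_comp_sub_left (fun s : ℝ => s ^ (-(1 / 2) : ℝ)) T,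
    integral_rpow (Or.inl (by norm_num))]
  norm_num
  linarith

theorem sq_lintegral_mul_le {α : Type*} [MeasurableSpace α] (μ : Measure α) {f g : α → ℝ≥0∞}
    (hf : AEMeasurable f μ) (hg : AEMeasurable g μ) :
    (∫⁻ a, f a * g a ∂μ) ^ 2 ≤ (∫⁻ a, f a ^ 2 ∂μ) * ∫⁻ a, g a ^ 2 ∂μ := by
  have h := ENNReal.lintegral_mul_le_Lp_mul_Lq μ Real.HolderConjugate.two_two hf hg
  calc (∫⁻ a, f a * g a ∂μ) ^ 2 ≤ ((∫⁻ a, f a ^ (2 : ℝ) ∂μ) ^ (1 / 2 : ℝ) *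
        (∫⁻ a, g a ^ (2 : ℝ) ∂μ) ^ (1 / 2 : ℝ)) ^ 2 := by gcongr; exact h
    _ = _ := by
      rw [mul_pow, ← ENNReal.rpow_natCast, ← ENNReal.rpow_natCast, ← ENNReal.rpow_mul,
        ← ENNReal.rpow_mul]
      norm_num

variable {N : ℕ}

/-- Hardy's inequality for integrals over the segments `[y, y + ρ e]`, where `T` is a height
function in the direction `e`. -/
theorem lintegral_sq_lintegral_segment_le {T : Vec N → ℝ} (hTm : Measurable T) {e : Vec N}
    (hT : ∀ y s, T (y + s • e) = T y + s) {V U : Set (Vec N)} (hV : MeasurableSet V)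
    (hU : MeasurableSet U) {ρ : ℝ} (hρ : 0 ≤ ρ) (hpos : ∀ y ∈ V, 0 < T y)
    (hVU : ∀ y ∈ V, ∀ s ∈ Set.Ioc 0 ρ, y + s • e ∈ U) {g : Vec N → ℝ≥0∞} (hg : Measurable g) :
    ∫⁻ y in V, (∫⁻ s in Set.Ioc 0 ρ, g (y + s • e)) ^ 2 ≤
      4 * ∫⁻ z in U, ENNReal.ofReal (T z) ^ 2 * g z ^ 2 := by
  set φ : Vec N → ℝ≥0∞ := fun z => ENNReal.ofReal (T z ^ (3 / 2 : ℝ)) * g z ^ 2 with hφ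
  have hφm : Measurable φ := ((hTm.pow_const _).ennreal_ofReal).mul (hg.pow_const _)
  have hadd : Measurable fun p : Vec N × ℝ => p.1 + p.2 • e := by fun_prop
  -- Cauchy–Schwarz on each segment
  have h1 : ∀ y ∈ V, (∫⁻ s in Set.Ioc 0 ρ, g (y + s • e)) ^ 2 ≤
      2 * (ENNReal.ofReal (T y ^ (-(1 / 2) : ℝ)) * ∫⁻ s in Set.Ioc 0 ρ, φ (y + s • e)) := by
    intro y hy
    have hy0 := hpos y hy
    have hmy : Measurable fun s : ℝ => y + s • e := by fun_prop
    -- Cauchy–Schwarz with weights `(T y + s)^{±3/4}`. The squared exponent `3/2` lies strictly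
    -- between 1 and 2: above 1, the integral over `s` is uniform in `ρ`; below 2, the power of the
    -- height left over is integrable at zero in the second integration.
    have e1 : ∫⁻ s in Set.Ioc 0 ρ, g (y + s • e) = ∫⁻ s in Set.Ioc 0 ρ,
        ENNReal.ofReal ((T y + s) ^ (-(3 / 4) : ℝ)) *
          (ENNReal.ofReal ((T y + s) ^ (3 / 4 : ℝ)) * g (y + s • e)) := by
      refine setLIntegral_congr_fun measurableSet_Ioc fun s hs => ?_
      have : 0 < T y + s := by linarith [hs.1]
      rw [← mul_assoc, ← ENNReal.ofReal_mul (by positivity), ← Real.rpow_add this]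
      norm_num
    rw [e1]
    refine (sq_lintegral_mul_le _ (by fun_prop)
      ((by fun_prop : AEMeasurable (fun s : ℝ => ENNReal.ofReal ((T y + s) ^ (3 / 4 : ℝ))) _).mul
        (hg.comp hmy).aemeasurable)).trans ?_
    have e2 : ∫⁻ s in Set.Ioc 0 ρ, ENNReal.ofReal ((T y + s) ^ (-(3 / 4) : ℝ)) ^ 2 ≤
        2 * ENNReal.ofReal (T y ^ (-(1 / 2) : ℝ)) := by
      refine le_trans (le_of_eq ?_) ((lintegral_rpow_neg_three_halves_le hy0 hρ).trans_eq ?_)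
      · refine setLIntegral_congr_fun measurableSet_Ioc fun s hs => ?_
        have : 0 < T y + s := by linarith [hs.1]
        rw [← ENNReal.ofReal_pow (by positivity), ← Real.rpow_natCast, ← Real.rpow_mul this.le]
        norm_num
      · rw [ENNReal.ofReal_mul (by norm_num)]; norm_num
    have e3 : ∫⁻ s in Set.Ioc 0 ρ, (ENNReal.ofReal ((T y + s) ^ (3 / 4 : ℝ)) * g (y + s • e)) ^ 2 =
        ∫⁻ s in Set.Ioc 0 ρ, φ (y + s • e) := by
      refine setLIntegral_congr_fun measurableSet_Ioc fun s hs => ?_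
      have : 0 < T y + s := by linarith [hs.1]
      simp only [hφ, hT]
      rw [mul_pow, ← ENNReal.ofReal_pow (by positivity), ← Real.rpow_natCast,
        ← Real.rpow_mul this.le]
      norm_num
    rw [← mul_assoc]
    exact mul_le_mul' e2 e3.le
  -- Tonelli and a translation
  have h2 : ∫⁻ y in V, ENNReal.ofReal (T y ^ (-(1 / 2) : ℝ)) * ∫⁻ s in Set.Ioc 0 ρ, φ (y + s • e) =
      ∫⁻ z, φ z * ∫⁻ s in Set.Ioc 0 ρ,
        V.indicator (fun y => ENNReal.ofReal (T y ^ (-(1 / 2) : ℝ))) (z - s • e) := by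
    set k := V.indicator (fun y => ENNReal.ofReal (T y ^ (-(1 / 2) : ℝ))) with hk
    have hkm : Measurable k := ((hTm.pow_const _).ennreal_ofReal).indicator hV
    have hsub : Measurable fun p : Vec N × ℝ => p.1 - p.2 • e := by fun_prop
    calc _ = ∫⁻ y, k y * ∫⁻ s in Set.Ioc 0 ρ, φ (y + s • e) := by
          rw [← lintegral_indicator hV]
          refine lintegral_congr fun y => ?_
          by_cases hy : y ∈ V <;> simp [hk, hy]
      _ = ∫⁻ y, ∫⁻ s in Set.Ioc 0 ρ, k y * φ (y + s • e) := by
          refine lintegral_congr fun y => (lintegral_const_mul _ ?_).symm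
          exact hφm.comp (by fun_prop)
      _ = ∫⁻ s in Set.Ioc 0 ρ, ∫⁻ y, k y * φ (y + s • e) := by
          refine lintegral_lintegral_swap ?_
          exact ((hkm.comp measurable_fst).mul (hφm.comp hadd)).aemeasurable
      _ = ∫⁻ s in Set.Ioc 0 ρ, ∫⁻ z, φ z * k (z - s • e) := by
          refine lintegral_congr fun s => ?_
          rw [← lintegral_sub_right_eq_self _ (s • e)]
          simp [mul_comm]
      _ = ∫⁻ z, ∫⁻ s in Set.Ioc 0 ρ, φ z * k (z - s • e) := by
          refine lintegral_lintegral_swap ?_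
          exact ((hφm.comp measurable_snd).mul
            (hkm.comp (hsub.comp measurable_swap))).aemeasurable
      _ = _ := by
          refine lintegral_congr fun z => lintegral_const_mul _ ?_
          exact hkm.comp (by fun_prop)
  -- For fixed `z` only shifts with `T z - s > 0` contribute, so the integral is at most `2 (T
  -- z)^{1/2}`. Multiplied by the weight `(T z)^{3/2}` in `φ`, it restores `(T z)²`.
  have h3 : ∀ z, ∫⁻ s in Set.Ioc 0 ρ,
        V.indicator (fun y => ENNReal.ofReal (T y ^ (-(1 / 2) : ℝ))) (z - s • e) ≤
      U.indicator (fun z => 2 * ENNReal.ofReal (T z ^ (1 / 2 : ℝ))) z := by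
    intro z
    have hTz : ∀ s, T (z - s • e) = T z - s := fun s => by
      rw [sub_eq_add_neg, ← neg_smul, hT]; ring
    by_cases hz : z ∈ U ∧ 0 < T z
    · rw [Set.indicator_of_mem hz.1]
      calc _ ≤ ∫⁻ s in Set.Ioc 0 ρ, (Set.Ioc 0 (T z)).indicator
            (fun s => ENNReal.ofReal ((T z - s) ^ (-(1 / 2) : ℝ))) s := by
            refine setLIntegral_mono' measurableSet_Ioc fun s hs => ?_
            by_cases hv : z - s • e ∈ V
            · have := hpos _ hv
              rw [hTz] at this
              have hs' : s ∈ Set.Ioc 0 (T z) := ⟨hs.1, by linarith⟩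
              rw [Set.indicator_of_mem hv, Set.indicator_of_mem hs', hTz]
            · simp [hv]
        _ ≤ ∫⁻ s, (Set.Ioc 0 (T z)).indicator
            (fun s => ENNReal.ofReal ((T z - s) ^ (-(1 / 2) : ℝ))) s := setLIntegral_le_lintegral _ _
        _ ≤ _ := by
            rw [lintegral_indicator measurableSet_Ioc]
            refine (lintegral_rpow_neg_half_le hz.2.le).trans_eq ?_
            rw [ENNReal.ofReal_mul (by norm_num)]; norm_num
    · have : ∀ s ∈ Set.Ioc 0 ρ,
          V.indicator (fun y => ENNReal.ofReal (T y ^ (-(1 / 2) : ℝ))) (z - s • e) = 0 := by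
        intro s hs
        refine Set.indicator_of_notMem (fun hv => hz ⟨?_, ?_⟩) _
        · have := hVU _ hv s hs; simpa using this
        · have := hpos _ hv; rw [hTz] at this; linarith [hs.1]
      rw [setLIntegral_congr_fun measurableSet_Ioc this]
      simp
  calc ∫⁻ y in V, (∫⁻ s in Set.Ioc 0 ρ, g (y + s • e)) ^ 2
      ≤ ∫⁻ y in V, 2 * (ENNReal.ofReal (T y ^ (-(1 / 2) : ℝ)) *
          ∫⁻ s in Set.Ioc 0 ρ, φ (y + s • e)) := setLIntegral_mono' hV h1
    _ = 2 * ∫⁻ z, φ z * ∫⁻ s in Set.Ioc 0 ρ,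
        V.indicator (fun y => ENNReal.ofReal (T y ^ (-(1 / 2) : ℝ))) (z - s • e) := by
        rw [lintegral_const_mul' _ _ (by norm_num), h2]
    _ ≤ 2 * ∫⁻ z, U.indicator (fun z => 2 * (ENNReal.ofReal (T z) ^ 2 * g z ^ 2)) z := by
        gcongr with z
        refine (mul_le_mul_right (h3 z) (φ z)).trans ?_
        by_cases hz : z ∈ U
        · simp only [Set.indicator_of_mem hz, hφ]
          rcases le_or_gt (T z) 0 with h0 | h0
          · rw [mul_mul_mul_comm]
            have : ENNReal.ofReal (T z ^ (1 / 2 : ℝ)) = 0 := by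
              rw [← Real.sqrt_eq_rpow, Real.sqrt_eq_zero_of_nonpos h0, ENNReal.ofReal_zero]
            rw [this]; simp
          · have : ENNReal.ofReal (T z) ^ 2 =
                ENNReal.ofReal (T z ^ (3 / 2 : ℝ)) * ENNReal.ofReal (T z ^ (1 / 2 : ℝ)) := by
              rw [← ENNReal.ofReal_mul (by positivity), ← Real.rpow_add h0,
                ← ENNReal.ofReal_pow h0.le]
              norm_num
            rw [this]
            exact le_of_eq (by ring)
        · simp [hz]
    _ = 4 * ∫⁻ z in U, ENNReal.ofReal (T z) ^ 2 * g z ^ 2 := by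
        rw [lintegral_indicator hU, lintegral_const_mul' _ _ (by norm_num), ← mul_assoc]
        norm_num

end

/-! ### Comparison of boundary values with interior values by a shift -/

section

variable {N : ℕ}

/-- Interchange the two integrals. On `B(z, T z/(4L))` the function `T` varies by less than `T z/4`,
so for fixed `y` the relevant `z` lie in a ball about `y` of radius comparable to `T y`, whose
volume compensates `(T z)^{-N}`. -/
theorem lintegral_average_ball_le {T : Vec N → ℝ} {L : ℝ≥0} (hT : LipschitzWith L T) (hL : 1 ≤ L)
    {U : Set (Vec N)} (hU : MeasurableSet U) (hpos : ∀ z ∈ U, 0 < T z)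
    {W : Vec N → ℝ≥0∞} (hW : Measurable W) :
    ∫⁻ z in U, ENNReal.ofReal ((T z ^ N)⁻¹) * ∫⁻ y in Metric.ball z (T z / (4 * L)), W y ≤
      volume (Metric.ball (0 : Vec N) 1) * ∫⁻ y, W y := by
  have hL0 : (0 : ℝ) < L := lt_of_lt_of_le one_pos (by exact_mod_cast hL)
  have hTm : Measurable T := hT.continuous.measurable
  set S : Set (Vec N × Vec N) := (Prod.fst ⁻¹' U) ∩ {p | dist p.2 p.1 < T p.1 / (4 * L)} with hS
  have hSm : MeasurableSet S := by
    refine MeasurableSet.inter (measurable_fst hU) (measurableSet_lt ?_ ?_)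
    · exact measurable_snd.dist measurable_fst
    · exact (hTm.comp measurable_fst).div_const _
  set k : Vec N × Vec N → ℝ≥0∞ := S.indicator fun p => ENNReal.ofReal ((T p.1 ^ N)⁻¹) with hk
  have hkm : Measurable k :=
    ((((hTm.comp measurable_fst).pow_const N).inv).ennreal_ofReal).indicator hSm
  have hinner : ∀ y, ∫⁻ z, k (z, y) ≤ volume (Metric.ball (0 : Vec N) 1) := by
    intro y
    -- From `|T y - T z| < T z/4`: `T z < (4/3) T y` converts the radius into `T y/(3L)`, and `T y <
    -- (5/4) T z` is the lower bound on `T z`.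
    have hcomp : ∀ z, (z, y) ∈ S → 0 < T y ∧ 4 / 5 * T y ≤ T z ∧ dist z y < T y / (3 * L) := by
      rintro z ⟨hz, hd⟩
      have h0 := hpos z hz
      have h1 : |T y - T z| ≤ L * dist y z := hT.dist_le_mul y z
      have h2 : L * dist y z < T z / 4 := by
        rw [Set.mem_ofPred_eq, lt_div_iff₀ (by positivity)] at hd
        linarith
      rw [abs_le] at h1
      refine ⟨by linarith [h1.1], by linarith [h1.2], ?_⟩
      rw [dist_comm, lt_div_iff₀ (by positivity)]
      linarith [h1.1]
    by_cases hy : 0 < T y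
    · calc ∫⁻ z, k (z, y) ≤ ∫⁻ z, (Metric.ball y (T y / (3 * L))).indicator
            (fun _ => ENNReal.ofReal (((4 / 5 * T y) ^ N)⁻¹)) z := by
            refine lintegral_mono fun z => ?_
            by_cases hz : (z, y) ∈ S
            · obtain ⟨-, h1, h2⟩ := hcomp z hz
              rw [hk, Set.indicator_of_mem hz, Set.indicator_of_mem (Metric.mem_ball.mpr h2)]
              refine ENNReal.ofReal_le_ofReal ?_
              gcongr
            · simp [hk, hz]
        _ = ENNReal.ofReal (((4 / 5 * T y) ^ N)⁻¹ * (T y / (3 * L)) ^ N) *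
            volume (Metric.ball (0 : Vec N) 1) := by
            rw [lintegral_indicator_const Metric.isOpen_ball.measurableSet,
              Measure.addHaar_ball_of_pos _ _ (by positivity), ENNReal.ofReal_mul (by positivity),
              finrank_euclideanSpace_fin, mul_assoc]
        _ ≤ 1 * volume (Metric.ball (0 : Vec N) 1) := by
            gcongr
            rw [ENNReal.ofReal_le_one, ← inv_pow, ← mul_pow]
            refine pow_le_one₀ (by positivity) ?_
            rw [inv_mul_le_iff₀ (by positivity), mul_one, div_le_iff₀ (by positivity)]
            have : (1 : ℝ) ≤ L := by exact_mod_cast hL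
            nlinarith
        _ = _ := one_mul _
    · have : ∀ z, k (z, y) = 0 := fun z =>
        Set.indicator_of_notMem (fun hz => hy (hcomp z hz).1) _
      simp [this]
  calc _ = ∫⁻ z, ∫⁻ y, k (z, y) * W y := by
        rw [← lintegral_indicator hU]
        refine lintegral_congr fun z => ?_
        by_cases hz : z ∈ U
        · rw [Set.indicator_of_mem hz, ← lintegral_const_mul _ hW,
            ← lintegral_indicator Metric.isOpen_ball.measurableSet]
          refine lintegral_congr fun y => ?_
          by_cases hy : y ∈ Metric.ball z (T z / (4 * L))
          · have hS' : (z, y) ∈ S := ⟨hz, hy⟩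
            rw [Set.indicator_of_mem hy, hk, Set.indicator_of_mem hS']
          · have hS' : (z, y) ∉ S := fun h => hy h.2
            rw [Set.indicator_of_notMem hy, hk, Set.indicator_of_notMem hS', zero_mul]
        · have hS' : ∀ y, (z, y) ∉ S := fun y h => hz h.1
          simp [hz, hk, hS']
    _ = ∫⁻ y, ∫⁻ z, k (z, y) * W y :=
        lintegral_lintegral_swap (hkm.mul (hW.comp measurable_snd)).aemeasurable
    _ = ∫⁻ y, (∫⁻ z, k (z, y)) * W y :=
        lintegral_congr fun y => lintegral_mul_const _ (hkm.comp (by fun_prop))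
    _ ≤ ∫⁻ y, volume (Metric.ball (0 : Vec N) 1) * W y := by
        gcongr with y; exact hinner y
    _ = _ := lintegral_const_mul _ hW

/-- `H` is `C¹` on `Ω` and its gradient at `x` is controlled by the integral of `W` over balls
`B(x, r) ⊆ Ω`, with the scaling of the interior estimates for harmonic functions. -/
structure InteriorGradientBound (Ω : Set (Vec N)) (C : ℝ≥0) (H : Vec N → ℝ) (W : Vec N → ℝ≥0∞) :
    Prop where
  contDiffOn : ContDiffOn ℝ 1 H Ω
  measurable : Measurable W
  le : ∀ x r, 0 < r → Metric.ball x r ⊆ Ω →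
    ENNReal.ofReal (r ^ (N + 2)) * ‖fderiv ℝ H x‖ₑ ^ 2 ≤ C * ∫⁻ y in Metric.ball x r, W y

theorem enorm_sub_le_lintegral_fderiv {Ω : Set (Vec N)} (hΩ : IsOpen Ω) {H : Vec N → ℝ}
    (hH : ContDiffOn ℝ 1 H Ω) {y e : Vec N} (he : ‖e‖ = 1) {ρ : ℝ} (hρ : 0 ≤ ρ)
    (hy : ∀ s ∈ Set.Icc 0 ρ, y + s • e ∈ Ω) :
    ‖H (y + ρ • e) - H y‖ₑ ≤ ∫⁻ s in Set.Ioc 0 ρ, ‖fderiv ℝ H (y + s • e)‖ₑ := by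
  have hd : ∀ s ∈ Set.uIcc 0 ρ,
      HasDerivAt (fun s : ℝ => H (y + s • e)) (fderiv ℝ H (y + s • e) e) s := by
    intro s hs
    rw [Set.uIcc_of_le hρ] at hs
    have h1 : HasFDerivAt H (fderiv ℝ H (y + s • e)) (y + s • e) :=
      ((hH.differentiableOn (by simp)).differentiableAt (hΩ.mem_nhds (hy s hs))).hasFDerivAt
    have h2 : HasDerivAt (fun s : ℝ => y + s • e) e s := by
      simpa using ((hasDerivAt_id s).smul_const e).const_add y
    exact h1.comp_hasDerivAt s h2
  have hc : ContinuousOn (fun s : ℝ => fderiv ℝ H (y + s • e) e) (Set.uIcc 0 ρ) := by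
    rw [Set.uIcc_of_le hρ]
    have h1 : ContinuousOn (fun s : ℝ => fderiv ℝ H (y + s • e)) (Set.Icc 0 ρ) :=
      (hH.continuousOn_fderiv_of_isOpen hΩ (by simp)).comp (by fun_prop) hy
    exact h1.clm_apply continuousOn_const
  have h := intervalIntegral.integral_eq_sub_of_hasDerivAt hd hc.intervalIntegrable
  simp only [zero_smul, add_zero] at h
  rw [← h, intervalIntegral.integral_of_le hρ]
  refine (enorm_integral_le_lintegral_enorm _).trans (lintegral_mono fun s => ?_)
  refine (ContinuousLinearMap.le_opENorm _ _).trans_eq ?_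
  rw [← ofReal_norm e, he]; simp

/-- The height of a point above the graph of `g`, in the direction `e`. -/
def height (e : Vec N) (g : (Submodule.span ℝ {e})ᗮ → ℝ) (y : Vec N) : ℝ :=
  inner ℝ e y - g ((Submodule.span ℝ {e})ᗮ.orthogonalProjectionOnto y)

theorem lipschitzWith_height {e : Vec N} (he : ‖e‖ = 1) {K : ℝ≥0}
    {g : (Submodule.span ℝ {e})ᗮ → ℝ} (hg : LipschitzWith K g) :
    LipschitzWith (1 + K) (height e g) := by
  refine LipschitzWith.sub ?_ ?_
  · refine LipschitzWith.of_dist_le_mul fun x y => ?_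
    rw [Real.dist_eq, ← inner_sub_right, dist_eq_norm]
    exact (abs_real_inner_le_norm _ _).trans_eq (by rw [he]; simp)
  · refine LipschitzWith.of_dist_le_mul fun x y => (hg.dist_le_mul _ _).trans ?_
    gcongr
    simpa using (Submodule.lipschitzWith_orthogonalProjectionOnto
      (Submodule.span ℝ {e})ᗮ).dist_le_mul x y

theorem height_add_smul {e : Vec N} (he : ‖e‖ = 1) (g : (Submodule.span ℝ {e})ᗮ → ℝ) (y : Vec N)
    (s : ℝ) : height e g (y + s • e) = height e g y + s := by
  have hPe : (Submodule.span ℝ {e})ᗮ.orthogonalProjectionOnto e = 0 :=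
    Submodule.orthogonalProjectionOnto_orthogonalComplement_singleton_eq_zero e
  simp only [height, map_add, map_smul, hPe, smul_zero, add_zero, inner_add_right,
    inner_smul_right, real_inner_self_eq_norm_sq, he]
  ring

variable (Ω : BoundedLipschitzDomain N)

/-- Moving a fixed distance upwards takes a neighbourhood of the boundary point into a compact
subset of `Ω`. The increment of `H` is an integral of `∇H` over a vertical segment. Hardy's
inequality bounds its square integral by that of `T²|∇H|²`, and the interior bound on balls of
radius `T/(4L)` replaces `T²|∇H|²` by averages of `W`. -/
theorem exists_boundary_shift_estimate {x₀ : Vec N}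
    (hx₀ : x₀ ∈ frontier (Ω.toOpens : Set (Vec N))) (C₀ : ℝ≥0) :
    ∃ ρ : ℝ, 0 < ρ ∧ ∃ (a : Vec N) (k : Set (Vec N)) (C : ℝ≥0), IsCompact k ∧ k ⊆ Ω.toOpens ∧
      (∀ y ∈ (Ω.toOpens : Set (Vec N)) ∩ Metric.ball x₀ ρ, y + a ∈ k) ∧
      ∀ H W, InteriorGradientBound (Ω.toOpens : Set (Vec N)) C₀ H W →
        ∫⁻ y in (Ω.toOpens : Set (Vec N)) ∩ Metric.ball x₀ ρ, ‖H (y + a) - H y‖ₑ ^ 2 ≤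
          C * ∫⁻ y, W y := by
  obtain ⟨r, hr, e, he, K, g, hg, hgr⟩ := Ω.lipschitz x₀ hx₀
  have hopen : IsOpen (Ω.toOpens : Set (Vec N)) := Ω.toOpens.isOpen
  set D : Set (Vec N) := (Ω.toOpens : Set (Vec N)) with hD
  set T : Vec N → ℝ := height e g with hT
  set L : ℝ≥0 := 1 + K with hL
  have hL1 : 1 ≤ L := le_self_add
  have hL1' : (1 : ℝ) ≤ L := by exact_mod_cast hL1
  have hTL : LipschitzWith L T := lipschitzWith_height he hg
  have hTe : ∀ y s, T (y + s • e) = T y + s := height_add_smul he g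
  have hmem : ∀ y ∈ Metric.ball x₀ r, (y ∈ D ↔ 0 < T y) := fun y hy => by
    rw [hgr y hy, hT, height, sub_pos]
  have hTx₀ : T x₀ ≤ 0 := by
    by_contra! h
    have : x₀ ∈ D := (hmem x₀ (Metric.mem_ball_self hr)).mpr h
    rw [hopen.frontier_eq] at hx₀
    exact hx₀.2 this
  -- Segments of length `ρ` starting in `B(x₀, ρ)` stay in `B(x₀, 2ρ)`, and balls of radius at most
  -- `ρ` about their points stay in `B(x₀, 3ρ)`, inside the chart of radius `4ρ`.
  set ρ := r / 4 with hρ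
  have hρ0 : 0 < ρ := by positivity
  have hTle : ∀ z ∈ Metric.ball x₀ (2 * ρ), T z ≤ 2 * L * ρ := by
    intro z hz
    have h1 : |T z - T x₀| ≤ L * dist z x₀ := hTL.dist_le_mul z x₀
    have h2 : L * dist z x₀ ≤ L * (2 * ρ) := by gcongr; exact (Metric.mem_ball.mp hz).le
    linarith [le_abs_self (T z - T x₀)]
  set U : Set (Vec N) := Metric.ball x₀ (2 * ρ) ∩ {z | 0 < T z} with hU
  have hUm : MeasurableSet U := (Metric.isOpen_ball.inter
    (isOpen_lt continuous_const hTL.continuous)).measurableSet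
  have hball : ∀ z ∈ U, Metric.ball z (T z / (4 * L)) ⊆ D := by
    rintro z ⟨hz, hz0⟩ y hy
    rw [Metric.mem_ball] at hy hz
    have h1 : |T y - T z| ≤ L * dist y z := hTL.dist_le_mul y z
    have h2 : L * dist y z < T z / 4 := by
      rw [lt_div_iff₀ (by positivity)] at hy
      linarith
    have h3 : T z / (4 * L) ≤ ρ := by
      rw [div_le_iff₀ (by positivity)]
      nlinarith [hTle z hz]
    refine (hmem y ?_).mpr ?_
    · rw [Metric.mem_ball]
      linarith [dist_triangle y z x₀]
    · have h0 : 0 < T z := hz0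
      rw [abs_le] at h1
      linarith [h1.1]
  set V := D ∩ Metric.ball x₀ ρ with hV
  have hVpos : ∀ y ∈ V, 0 < T y := fun y hy =>
    (hmem y (Metric.ball_subset_ball (by linarith) hy.2)).mp hy.1
  have hVm : MeasurableSet V := (hopen.inter Metric.isOpen_ball).measurableSet
  have hVU : ∀ y ∈ V, ∀ s ∈ Set.Icc 0 ρ, y + s • e ∈ U := by
    intro y hy s hs
    refine ⟨?_, ?_⟩
    · have h1 := Metric.mem_ball.mp hy.2
      have h2 : dist (y + s • e) y ≤ ρ := by
        rw [dist_eq_norm, add_sub_cancel_left, norm_smul, he, Real.norm_of_nonneg hs.1, mul_one]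
        exact hs.2
      rw [Metric.mem_ball]
      linarith [dist_triangle (y + s • e) y x₀]
    · have := hVpos y hy
      simp only [Set.mem_ofPred_eq, hTe]
      linarith [hs.1]
  have hUD : U ⊆ D := fun z hz => hball z hz (Metric.mem_ball_self (div_pos hz.2 (by positivity)))
  -- Points of positive height are lifted to height at least `ρ`. The closed condition `ρ ≤ T` makes
  -- the landing set compact, and inside the chart it implies membership in `Ω`.
  refine ⟨ρ, hρ0, ρ • e, Metric.closedBall x₀ (2 * ρ) ∩ {z | ρ ≤ T z},
    4 * (C₀ * (4 * L) ^ (N + 2) * (volume (Metric.ball (0 : Vec N) 1)).toNNReal),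
    (isCompact_closedBall _ _).inter_right (isClosed_le continuous_const hTL.continuous), ?_, ?_, ?_⟩
  · rintro z ⟨hz, hz'⟩
    refine (hmem z ?_).mpr (hρ0.trans_le hz')
    rw [Metric.mem_ball]
    linarith [Metric.mem_closedBall.mp hz]
  · intro y hy
    have h1 := hVU y hy ρ ⟨hρ0.le, le_rfl⟩
    refine ⟨Metric.ball_subset_closedBall h1.1, ?_⟩
    have := hVpos y hy
    simp only [Set.mem_ofPred_eq, hTe]
    linarith
  · intro H W hHW
    have hfm : Measurable fun z => ‖fderiv ℝ H z‖ₑ := (measurable_fderiv ℝ H).enorm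
    calc ∫⁻ y in V, ‖H (y + ρ • e) - H y‖ₑ ^ 2
        ≤ ∫⁻ y in V, (∫⁻ s in Set.Ioc 0 ρ, ‖fderiv ℝ H (y + s • e)‖ₑ) ^ 2 := by
          refine setLIntegral_mono' hVm fun y hy => ?_
          gcongr
          exact enorm_sub_le_lintegral_fderiv hopen hHW.contDiffOn he hρ0.le
            fun s hs => hUD (hVU y hy s hs)
      _ ≤ 4 * ∫⁻ z in U, ENNReal.ofReal (T z) ^ 2 * ‖fderiv ℝ H z‖ₑ ^ 2 :=
          lintegral_sq_lintegral_segment_le hTL.continuous.measurable hTe hVm hUm hρ0.le hVpos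
            (fun y hy s hs => hVU y hy s ⟨hs.1.le, hs.2⟩) hfm
      _ ≤ 4 * ∫⁻ z in U, (C₀ * (4 * L) ^ (N + 2) : ℝ≥0) * (ENNReal.ofReal ((T z ^ N)⁻¹) *
            ∫⁻ y in Metric.ball z (T z / (4 * L)), W y) := by
          gcongr 4 * ?_
          refine setLIntegral_mono' hUm fun z hz => ?_
          have hz0 : 0 < T z := hz.2
          have h := hHW.le z (T z / (4 * L)) (by positivity) (hball z hz)
          -- With radius `T z/(4L)`, the factor `r^{N+2}` of the interior bound splits into `(T
          -- z)²`, the `(T z)^N` of the averages, and a power of `4L`.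
          have e1 : ENNReal.ofReal (T z) ^ 2 = ((4 * L) ^ (N + 2) : ℝ≥0) *
              ENNReal.ofReal ((T z ^ N)⁻¹) * ENNReal.ofReal ((T z / (4 * L)) ^ (N + 2)) := by
            rw [← ENNReal.ofReal_coe_nnreal, ← ENNReal.ofReal_mul (by positivity),
              ← ENNReal.ofReal_mul (by positivity), ← ENNReal.ofReal_pow hz0.le]
            congr 1
            push_cast
            rw [div_pow]
            have : (L : ℝ) ≠ 0 := by positivity
            field_simp
            ring
          rw [e1, mul_assoc]
          refine (mul_le_mul_right h _).trans_eq ?_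
          push_cast
          ring
      _ = 4 * ((C₀ * (4 * L) ^ (N + 2) : ℝ≥0) * ∫⁻ z in U, ENNReal.ofReal ((T z ^ N)⁻¹) *
            ∫⁻ y in Metric.ball z (T z / (4 * L)), W y) := by
          rw [lintegral_const_mul' _ _ ENNReal.coe_ne_top]
      _ ≤ 4 * ((C₀ * (4 * L) ^ (N + 2) : ℝ≥0) *
            (volume (Metric.ball (0 : Vec N) 1) * ∫⁻ y, W y)) := by
          gcongr
          exact lintegral_average_ball_le hTL hL1 hUm (fun z hz => hz.2) hHW.measurable
      _ = _ := by
          push_cast [ENNReal.coe_toNNReal (measure_ball_lt_top (μ := volume) (x := (0 : Vec N))).ne]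
          ring

end

/-! ### Oscillation estimates from interior gradient bounds -/

section

variable {N : ℕ}

/-- Each point of `B(x, r)` is the centre of a ball of radius `r` inside `Ω`, so the gradient is
bounded uniformly on `B(x, r)` and the mean value inequality applies on this convex set. -/
theorem InteriorGradientBound.abs_sub_le {Ω : Set (Vec N)} (hΩ : IsOpen Ω) {C₀ : ℝ≥0}
    {H : Vec N → ℝ} {W : Vec N → ℝ≥0∞} (hHW : InteriorGradientBound Ω C₀ H W) {m : ℝ} (hm : 0 ≤ m)
    (hW : ∫⁻ y, W y ≤ ENNReal.ofReal (m ^ 2)) {x : Vec N} {r : ℝ} (hr : 0 < r)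
    (hx : Metric.ball x (2 * r) ⊆ Ω) {y z : Vec N} (hy : y ∈ Metric.ball x r)
    (hz : z ∈ Metric.ball x r) :
    |H y - H z| ≤ 2 * r * Real.sqrt (C₀ / r ^ (N + 2)) * m := by
  have hgrad : ∀ z ∈ Metric.ball x r, ‖fderiv ℝ H z‖ ≤ Real.sqrt (C₀ / r ^ (N + 2)) * m := by
    intro z hz
    have hsub : Metric.ball z r ⊆ Ω := by
      refine (Metric.ball_subset_ball' ?_).trans hx
      linarith [Metric.mem_ball.mp hz]
    have h1 := (hHW.le z r hr hsub).trans (mul_le_mul_right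
      ((setLIntegral_le_lintegral (Metric.ball z r) W).trans hW) _)
    rw [← ofReal_norm, ← ENNReal.ofReal_pow (norm_nonneg _), ← ENNReal.ofReal_coe_nnreal,
      ← ENNReal.ofReal_mul (by positivity), ← ENNReal.ofReal_mul (by positivity),
      ENNReal.ofReal_le_ofReal_iff (by positivity)] at h1
    refine abs_le_of_sq_le_sq' ?_ (by positivity) |>.2
    rw [mul_pow, Real.sq_sqrt (by positivity), div_mul_eq_mul_div, le_div_iff₀ (by positivity)]
    linarith
  have h2 := Convex.norm_image_sub_le_of_norm_fderiv_le (𝕜 := ℝ) (f := H)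
    (fun z hz => (hHW.contDiffOn.differentiableOn (by simp)).differentiableAt
      (hΩ.mem_nhds (hx (Metric.ball_subset_ball (by linarith) hz)))) hgrad (convex_ball x r) hz hy
  rw [Real.norm_eq_abs] at h2
  have h3 : ‖y - z‖ ≤ 2 * r := by
    rw [← dist_eq_norm]
    linarith [dist_triangle_right y z x, Metric.mem_ball.mp hy, Metric.mem_ball.mp hz]
  calc _ ≤ _ := h2
    _ ≤ (Real.sqrt (C₀ / r ^ (N + 2)) * m) * (2 * r) := by gcongr
    _ = _ := by ring

variable (Ω : BoundedLipschitzDomain N) (C₀ : ℝ≥0)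

/-- The oscillation of `H` between `k` and the point `x₀` is at most `C m`, whenever the square
integral of the bound for its gradient is at most `m ^ 2`. -/
def OscillationBound (x₀ : Vec N) (k : Set (Vec N)) (C : ℝ) : Prop :=
  ∀ H W m, InteriorGradientBound (Ω.toOpens : Set (Vec N)) C₀ H W → 0 ≤ m →
    ∫⁻ y, W y ≤ ENNReal.ofReal (m ^ 2) → ∀ y ∈ k, |H y - H x₀| ≤ C * m

/-- A chain of balls in topological form: the points around which the oscillation from `x₀` is
controlled form an open set, containing `x₀` and relatively closed in the connected set `Ω`. The
constant may depend on the ball but not on `H`, `W` or `m`. -/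
theorem exists_oscillationBound_ball {x₀ : Vec N} (hx₀ : x₀ ∈ Ω.toOpens) {x : Vec N}
    (hx : x ∈ Ω.toOpens) : ∃ r : ℝ, 0 < r ∧ Metric.ball x r ⊆ Ω.toOpens ∧
      ∃ C : ℝ, OscillationBound Ω C₀ x₀ (Metric.ball x r) C := by
  have hopen : IsOpen (Ω.toOpens : Set (Vec N)) := Ω.toOpens.isOpen
  set u : Set (Vec N) := {x | ∃ r : ℝ, 0 < r ∧ Metric.ball x r ⊆ Ω.toOpens ∧
      ∃ C : ℝ, OscillationBound Ω C₀ x₀ (Metric.ball x r) C} with hu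
  have hradius : ∀ x ∈ Ω.toOpens, ∃ r : ℝ, 0 < r ∧ Metric.ball x (2 * r) ⊆ Ω.toOpens := by
    intro x hx
    obtain ⟨r, hr, h⟩ := Metric.isOpen_iff.mp hopen x hx
    exact ⟨r / 2, by positivity, by rwa [mul_div_cancel₀ _ (two_ne_zero)]⟩
  have huo : IsOpen u := by
    rw [Metric.isOpen_iff]
    rintro x ⟨r, hr, hsub, C, hC⟩
    refine ⟨r, hr, fun y hy => ?_⟩
    obtain ⟨s, hs, hys⟩ := Metric.isOpen_iff.mp Metric.isOpen_ball y hy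
    exact ⟨s, hs, hys.trans hsub, C, fun H W m h1 h2 h3 z hz => hC H W m h1 h2 h3 z (hys hz)⟩
  have hx₀u : x₀ ∈ u := by
    obtain ⟨r, hr, h⟩ := hradius x₀ hx₀
    refine ⟨r, hr, (Metric.ball_subset_ball (by linarith)).trans h, _, fun H W m h1 h2 h3 z hz =>
      h1.abs_sub_le hopen h2 h3 hr h hz (Metric.mem_ball_self hr)⟩
  have hcl : closure u ∩ Ω.toOpens ⊆ u := by
    rintro y ⟨hy, hyΩ⟩
    obtain ⟨r, hr, h⟩ := hradius y hyΩ
    obtain ⟨z, hzu, hz⟩ := Metric.mem_closure_iff.mp hy r hr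
    obtain ⟨s, hs, -, C, hC⟩ := hzu
    refine ⟨r, hr, (Metric.ball_subset_ball (by linarith)).trans h,
      2 * r * Real.sqrt (C₀ / r ^ (N + 2)) + C, fun H W m h1 h2 h3 q hq => ?_⟩
    have a1 := h1.abs_sub_le hopen h2 h3 hr h hq (Metric.mem_ball'.mpr hz)
    have a2 := hC H W m h1 h2 h3 z (Metric.mem_ball_self hs)
    have a3 := abs_sub_le (H q) (H z) (H x₀)
    rw [add_mul]
    linarith
  exact Ω.connected.isPreconnected.subset_of_closure_inter_subset huo ⟨x₀, hx₀, hx₀u⟩ hcl hx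

theorem exists_oscillationBound_compact {x₀ : Vec N} (hx₀ : x₀ ∈ Ω.toOpens) {k : Set (Vec N)}
    (hk : IsCompact k) (hkΩ : k ⊆ Ω.toOpens) : ∃ C : ℝ, OscillationBound Ω C₀ x₀ k C := by
  refine hk.induction_on (p := fun k => ∃ C : ℝ, OscillationBound Ω C₀ x₀ k C) ?_ ?_ ?_ ?_
  · exact ⟨0, fun H W m _ _ _ y hy => hy.elim⟩
  · rintro s t hst ⟨C, hC⟩
    exact ⟨C, fun H W m h1 h2 h3 y hy => hC H W m h1 h2 h3 y (hst hy)⟩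
  · rintro s t ⟨C, hC⟩ ⟨D, hD⟩
    refine ⟨max C D, fun H W m h1 h2 h3 y hy => ?_⟩
    rcases hy with hy | hy
    · exact (hC H W m h1 h2 h3 y hy).trans (by gcongr; exact le_max_left _ _)
    · exact (hD H W m h1 h2 h3 y hy).trans (by gcongr; exact le_max_right _ _)
  · intro x hx
    obtain ⟨r, hr, -, C, hC⟩ := exists_oscillationBound_ball Ω C₀ hx₀ (hkΩ hx)
    exact ⟨Metric.ball x r, mem_nhdsWithin_of_mem_nhds (Metric.ball_mem_nhds x hr), C, hC⟩

/-- The `L²(s)` distance of `H` to its value at `x₀` is at most `C m`. -/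
def L2OscillationBound (x₀ : Vec N) (s : Set (Vec N)) (C : ℝ≥0) : Prop :=
  ∀ H W m, InteriorGradientBound (Ω.toOpens : Set (Vec N)) C₀ H W → 0 ≤ m →
    ∫⁻ y, W y ≤ ENNReal.ofReal (m ^ 2) →
      ∫⁻ y in (Ω.toOpens : Set (Vec N)) ∩ s, ‖H y - H x₀‖ₑ ^ 2 ≤ C * ENNReal.ofReal (m ^ 2)

theorem enorm_sq_le_of_abs_le {a C m : ℝ} (h : |a| ≤ C * m) :
    ‖a‖ₑ ^ 2 ≤ ENNReal.ofReal (C ^ 2) * ENNReal.ofReal (m ^ 2) := by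
  rw [← ofReal_norm, ← ENNReal.ofReal_pow (norm_nonneg _), ← ENNReal.ofReal_mul (by positivity),
    ← mul_pow, Real.norm_eq_abs]
  exact ENNReal.ofReal_le_ofReal (pow_le_pow_left₀ (abs_nonneg _) h 2)

theorem enorm_sq_sub_le (a b c : ℝ) : ‖a - c‖ₑ ^ 2 ≤ 2 * ‖b - a‖ₑ ^ 2 + 2 * ‖b - c‖ₑ ^ 2 := by
  have h : ∀ t : ℝ, ‖t‖ₑ ^ 2 = ENNReal.ofReal (t ^ 2) := fun t => by
    rw [← ofReal_norm, ← ENNReal.ofReal_pow (norm_nonneg _), Real.norm_eq_abs, sq_abs]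
  have h2 : (2 : ℝ≥0∞) = ENNReal.ofReal 2 := by simp
  rw [h, h, h, h2, ← ENNReal.ofReal_mul (by norm_num),
    ← ENNReal.ofReal_mul (by norm_num), ← ENNReal.ofReal_add (by positivity) (by positivity)]
  refine ENNReal.ofReal_le_ofReal ?_
  nlinarith [sq_nonneg ((b - a) + (b - c))]

/-- In the interior the pointwise bound is enough. At a boundary point its constants may degenerate,
so `H y` is compared in `L²` with `H (y + a)`, and `y + a` lies in a fixed compact subset where the
pointwise bound holds. -/
theorem exists_l2OscillationBound_local {x₀ : Vec N} (hx₀ : x₀ ∈ Ω.toOpens) {x : Vec N}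
    (hx : x ∈ closure (Ω.toOpens : Set (Vec N))) : ∃ r : ℝ, 0 < r ∧
      ∃ C : ℝ≥0, L2OscillationBound Ω C₀ x₀ (Metric.ball x r) C := by
  have hopen : IsOpen (Ω.toOpens : Set (Vec N)) := Ω.toOpens.isOpen
  by_cases hxΩ : x ∈ (Ω.toOpens : Set (Vec N))
  · obtain ⟨r, hr, hsub, C, hC⟩ := exists_oscillationBound_ball Ω C₀ hx₀ hxΩ
    refine ⟨r, hr, (ENNReal.ofReal (C ^ 2) * volume (Metric.ball x r)).toNNReal,
      fun H W m h1 h2 h3 => ?_⟩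
    rw [ENNReal.coe_toNNReal (ENNReal.mul_ne_top ENNReal.ofReal_ne_top measure_ball_lt_top.ne)]
    calc _ ≤ ∫⁻ y in (Ω.toOpens : Set (Vec N)) ∩ Metric.ball x r,
          ENNReal.ofReal (C ^ 2) * ENNReal.ofReal (m ^ 2) :=
          setLIntegral_mono' (hopen.inter Metric.isOpen_ball).measurableSet fun y hy =>
            enorm_sq_le_of_abs_le (hC H W m h1 h2 h3 y hy.2)
      _ ≤ ENNReal.ofReal (C ^ 2) * ENNReal.ofReal (m ^ 2) * volume (Metric.ball x r) := by
          rw [setLIntegral_const]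
          gcongr
          exact Set.inter_subset_right
      _ = _ := by ring
  · have hxf : x ∈ frontier (Ω.toOpens : Set (Vec N)) := by
      rw [hopen.frontier_eq]; exact ⟨hx, hxΩ⟩
    obtain ⟨r, hr, a, k, C, hk, hkΩ, hka, hC⟩ := exists_boundary_shift_estimate Ω hxf C₀
    obtain ⟨D, hD⟩ := exists_oscillationBound_compact Ω C₀ hx₀ hk hkΩ
    have hVm := (hopen.inter (Metric.isOpen_ball (x := x) (ε := r))).measurableSet
    refine ⟨r, hr, 2 * C + 2 * (ENNReal.ofReal (D ^ 2) * volume (Metric.ball x r)).toNNReal,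
      fun H W m h1 h2 h3 => ?_⟩
    push_cast
    rw [ENNReal.coe_toNNReal (ENNReal.mul_ne_top ENNReal.ofReal_ne_top measure_ball_lt_top.ne)]
    calc _ ≤ ∫⁻ y in (Ω.toOpens : Set (Vec N)) ∩ Metric.ball x r,
          (2 * ‖H (y + a) - H y‖ₑ ^ 2 + 2 * (ENNReal.ofReal (D ^ 2) * ENNReal.ofReal (m ^ 2))) := by
          refine setLIntegral_mono' hVm fun y hy => (enorm_sq_sub_le (H y) (H (y + a)) (H x₀)).trans ?_
          gcongr
          exact enorm_sq_le_of_abs_le (hD H W m h1 h2 h3 _ (hka y hy))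
      _ = 2 * (∫⁻ y in (Ω.toOpens : Set (Vec N)) ∩ Metric.ball x r, ‖H (y + a) - H y‖ₑ ^ 2) +
          2 * (ENNReal.ofReal (D ^ 2) * ENNReal.ofReal (m ^ 2)) *
            volume ((Ω.toOpens : Set (Vec N)) ∩ Metric.ball x r) := by
          rw [lintegral_add_right _ measurable_const, lintegral_const_mul' _ _ (by norm_num),
            setLIntegral_const]
      _ ≤ 2 * (C * ENNReal.ofReal (m ^ 2)) +
          2 * (ENNReal.ofReal (D ^ 2) * ENNReal.ofReal (m ^ 2)) * volume (Metric.ball x r) := by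
          gcongr
          · exact (hC H W h1).trans (mul_le_mul_right h3 _)
          · exact Set.inter_subset_right
      _ = _ := by ring

/-- An improved Poincaré inequality: interior gradient bounds control the distance of `H` to
a constant in `L²(Ω)`. -/
theorem exists_l2OscillationBound {x₀ : Vec N} (hx₀ : x₀ ∈ Ω.toOpens) :
    ∃ C : ℝ≥0, L2OscillationBound Ω C₀ x₀ (Ω.toOpens : Set (Vec N)) C := by
  have hcomp : IsCompact (closure (Ω.toOpens : Set (Vec N))) := Ω.bounded.isCompact_closure
  obtain ⟨C, hC⟩ : ∃ C : ℝ≥0, L2OscillationBound Ω C₀ x₀ (closure (Ω.toOpens : Set (Vec N))) C := by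
    refine hcomp.induction_on (p := fun s => ∃ C : ℝ≥0, L2OscillationBound Ω C₀ x₀ s C) ?_ ?_ ?_ ?_
    · exact ⟨0, fun H W m _ _ _ => by simp⟩
    · rintro s t hst ⟨C, hC⟩
      exact ⟨C, fun H W m h1 h2 h3 => (lintegral_mono_set
        (Set.inter_subset_inter_right _ hst)).trans (hC H W m h1 h2 h3)⟩
    · rintro s t ⟨C, hC⟩ ⟨D, hD⟩
      refine ⟨C + D, fun H W m h1 h2 h3 => ?_⟩
      rw [Set.inter_union_distrib_left, ENNReal.coe_add, add_mul]
      exact (lintegral_union_le _ _ _).trans (add_le_add (hC H W m h1 h2 h3) (hD H W m h1 h2 h3))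
    · intro x hx
      obtain ⟨r, hr, C, hC⟩ := exists_l2OscillationBound_local Ω C₀ hx₀ hx
      exact ⟨Metric.ball x r, mem_nhdsWithin_of_mem_nhds (Metric.ball_mem_nhds x hr), C, hC⟩
  exact ⟨C, fun H W m h1 h2 h3 => (lintegral_mono_set
    (Set.inter_subset_inter_right _ subset_closure)).trans (hC H W m h1 h2 h3)⟩

end

section

/-! ### A radial mollifier -/

/-- A smooth cutoff on `ℝ`, equal to `1` on `(-∞, 1/2]` and to `0` on `[1, ∞)`. -/
def cutoff (s : ℝ) : ℝ := Real.smoothTransition (2 - 2 * s)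

theorem contDiff_cutoff {n : WithTop ℕ∞} (hn : n ≤ ((⊤ : ℕ∞) : WithTop ℕ∞)) : ContDiff ℝ n cutoff :=
  ((Real.smoothTransition.contDiff (n := ⊤)).of_le hn).comp
    (contDiff_const.sub (contDiff_const.mul contDiff_id))

theorem cutoff_nonneg (s : ℝ) : 0 ≤ cutoff s := Real.smoothTransition.nonneg _

theorem cutoff_le_one (s : ℝ) : cutoff s ≤ 1 := Real.smoothTransition.le_one _

theorem cutoff_eq_zero {s : ℝ} (hs : 1 ≤ s) : cutoff s = 0 :=
  Real.smoothTransition.zero_of_nonpos (by linarith)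

theorem hasDerivAt_cutoff (s : ℝ) : HasDerivAt cutoff (deriv cutoff s) s :=
  ((contDiff_cutoff (n := 1) (by simp)).differentiable (by simp) s).hasDerivAt

/-- Such a point is a minimum of the nonnegative cutoff; this covers the endpoint `s = 1` as well.
-/
theorem deriv_cutoff_eq_zero {s : ℝ} (hs : 1 ≤ s) : deriv cutoff s = 0 := by
  refine IsLocalMin.deriv_eq_zero (Eventually.of_forall fun t => ?_)
  rw [cutoff_eq_zero hs]
  exact cutoff_nonneg t

theorem exists_deriv_cutoff_bound : ∃ B : ℝ, 0 ≤ B ∧ ∀ s, 0 ≤ s → |deriv cutoff s| ≤ B := by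
  have hc : Continuous (deriv cutoff) := (contDiff_cutoff (n := 1) (by simp)).continuous_deriv le_rfl
  obtain ⟨B, hB⟩ := (isCompact_Icc (a := (0 : ℝ)) (b := 1)).exists_bound_of_continuousOn
    hc.continuousOn
  refine ⟨max B 0, le_max_right _ _, fun s hs => ?_⟩
  rcases le_total s 1 with h | h
  · exact (hB s ⟨hs, h⟩).trans (le_max_left _ _)
  · rw [deriv_cutoff_eq_zero h, abs_zero]; exact le_max_right _ _

/-- The primitive of `cutoff / 2` vanishing on `[1, ∞)`. -/
def cutoffPrim (s : ℝ) : ℝ := ∫ t in (1 : ℝ)..s, cutoff t / 2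

theorem hasDerivAt_cutoffPrim (s : ℝ) : HasDerivAt cutoffPrim (cutoff s / 2) s := by
  have hc : Continuous fun t => cutoff t / 2 :=
    (contDiff_cutoff (n := 0) (by simp)).continuous.div_const _
  exact intervalIntegral.integral_hasDerivAt_right (hc.intervalIntegrable _ _)
    (hc.stronglyMeasurableAtFilter _ _) hc.continuousAt

theorem contDiff_cutoffPrim : ContDiff ℝ ((⊤ : ℕ∞) : WithTop ℕ∞) cutoffPrim := by
  rw [contDiff_infty_iff_deriv]
  refine ⟨fun s => (hasDerivAt_cutoffPrim s).differentiableAt, ?_⟩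
  have : deriv cutoffPrim = fun s => cutoff s / 2 := funext fun s => (hasDerivAt_cutoffPrim s).deriv
  rw [this]
  exact (contDiff_cutoff le_rfl).div_const _

theorem cutoffPrim_eq_zero {s : ℝ} (hs : 1 ≤ s) : cutoffPrim s = 0 := by
  rw [cutoffPrim, intervalIntegral.integral_of_le hs]
  rw [setIntegral_congr_fun (g := fun _ => (0 : ℝ)) measurableSet_Ioc fun t ht => ?_]
  · simp
  · simp [cutoff_eq_zero ht.1.le]

variable {N : ℕ}

/-- The radial mollifier `r^{-N} cutoff(|z|² / r²)`, which is not normalized. -/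
def mollifier (r : ℝ) (z : Vec N) : ℝ := (r ^ N)⁻¹ * cutoff (‖z‖ ^ 2 / r ^ 2)

theorem contDiff_mollifier (r : ℝ) :
    ContDiff ℝ ((⊤ : ℕ∞) : WithTop ℕ∞) (mollifier r : Vec N → ℝ) :=
  contDiff_const.mul ((contDiff_cutoff le_rfl).comp ((contDiff_norm_sq ℝ).div_const _))

theorem one_le_norm_sq_div {r : ℝ} (hr : 0 < r) {z : Vec N} (hz : r ≤ ‖z‖) :
    1 ≤ ‖z‖ ^ 2 / r ^ 2 := by
  rw [one_le_div (by positivity)]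
  gcongr

theorem mollifier_eq_zero {r : ℝ} (hr : 0 < r) {z : Vec N} (hz : r ≤ ‖z‖) : mollifier r z = 0 := by
  rw [mollifier, cutoff_eq_zero (one_le_norm_sq_div hr hz), mul_zero]

theorem tsupport_subset_closedBall {φ : Vec N → ℝ} {x : Vec N} {r : ℝ}
    (h : ∀ y, r ≤ ‖x - y‖ → φ y = 0) : tsupport φ ⊆ Metric.closedBall x r := by
  refine closure_minimal (fun y hy => ?_) Metric.isClosed_closedBall
  by_contra hy'
  refine hy (h y ?_)
  rw [Metric.mem_closedBall, dist_comm, dist_eq_norm, not_le] at hy'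
  exact hy'.le

theorem hasCompactSupport_mollifier {r : ℝ} (hr : 0 < r) :
    HasCompactSupport (mollifier r : Vec N → ℝ) :=
  (isCompact_closedBall (0 : Vec N) r).of_isClosed_subset (isClosed_tsupport _)
    (tsupport_subset_closedBall fun y hy => mollifier_eq_zero hr (by simpa using hy))

theorem mollifier_nonneg {r : ℝ} (hr : 0 < r) (z : Vec N) : 0 ≤ mollifier r z :=
  mul_nonneg (by positivity) (cutoff_nonneg _)

theorem mollifier_le {r : ℝ} (hr : 0 < r) (z : Vec N) : mollifier r z ≤ (r ^ N)⁻¹ :=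
  mul_le_of_le_one_right (by positivity) (cutoff_le_one _)

theorem fderiv_mollifier (r : ℝ) (z v : Vec N) :
    fderiv ℝ (mollifier r) z v =
      (r ^ N)⁻¹ * (deriv cutoff (‖z‖ ^ 2 / r ^ 2) * (2 * inner ℝ z v / r ^ 2)) := by
  have h1 : HasFDerivAt (fun z : Vec N => ‖z‖ ^ 2 / r ^ 2)
      ((r ^ 2)⁻¹ • (2 • innerSL ℝ z)) z := by
    simp_rw [div_eq_inv_mul]
    exact ((hasStrictFDerivAt_norm_sq z).hasFDerivAt).const_mul _
  have h2 := ((hasDerivAt_cutoff (‖z‖ ^ 2 / r ^ 2)).comp_hasFDerivAt z h1).const_mul (r ^ N)⁻¹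
  have h3 : HasFDerivAt (mollifier r) _ z := h2
  rw [h3.fderiv]
  simp only [smul_apply, smul_eq_mul, innerSL_apply_apply, nsmul_eq_mul]
  push_cast
  ring

theorem exists_fderiv_mollifier_bound (N : ℕ) : ∃ B : ℝ, 0 ≤ B ∧ ∀ r : ℝ, 0 < r → ∀ z : Vec N,
    ‖fderiv ℝ (mollifier r) z‖ ≤ B * (r ^ (N + 1))⁻¹ := by
  obtain ⟨B, hB0, hB⟩ := exists_deriv_cutoff_bound
  refine ⟨2 * B, by positivity, fun r hr z => ?_⟩
  refine ContinuousLinearMap.opNorm_le_bound _ (by positivity) fun v => ?_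
  rw [fderiv_mollifier, Real.norm_eq_abs]
  rcases le_total r ‖z‖ with hz | hz
  · rw [deriv_cutoff_eq_zero (one_le_norm_sq_div hr hz)]
    simp only [zero_mul, mul_zero, abs_zero]
    positivity
  · rw [abs_mul, abs_mul, abs_div, abs_mul, abs_of_pos (by positivity : 0 < (r ^ N)⁻¹),
      abs_of_pos (by positivity : 0 < r ^ 2), abs_two]
    calc _ ≤ (r ^ N)⁻¹ * (B * (2 * (r * ‖v‖) / r ^ 2)) := by
          gcongr
          · exact hB _ (by positivity)
          · exact (abs_real_inner_le_norm z v).trans (by gcongr)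
      _ = _ := by field_simp; ring

/-- The mass of the mollifiers. -/
def mollifierMass (N : ℕ) : ℝ := ∫ z : Vec N, mollifier 1 z

theorem integral_mollifier {r : ℝ} (hr : 0 < r) :
    ∫ z : Vec N, mollifier r z = mollifierMass N := by
  have h : ∀ z : Vec N, mollifier r z = (r ^ N)⁻¹ * mollifier 1 (r⁻¹ • z) := fun z => by
    simp [mollifier, norm_smul, abs_of_pos hr]
    left; congr 1; field_simp
  simp_rw [h]
  rw [integral_const_mul, Measure.integral_comp_smul, finrank_euclideanSpace_fin, mollifierMass,
    smul_eq_mul, ← mul_assoc, inv_pow, inv_inv, abs_of_pos (by positivity),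
    inv_mul_cancel₀ (by positivity), one_mul]

theorem mollifierMass_pos (N : ℕ) : 0 < mollifierMass N := by
  refine (contDiff_mollifier 1).continuous.integral_pos_of_hasCompactSupport_nonneg_nonzero
    (hasCompactSupport_mollifier one_pos) (fun z => mollifier_nonneg one_pos z) (x := 0) ?_
  have : cutoff 0 = 1 := Real.smoothTransition.one_of_one_le (by norm_num)
  simp [mollifier, this]

/-- The sum of the pure second derivatives. -/
def lap (φ : Vec N → ℝ) (y : Vec N) : ℝ :=
  ∑ j : Fin N, fderiv ℝ (fun y => fderiv ℝ φ y (EuclideanSpace.single j 1)) y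
    (EuclideanSpace.single j 1)

/-- The function whose Laplacian is the derivative of the mollifier with respect to the radius. -/
def mollifierPotential (r : ℝ) (x y : Vec N) : ℝ := -(r * (r ^ N)⁻¹) * cutoffPrim (‖y - x‖ ^ 2 / r ^ 2)

theorem contDiff_mollifierPotential (r : ℝ) (x : Vec N) :
    ContDiff ℝ ((⊤ : ℕ∞) : WithTop ℕ∞) (mollifierPotential r x) :=
  contDiff_const.mul (contDiff_cutoffPrim.comp
    (((contDiff_norm_sq ℝ).comp (contDiff_id.sub contDiff_const)).div_const _))

theorem mollifierPotential_eq_zero {r : ℝ} (hr : 0 < r) {x y : Vec N} (hz : r ≤ ‖x - y‖) :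
    mollifierPotential r x y = 0 := by
  rw [norm_sub_rev] at hz
  rw [mollifierPotential, cutoffPrim_eq_zero (one_le_norm_sq_div hr hz), mul_zero]

theorem hasFDerivAt_norm_sub_sq_div (r : ℝ) (x y : Vec N) :
    HasFDerivAt (fun y : Vec N => ‖y - x‖ ^ 2 / r ^ 2) ((r ^ 2)⁻¹ • (2 • innerSL ℝ (y - x))) y := by
  simp_rw [div_eq_inv_mul]
  have := (((hasFDerivAt_id y).sub_const x).norm_sq).const_mul (r ^ 2)⁻¹
  simpa using this

/-- Since `cutoffPrim` has derivative `cutoff / 2`, the gradient of the potential in `y` is `-(y -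
x)/r` times the mollifier; a second differentiation gives the two terms. -/
theorem lap_mollifierPotential {r : ℝ} (hr : 0 < r) (x y : Vec N) :
    lap (mollifierPotential r x) y = -(r * (r ^ N)⁻¹) *
      (deriv cutoff (‖y - x‖ ^ 2 / r ^ 2) * (2 * ‖y - x‖ ^ 2 / r ^ 4) +
        N * cutoff (‖y - x‖ ^ 2 / r ^ 2) / r ^ 2) := by
  have h1 : ∀ y (j : Fin N), fderiv ℝ (mollifierPotential r x) y (EuclideanSpace.single j 1) =
      -(r * (r ^ N)⁻¹) * (cutoff (‖y - x‖ ^ 2 / r ^ 2) * ((y - x) j / r ^ 2)) := by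
    intro y j
    have h2 : HasFDerivAt (mollifierPotential r x) _ y :=
      ((hasDerivAt_cutoffPrim _).comp_hasFDerivAt y
        (hasFDerivAt_norm_sub_sq_div r x y)).const_mul (-(r * (r ^ N)⁻¹))
    rw [h2.fderiv]
    simp only [smul_apply, smul_eq_mul, innerSL_apply_apply, EuclideanSpace.inner_single_right,
      nsmul_eq_mul, conj_trivial]
    push_cast
    ring
  have h3 : ∀ j : Fin N, fderiv ℝ (fun y => fderiv ℝ (mollifierPotential r x) y
      (EuclideanSpace.single j 1)) y (EuclideanSpace.single j 1) = -(r * (r ^ N)⁻¹) *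
        (deriv cutoff (‖y - x‖ ^ 2 / r ^ 2) * (2 * (y - x) j ^ 2 / r ^ 4) +
          cutoff (‖y - x‖ ^ 2 / r ^ 2) / r ^ 2) := by
    intro j
    simp_rw [h1]
    have h4 : HasFDerivAt (fun y : Vec N => (y - x) j / r ^ 2)
        ((r ^ 2)⁻¹ • (EuclideanSpace.proj j : Vec N →L[ℝ] ℝ)) y := by
      simp_rw [div_eq_inv_mul]
      exact ((EuclideanSpace.proj (𝕜 := ℝ) j).hasFDerivAt.comp y
        ((hasFDerivAt_id y).sub_const x)).const_mul _
    have hproj : (EuclideanSpace.proj j : Vec N →L[ℝ] ℝ) (EuclideanSpace.single j 1) = 1 := by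
      simp
    have h5 := (((hasDerivAt_cutoff _).comp_hasFDerivAt y
        (hasFDerivAt_norm_sub_sq_div r x y)).mul h4).const_mul (-(r * (r ^ N)⁻¹))
    have h6 : HasFDerivAt (fun y : Vec N => -(r * (r ^ N)⁻¹) *
      (cutoff (‖y - x‖ ^ 2 / r ^ 2) * ((y - x) j / r ^ 2))) _ y := h5
    rw [h6.fderiv]
    simp only [smul_apply, add_apply, smul_eq_mul, innerSL_apply_apply,
      EuclideanSpace.inner_single_right, nsmul_eq_mul, conj_trivial, Function.comp_apply, hproj]
    push_cast
    field_simp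
    ring
  rw [lap, Finset.sum_congr rfl fun j _ => h3 j, ← Finset.mul_sum, Finset.sum_add_distrib,
    ← Finset.mul_sum, ← Finset.sum_div, ← Finset.mul_sum, EuclideanSpace.real_norm_sq_eq (y - x)]
  simp only [Finset.sum_const, Finset.card_univ, Fintype.card_fin, nsmul_eq_mul]
  ring

/-- The scaling preserves mass, so the derivative in the radius is a divergence: `∂ᵣ m = -div(z m /
r)`. As `m` is radial, this field is a gradient, namely that of `mollifierPotential`. The identity
yields a mean value property for distributions that avoids integrals over spheres. -/
theorem hasDerivAt_mollifier {r : ℝ} (hr : 0 < r) (x y : Vec N) :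
    HasDerivAt (fun r => mollifier r (x - y)) (lap (mollifierPotential r x) y) r := by
  rw [lap_mollifierPotential hr, norm_sub_rev y x]
  have h1 : HasDerivAt (fun r : ℝ => ‖x - y‖ ^ 2 / r ^ 2) (-(2 * ‖x - y‖ ^ 2 / r ^ 3)) r := by
    have := ((hasDerivAt_pow 2 r).fun_inv (by positivity)).const_mul (‖x - y‖ ^ 2)
    simp_rw [div_eq_mul_inv]
    refine this.congr_deriv ?_
    field_simp
    norm_num
    ring
  have h2 : HasDerivAt (fun r : ℝ => (r ^ N)⁻¹) (-(N * (r ^ N)⁻¹ / r)) r := by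
    refine ((hasDerivAt_pow N r).fun_inv (by positivity)).congr_deriv ?_
    rcases N with _ | n
    · simp
    · push_cast
      field_simp
      simp [pow_succ]
  have h3 := h2.mul ((hasDerivAt_cutoff _).comp r h1)
  refine HasDerivAt.congr_deriv h3 ?_
  simp only [Function.comp_apply]
  field_simp
  ring

theorem exists_lap_mollifierPotential_bound (N : ℕ) : ∃ B : ℝ, 0 ≤ B ∧ ∀ r : ℝ, 0 < r →
    ∀ x y : Vec N, |lap (mollifierPotential r x) y| ≤ B * (r ^ (N + 1))⁻¹ := by
  obtain ⟨B, hB0, hB⟩ := exists_deriv_cutoff_bound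
  refine ⟨2 * B + N, by positivity, fun r hr x y => ?_⟩
  rw [lap_mollifierPotential hr, abs_mul, abs_neg, abs_of_pos (by positivity : 0 < r * (r ^ N)⁻¹)]
  have h1 : |deriv cutoff (‖y - x‖ ^ 2 / r ^ 2) * (2 * ‖y - x‖ ^ 2 / r ^ 4)| ≤ 2 * B / r ^ 2 := by
    rcases le_total r ‖y - x‖ with hz | hz
    · rw [deriv_cutoff_eq_zero (one_le_norm_sq_div hr hz), zero_mul, abs_zero]
      positivity
    · rw [abs_mul, abs_of_nonneg (by positivity : 0 ≤ 2 * ‖y - x‖ ^ 2 / r ^ 4)]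
      calc _ ≤ B * (2 * r ^ 2 / r ^ 4) := by
            gcongr
            exact hB _ (by positivity)
        _ = _ := by field_simp
  have h2 : |N * cutoff (‖y - x‖ ^ 2 / r ^ 2) / r ^ 2| ≤ N / r ^ 2 := by
    rw [abs_of_nonneg (div_nonneg (mul_nonneg (by positivity) (cutoff_nonneg _)) (by positivity))]
    gcongr
    exact mul_le_of_le_one_right (by positivity) (cutoff_le_one _)
  calc _ ≤ r * (r ^ N)⁻¹ * (2 * B / r ^ 2 + N / r ^ 2) := by
        gcongr
        exact (abs_add_le _ _).trans (add_le_add h1 h2)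
    _ = _ := by field_simp; ring

end

section

variable {N : ℕ}

/-! ### Weakly harmonic functions -/

/-- `h` is harmonic in `Ω` in the sense of distributions. -/
def WeaklyHarmonicOn (Ω : Set (Vec N)) (h : Vec N → ℝ) : Prop :=
  ∀ φ : Vec N → ℝ, ContDiff ℝ ((⊤ : ℕ∞) : WithTop ℕ∞) φ → HasCompactSupport φ → tsupport φ ⊆ Ω →
    ∫ y, h y * lap φ y = 0

/-- The mollification of `h` at scale `r`. -/
def mollify (h : Vec N → ℝ) (r : ℝ) (x : Vec N) : ℝ := ∫ y, h y * mollifier r (x - y)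

variable {h : Vec N → ℝ}

theorem continuous_lap {φ : Vec N → ℝ} (hφ : ContDiff ℝ ((⊤ : ℕ∞) : WithTop ℕ∞) φ) :
    Continuous (lap φ) := by
  refine continuous_finsetSum _ fun j _ => ?_
  have h1 : ContDiff ℝ 1 (fderiv ℝ φ) := hφ.fderiv_right (by norm_cast)
  have h2 : ContDiff ℝ 1 fun y => fderiv ℝ φ y (EuclideanSpace.single j 1) :=
    h1.clm_apply contDiff_const
  exact (h2.continuous_fderiv (by simp)).clm_apply continuous_const

theorem integrable_mul_mollifier (hh : Integrable h) {r : ℝ} (hr : 0 < r) (x : Vec N) :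
    Integrable fun y => h y * mollifier r (x - y) := by
  refine hh.mul_bdd (c := (r ^ N)⁻¹) ?_ (Eventually.of_forall fun y => ?_)
  · exact ((contDiff_mollifier r).continuous.comp
      (continuous_const.sub continuous_id)).aestronglyMeasurable
  · rw [Real.norm_of_nonneg (mollifier_nonneg hr _)]
    exact mollifier_le hr _

theorem hasDerivAt_mollify_radius (hh : Integrable h) {r : ℝ} (hr : 0 < r) (x : Vec N) :
    HasDerivAt (fun r => mollify h r x) (∫ y, h y * lap (mollifierPotential r x) y) r := by
  obtain ⟨B, hB0, hB⟩ := exists_lap_mollifierPotential_bound N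
  -- Above `r / 2` the bound of order `s^{-(N+1)}` on the Laplacian is uniform in the radius `s`, so
  -- a multiple of `‖h‖` dominates.
  have hs : Set.Ioi (r / 2) ∈ 𝓝 r := Ioi_mem_nhds (by linarith)
  refine (hasDerivAt_integral_of_dominated_loc_of_deriv_le (𝕜 := ℝ)
    (F := fun r y => h y * mollifier r (x - y))
    (F' := fun r y => h y * lap (mollifierPotential r x) y)
    (bound := fun y => ‖h y‖ * (B * ((r / 2) ^ (N + 1))⁻¹)) hs ?_ ?_ ?_ ?_ ?_ ?_).2
  · filter_upwards [eventually_gt_nhds hr] with s hs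
    exact (integrable_mul_mollifier hh hs x).aestronglyMeasurable
  · exact integrable_mul_mollifier hh hr x
  · exact hh.aestronglyMeasurable.mul
      (continuous_lap (contDiff_mollifierPotential r x)).aestronglyMeasurable
  · refine Eventually.of_forall fun y s hs => ?_
    have hs' : r / 2 < s := hs
    have hs0 : 0 < s := by linarith
    rw [norm_mul, Real.norm_eq_abs (lap _ _)]
    gcongr
    refine (hB s hs0 x y).trans ?_
    gcongr
  · exact hh.norm.mul_const _
  · refine Eventually.of_forall fun y s hs => ?_
    have hs' : r / 2 < s := hs
    have hs0 : 0 < s := by linarith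
    exact (hasDerivAt_mollifier hs0 x y).const_mul (h y)

theorem tsupport_mollifierPotential_subset {r : ℝ} (hr : 0 < r) (x : Vec N) :
    tsupport (mollifierPotential r x) ⊆ Metric.closedBall x r :=
  tsupport_subset_closedBall fun _ hy => mollifierPotential_eq_zero hr hy

/-- The mean value property: the derivative in the radius `t` tests `h` against the Laplacian of a
function supported in the closed ball of radius `t`, hence vanishes. -/
theorem WeaklyHarmonicOn.mollify_eq {Ω : Set (Vec N)} (hΩ : WeaklyHarmonicOn Ω h)
    (hh : Integrable h) {x : Vec N} {r s : ℝ} (hr : 0 < r) (hrs : r ≤ s)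
    (hs : Metric.closedBall x s ⊆ Ω) : mollify h r x = mollify h s x := by
  have hd : ∀ t ∈ Set.Icc r s, HasDerivAt (fun r => mollify h r x) 0 t := by
    intro t ht
    have ht0 : 0 < t := hr.trans_le ht.1
    have hsub := tsupport_mollifierPotential_subset ht0 x
    have := hasDerivAt_mollify_radius hh ht0 x
    rwa [hΩ _ (contDiff_mollifierPotential t x)
      ((isCompact_closedBall x t).of_isClosed_subset (isClosed_tsupport _) hsub)
      (hsub.trans ((Metric.closedBall_subset_closedBall ht.2).trans hs))] at this
  exact (constant_of_has_deriv_right_zero (fun t ht => (hd t ht).continuousAt.continuousWithinAt)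
    (fun t ht => (hd t ⟨ht.1, ht.2.le⟩).hasDerivWithinAt) s ⟨hrs, le_rfl⟩).symm

theorem WeaklyHarmonicOn.mollify_eq_of_closedBall {Ω : Set (Vec N)} (hΩ : WeaklyHarmonicOn Ω h)
    (hh : Integrable h) {x : Vec N} {r s : ℝ} (hr : 0 < r) (hr' : Metric.closedBall x r ⊆ Ω)
    (hs : 0 < s) (hs' : Metric.closedBall x s ⊆ Ω) : mollify h r x = mollify h s x := by
  rcases le_total r s with h' | h'
  · exact hΩ.mollify_eq hh hr h' hs'
  · exact (hΩ.mollify_eq hh hs h' hr').symm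

theorem mollify_eq_convolution (h : Vec N → ℝ) (r : ℝ) :
    mollify h r = convolution h (mollifier r) (ContinuousLinearMap.mul ℝ ℝ) volume := rfl

theorem contDiff_mollify (hh : Integrable h) {r : ℝ} (hr : 0 < r) : ContDiff ℝ 1 (mollify h r) := by
  rw [mollify_eq_convolution]
  exact (hasCompactSupport_mollifier hr).contDiff_convolution_right (n := 1) _
    hh.locallyIntegrable ((contDiff_mollifier r).of_le (by norm_cast))

theorem fderiv_mollifier_sub (r : ℝ) (x y v : Vec N) :
    fderiv ℝ (fun y => mollifier r (x - y)) y v = -fderiv ℝ (mollifier r) (x - y) v := by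
  have h1 : HasFDerivAt (mollifier r) (fderiv ℝ (mollifier r) (x - y)) (x - y) :=
    ((contDiff_mollifier r).differentiable (by simp) _).hasFDerivAt
  have h2 := h1.comp y ((hasFDerivAt_id y).const_sub x)
  have h3 : HasFDerivAt (fun y => mollifier r (x - y)) _ y := h2
  rw [h3.fderiv]
  simp

theorem fderiv_mollify (hh : Integrable h) {r : ℝ} (hr : 0 < r) (x v : Vec N) :
    fderiv ℝ (mollify h r) x v = -∫ y, h y * fderiv ℝ (fun y => mollifier r (x - y)) y v := by
  have hc : ContDiff ℝ 1 (mollifier r : Vec N → ℝ) :=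
    (contDiff_mollifier r).of_le (by norm_cast)
  have h1 := (hasCompactSupport_mollifier hr).hasFDerivAt_convolution_right
    (ContinuousLinearMap.mul ℝ ℝ) (μ := volume) hh.locallyIntegrable hc x
  rw [mollify_eq_convolution, h1.fderiv, convolution_precompR_apply _ hh.locallyIntegrable
    ((hasCompactSupport_mollifier hr).fderiv (𝕜 := ℝ)) (hc.continuous_fderiv (by simp)),
    convolution_def, ← integral_neg]
  refine integral_congr_ae (Eventually.of_forall fun y => ?_)
  simp only [ContinuousLinearMap.mul_apply', fderiv_mollifier_sub, mul_neg, neg_neg]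

/-- Lebesgue differentiation: the mollifier at scale `r` is supported in the ball of radius `r` and
bounded by a constant over its volume, so convergence holds at Lebesgue points of `h`. -/
theorem ae_tendsto_mollify (hh : Integrable h) :
    ∀ᵐ x, Tendsto (fun r => mollify h r x) (𝓝[>] 0) (𝓝 (mollifierMass N * h x)) := by
  filter_upwards [(Besicovitch.vitaliFamily (volume : Measure (Vec N))).ae_tendsto_average_norm_sub
    hh.locallyIntegrable] with x hx
  have hM := mollifierMass_pos N
  have h1 := hx.comp (Besicovitch.tendsto_filterAt volume x)
  have h2 := tendsto_integral_smul_of_tendsto_average_norm_sub (f := h) (c := h x)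
    (g := fun r y => (mollifierMass N)⁻¹ * mollifier r (x - y))
    ((mollifierMass N)⁻¹ * volume.real (Metric.ball (0 : Vec N) 1)) h1 ?_ ?_ ?_ ?_
  · have h3 := h2.const_mul (mollifierMass N)
    refine h3.congr fun r => ?_
    rw [mollify, ← integral_const_mul]
    refine integral_congr_ae (Eventually.of_forall fun y => ?_)
    simp only [smul_eq_mul]
    field_simp
  · exact Eventually.of_forall fun r => hh.integrableOn
  · refine tendsto_const_nhds.congr' ?_
    filter_upwards [self_mem_nhdsWithin] with r hr
    rw [integral_const_mul, integral_sub_left_eq_self (mollifier r) volume x, integral_mollifier hr,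
      inv_mul_cancel₀ hM.ne']
  · filter_upwards [self_mem_nhdsWithin] with r hr
    intro y hy
    rw [Metric.mem_closedBall, dist_comm, dist_eq_norm]
    by_contra! hlt
    exact hy (by simp [mollifier_eq_zero hr hlt.le])
  · filter_upwards [self_mem_nhdsWithin] with r hr y
    have hr0 : 0 < r := hr
    have hb : 0 < volume.real (Metric.ball (0 : Vec N) 1) :=
      ENNReal.toReal_pos (Metric.measure_ball_pos _ _ one_pos).ne' measure_ball_lt_top.ne
    have hv : volume.real (Metric.closedBall x r) =
        r ^ N * volume.real (Metric.ball (0 : Vec N) 1) := by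
      rw [Measure.real, Measure.addHaar_closedBall _ _ hr0.le, ENNReal.toReal_mul,
        finrank_euclideanSpace_fin, ENNReal.toReal_ofReal (by positivity), Measure.real]
    rw [abs_of_nonneg (mul_nonneg (by positivity) (mollifier_nonneg hr0 _)), hv]
    calc _ ≤ (mollifierMass N)⁻¹ * (r ^ N)⁻¹ := by gcongr; exact mollifier_le hr0 _
      _ = _ := by field_simp

open Classical in
/-- The smooth representative of a weakly harmonic function. -/
def harmonicRep (Ω : Set (Vec N)) (h : Vec N → ℝ) (x : Vec N) : ℝ :=
  if hx : ∃ r : ℝ, 0 < r ∧ Metric.closedBall x r ⊆ Ω then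
    (mollifierMass N)⁻¹ * mollify h hx.choose x
  else 0

theorem WeaklyHarmonicOn.harmonicRep_eq {Ω : Set (Vec N)} (hΩ : WeaklyHarmonicOn Ω h)
    (hh : Integrable h) {x : Vec N} {r : ℝ} (hr : 0 < r) (hx : Metric.closedBall x r ⊆ Ω) :
    harmonicRep Ω h x = (mollifierMass N)⁻¹ * mollify h r x := by
  have hex : ∃ r : ℝ, 0 < r ∧ Metric.closedBall x r ⊆ Ω := ⟨r, hr, hx⟩
  rw [harmonicRep, dif_pos hex]
  congr 1
  exact hΩ.mollify_eq_of_closedBall hh hex.choose_spec.1 hex.choose_spec.2 hr hx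

/-- The value does not depend on the chosen radius, and near `x` the single scale `r / 2` serves all
points. Locally the representative is thus one mollification and inherits its regularity. -/
theorem WeaklyHarmonicOn.harmonicRep_eventuallyEq {Ω : Set (Vec N)} (hΩ : WeaklyHarmonicOn Ω h)
    (hh : Integrable h) {x : Vec N} {r : ℝ} (hr : 0 < r) (hx : Metric.ball x r ⊆ Ω) :
    harmonicRep Ω h =ᶠ[𝓝 x] fun y => (mollifierMass N)⁻¹ * mollify h (r / 2) y := by
  filter_upwards [Metric.ball_mem_nhds x (half_pos hr)] with y hy
  refine hΩ.harmonicRep_eq hh (half_pos hr) (Set.Subset.trans (fun z hz => ?_) hx)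
  rw [Metric.mem_closedBall] at hz
  rw [Metric.mem_ball] at hy ⊢
  linarith [dist_triangle z y x]

theorem WeaklyHarmonicOn.ae_eq_harmonicRep {Ω : Set (Vec N)} (hΩo : IsOpen Ω)
    (hΩ : WeaklyHarmonicOn Ω h) (hh : Integrable h) : ∀ᵐ x, x ∈ Ω → h x = harmonicRep Ω h x := by
  filter_upwards [ae_tendsto_mollify hh] with x hx hxΩ
  have hM := mollifierMass_pos N
  obtain ⟨r, hr, hsub⟩ := Metric.isOpen_iff.mp hΩo x hxΩ
  have h1 : (fun s => mollify h s x) =ᶠ[𝓝[>] 0] fun _ => mollifierMass N * harmonicRep Ω h x := by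
    filter_upwards [Ioo_mem_nhdsGT hr] with s hs
    rw [hΩ.harmonicRep_eq hh hs.1 ((Metric.closedBall_subset_ball hs.2).trans hsub), ← mul_assoc,
      mul_inv_cancel₀ hM.ne', one_mul]
  have h2 := tendsto_nhds_unique (hx.congr' h1) tendsto_const_nhds
  exact mul_left_cancel₀ hM.ne' h2

/-- The `L²` bound for `∇h` in the dual of `H¹₀`, localized to balls. -/
def LocalDualGradientBound (Ω : Set (Vec N)) (C : ℝ≥0) (h : Vec N → ℝ) (W : Vec N → ℝ≥0∞) : Prop :=
  ∀ (x : Vec N) (r : ℝ) (φ : Vec N → ℝ) (v : Vec N), ContDiff ℝ ((⊤ : ℕ∞) : WithTop ℕ∞) φ →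
    HasCompactSupport φ → tsupport φ ⊆ Metric.ball x r → Metric.ball x r ⊆ Ω →
      ‖∫ y, h y * fderiv ℝ φ y v‖ₑ ^ 2 ≤
        C * ‖v‖ₑ ^ 2 * (∫⁻ y in Metric.ball x r, W y) * ∫⁻ y, ‖fderiv ℝ φ y‖ₑ ^ 2

/-- The gradient has size `r^{-(N+1)}` on a ball of volume of order `r^N`. This is the origin of the
exponent `N + 2` in `InteriorGradientBound`. -/
theorem exists_lintegral_fderiv_mollifier_bound (N : ℕ) : ∃ B : ℝ≥0, ∀ (r : ℝ) (x : Vec N), 0 < r →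
    ENNReal.ofReal (r ^ (N + 2)) * ∫⁻ y, ‖fderiv ℝ (fun y => mollifier r (x - y)) y‖ₑ ^ 2 ≤ B := by
  obtain ⟨B, hB0, hB⟩ := exists_fderiv_mollifier_bound N
  refine ⟨(ENNReal.ofReal (B ^ 2) * volume (Metric.ball (0 : Vec N) 1)).toNNReal,
    fun r x hr => ?_⟩
  rw [ENNReal.coe_toNNReal (ENNReal.mul_ne_top ENNReal.ofReal_ne_top measure_ball_lt_top.ne)]
  have h1 : ∀ y, ‖fderiv ℝ (fun y => mollifier r (x - y)) y‖ₑ ^ 2 ≤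
      (Metric.closedBall x r).indicator
        (fun _ => ENNReal.ofReal ((B * (r ^ (N + 1))⁻¹) ^ 2)) y := by
    intro y
    by_cases hy : y ∈ Metric.closedBall x r
    · rw [Set.indicator_of_mem hy, ← ofReal_norm, ← ENNReal.ofReal_pow (norm_nonneg _)]
      refine ENNReal.ofReal_le_ofReal (pow_le_pow_left₀ (norm_nonneg _) ?_ 2)
      refine ContinuousLinearMap.opNorm_le_bound _ (by positivity) fun v => ?_
      rw [fderiv_mollifier_sub, norm_neg]
      exact (ContinuousLinearMap.le_opNorm _ _).trans (by gcongr; exact hB r hr _)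
    · have hts : tsupport (fun y => mollifier r (x - y)) ⊆ Metric.closedBall x r :=
        tsupport_subset_closedBall fun y hy => mollifier_eq_zero hr hy
      have h0 : fderiv ℝ (fun y => mollifier r (x - y)) y = 0 :=
        image_eq_zero_of_notMem_tsupport fun h' => hy (hts (tsupport_fderiv_subset ℝ h'))
      rw [← ofReal_norm, h0, norm_zero, Set.indicator_of_notMem hy]
      simp
  calc _ ≤ ENNReal.ofReal (r ^ (N + 2)) * (ENNReal.ofReal ((B * (r ^ (N + 1))⁻¹) ^ 2) *
        (ENNReal.ofReal (r ^ N) * volume (Metric.ball (0 : Vec N) 1))) := by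
        gcongr
        refine (lintegral_mono h1).trans_eq ?_
        rw [lintegral_indicator_const Metric.isClosed_closedBall.measurableSet,
          Measure.addHaar_closedBall _ _ hr.le, finrank_euclideanSpace_fin]
    _ = _ := by
        rw [← mul_assoc, ← mul_assoc, ← ENNReal.ofReal_mul (by positivity),
          ← ENNReal.ofReal_mul (by positivity)]
        congr 2
        field_simp
        ring

/-- Interior gradient estimates for weakly harmonic functions, in terms of the norm of the gradient
in the dual of `H¹₀`. -/
theorem exists_interiorGradientBound (N : ℕ) (C₁ : ℝ≥0) : ∃ C₀ : ℝ≥0, ∀ (Ω : Set (Vec N))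
    (h : Vec N → ℝ) (W : Vec N → ℝ≥0∞), IsOpen Ω → WeaklyHarmonicOn Ω h → Integrable h →
    Measurable W → LocalDualGradientBound Ω C₁ h W →
      InteriorGradientBound Ω C₀ (harmonicRep Ω h) W := by
  obtain ⟨B, hB⟩ := exists_lintegral_fderiv_mollifier_bound N
  have hM := mollifierMass_pos N
  set M := mollifierMass N with hMdef
  refine ⟨2 ^ (N + 2) * (Real.toNNReal M⁻¹) ^ 2 * C₁ * B, fun Ω h W hΩo hΩ hh hW hb =>
    ⟨?_, hW, ?_⟩⟩
  · intro x hx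
    obtain ⟨r, hr, hsub⟩ := Metric.isOpen_iff.mp hΩo x hx
    exact ((contDiff_const.mul (contDiff_mollify hh (half_pos hr))).contDiffAt.congr_of_eventuallyEq
      (hΩ.harmonicRep_eventuallyEq hh hr hsub)).contDiffWithinAt
  · intro x r hr hsub
    have hr2 : 0 < r / 2 := half_pos hr
    -- Up to the factor `-M⁻¹`, the gradient of the representative at `x` is `h` tested against
    -- `∇φ`, so the dual bound applies. Half the radius keeps the support of `φ` inside the open
    -- ball.
    set φ : Vec N → ℝ := fun y => mollifier (r / 2) (x - y) with hφ
    have hφc : ContDiff ℝ ((⊤ : ℕ∞) : WithTop ℕ∞) φ :=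
      (contDiff_mollifier _).comp (contDiff_const.sub contDiff_id)
    have hφs : tsupport φ ⊆ Metric.closedBall x (r / 2) :=
      tsupport_subset_closedBall fun y hy => mollifier_eq_zero hr2 hy
    have hφk : HasCompactSupport φ :=
      (isCompact_closedBall x (r / 2)).of_isClosed_subset (isClosed_tsupport _) hφs
    have hfd : ∀ v, fderiv ℝ (harmonicRep Ω h) x v = -(M⁻¹ * ∫ y, h y * fderiv ℝ φ y v) := by
      intro v
      rw [(hΩ.harmonicRep_eventuallyEq hh hr hsub).fderiv_eq, fderiv_const_mul
        ((contDiff_mollify hh hr2).differentiable (by simp) x)]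
      rw [smul_apply, fderiv_mollify hh hr2, smul_eq_mul, mul_neg]
    set D := (Real.toNNReal M⁻¹ : ℝ≥0∞) ^ 2 * C₁ * (∫⁻ y in Metric.ball x r, W y) *
      ∫⁻ y, ‖fderiv ℝ φ y‖ₑ ^ 2 with hD
    have hbv : ∀ v, ‖fderiv ℝ (harmonicRep Ω h) x v‖ₑ ^ 2 ≤ D * ‖v‖ₑ ^ 2 := by
      intro v
      have h1 := hb x r φ v hφc hφk (hφs.trans (Metric.closedBall_subset_ball (by linarith))) hsub
      rw [hfd, enorm_neg, enorm_mul, mul_pow]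
      have h2 : ‖M⁻¹‖ₑ = (Real.toNNReal M⁻¹ : ℝ≥0∞) := by
        rw [← ofReal_norm, Real.norm_of_nonneg (by positivity)]; rfl
      rw [h2]
      refine (mul_le_mul_right h1 _).trans_eq ?_
      rw [hD]; ring
    have hnorm : ‖fderiv ℝ (harmonicRep Ω h) x‖ₑ ^ 2 ≤ D := by
      rcases eq_or_ne D ∞ with hDt | hDt
      · rw [hDt]; exact le_top
      have h1 : ‖fderiv ℝ (harmonicRep Ω h) x‖ ≤ Real.sqrt D.toReal := by
        refine ContinuousLinearMap.opNorm_le_bound _ (Real.sqrt_nonneg _) fun v => ?_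
        refine abs_le_of_sq_le_sq' ?_ (by positivity) |>.2
        rw [mul_pow, Real.sq_sqrt ENNReal.toReal_nonneg]
        have h2 := hbv v
        rw [← ofReal_norm, ← ofReal_norm, ← ENNReal.ofReal_pow (norm_nonneg _),
          ← ENNReal.ofReal_pow (norm_nonneg _), ← ENNReal.ofReal_toReal hDt,
          ← ENNReal.ofReal_mul ENNReal.toReal_nonneg,
          ENNReal.ofReal_le_ofReal_iff (by positivity)] at h2
        exact h2
      rw [← ofReal_norm, ← ENNReal.ofReal_pow (norm_nonneg _)]
      refine ENNReal.ofReal_le_of_le_toReal ?_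
      calc _ ≤ Real.sqrt D.toReal ^ 2 := by gcongr
        _ = _ := Real.sq_sqrt ENNReal.toReal_nonneg
    have e1 : ENNReal.ofReal (r ^ (N + 2)) = 2 ^ (N + 2) * ENNReal.ofReal ((r / 2) ^ (N + 2)) := by
      have : (2 : ℝ≥0∞) ^ (N + 2) = ENNReal.ofReal (2 ^ (N + 2)) := by
        rw [ENNReal.ofReal_pow (by norm_num)]; norm_num
      rw [this, ← ENNReal.ofReal_mul (by positivity), ← mul_pow, mul_div_cancel₀ _ two_ne_zero]
    calc _ ≤ ENNReal.ofReal (r ^ (N + 2)) * D := by gcongr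
      _ = 2 ^ (N + 2) * (Real.toNNReal M⁻¹ : ℝ≥0∞) ^ 2 * C₁ *
          (ENNReal.ofReal ((r / 2) ^ (N + 2)) * ∫⁻ y, ‖fderiv ℝ φ y‖ₑ ^ 2) *
            ∫⁻ y in Metric.ball x r, W y := by rw [e1, hD]; ring
      _ ≤ 2 ^ (N + 2) * (Real.toNNReal M⁻¹ : ℝ≥0∞) ^ 2 * C₁ * B *
            ∫⁻ y in Metric.ball x r, W y := by gcongr; exact hB _ x hr2
      _ = _ := by push_cast; rfl

end

section

variable {N : ℕ} {Ω : BoundedLipschitzDomain N}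

/-! ### Test fields in `H¹₀` -/

instance : IsFiniteMeasure (vol Ω) :=
  ⟨by rw [Measure.restrict_apply_univ]; exact Ω.bounded.measure_lt_top⟩

namespace H10

/-- A smooth compactly supported field as an element of `H¹₀`. -/
def ofTest (φ : 𝓓(Ω.toOpens, Vec N)) : H10 Ω :=
  ⟨⟨testGraph Ω φ, subset_closure ⟨φ, rfl⟩⟩⟩

theorem field_ofTest (φ : 𝓓(Ω.toOpens, Vec N)) : (ofTest φ).field =ᵐ[vol Ω] φ :=
  (memLp_test φ).coeFn_toLp

theorem grad_ofTest (φ : 𝓓(Ω.toOpens, Vec N)) : (ofTest φ).grad =ᵐ[vol Ω] classicalGrad φ :=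
  (memLp_classicalGrad φ).coeFn_toLp

theorem denseRange_ofTest : DenseRange (ofTest : 𝓓(Ω.toOpens, Vec N) → H10 Ω) := by
  intro u
  rw [Metric.mem_closure_iff]
  intro ε hε
  have hu : u.pair.1 ∈ closure (LinearMap.range (testGraph Ω) : Set _) := u.pair.2
  obtain ⟨_, ⟨φ, rfl⟩, hφ⟩ := Metric.mem_closure_iff.mp hu ε hε
  refine ⟨ofTest φ, ⟨φ, rfl⟩, lt_of_le_of_lt ?_ hφ⟩
  rw [dist_eq_norm, ← norm_grad, dist_eq_norm]
  exact le_max_right ‖(u - ofTest φ).field‖ ‖(u - ofTest φ).grad‖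

/-- Closed conditions on `H¹₀` can be checked on smooth compactly supported fields. -/
theorem induction_ofTest {P : H10 Ω → Prop} (hP : IsClosed {u | P u})
    (h : ∀ φ : 𝓓(Ω.toOpens, Vec N), P (ofTest φ)) (u : H10 Ω) : P u :=
  denseRange_ofTest.induction_on u hP h

/-- `u ↦ u` as a continuous linear map into `L²`. -/
def fieldL : H10 Ω →L[ℝ] Lp (Vec N) 2 (vol Ω) :=
  LinearMap.mkContinuousOfExistsBound
    { toFun := field, map_add' := fun _ _ => rfl, map_smul' := fun _ _ => rfl } <| by
      obtain ⟨C, -, hC⟩ := poincare Ω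
      exact ⟨C, fun u => by have := hC u; rwa [norm_grad] at this⟩

end H10

theorem divL_apply_ae (u : H10 Ω) : divL Ω u =ᵐ[vol Ω] fun x => ∑ i, u.grad x i i := by
  filter_upwards [(traceL N).coeFn_compLpL (p := 2) (μ := vol Ω) u.grad] with x hx
  rw [← traceL_apply, ← hx]
  rfl

theorem divL_ofTest (φ : 𝓓(Ω.toOpens, Vec N)) :
    divL Ω (H10.ofTest φ) =ᵐ[vol Ω] fun x => ∑ i, classicalGrad φ x i i := by
  filter_upwards [divL_apply_ae (H10.ofTest φ), H10.grad_ofTest φ] with x h1 h2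
  rw [h1, h2]

/-! ### Integration by parts -/

/-- The standard basis vectors. -/
abbrev basisVec (j : Fin N) : Vec N := EuclideanSpace.single j 1

section ByParts

variable {f g : Vec N → ℝ}

theorem continuous_fderiv_apply (hf : ContDiff ℝ 1 f) (v : Vec N) :
    Continuous fun y => fderiv ℝ f y v :=
  (hf.continuous_fderiv (by simp)).clm_apply continuous_const

theorem contDiff_fderiv_apply (hf : ContDiff ℝ ((⊤ : ℕ∞) : WithTop ℕ∞) f) (v : Vec N) :
    ContDiff ℝ ((⊤ : ℕ∞) : WithTop ℕ∞) fun y => fderiv ℝ f y v :=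
  (hf.fderiv_right (m := ((⊤ : ℕ∞) : WithTop ℕ∞)) (by norm_cast)).clm_apply contDiff_const

theorem integral_mul_fderiv (hf : ContDiff ℝ 1 f) (hg : ContDiff ℝ 1 g) (hgc : HasCompactSupport g)
    (v : Vec N) : ∫ y, f y * fderiv ℝ g y v = -∫ y, fderiv ℝ f y v * g y := by
  have hgc' : HasCompactSupport fun y => fderiv ℝ g y v := hgc.fderiv_apply (𝕜 := ℝ) v
  refine integral_mul_fderiv_eq_neg_fderiv_mul_of_integrable ?_ ?_ ?_
    (fun y _ => hf.differentiable (by simp) y) fun y _ => hg.differentiable (by simp) y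
  · exact ((continuous_fderiv_apply hf v).mul hg.continuous).integrable_of_hasCompactSupport
      hgc.mul_left
  · exact (hf.continuous.mul (continuous_fderiv_apply hg v)).integrable_of_hasCompactSupport
      hgc'.mul_left
  · exact (hf.continuous.mul hg.continuous).integrable_of_hasCompactSupport hgc.mul_left

theorem fderiv_fderiv_comm (hf : ContDiff ℝ ((⊤ : ℕ∞) : WithTop ℕ∞) f) (u v y : Vec N) :
    fderiv ℝ (fun y => fderiv ℝ f y u) y v = fderiv ℝ (fun y => fderiv ℝ f y v) y u := by
  have h1 : DifferentiableAt ℝ (fderiv ℝ f) y :=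
    (hf.fderiv_right (m := 1) (by norm_cast)).differentiable (by simp) y
  have h2 : IsSymmSndFDerivAt ℝ f y := hf.contDiffAt.isSymmSndFDerivAt (by
    simp only [minSmoothness_of_isRCLikeNormedField]; norm_cast)
  rw [fderiv_clm_apply h1 (differentiableAt_const u), fderiv_clm_apply h1 (differentiableAt_const v)]
  simpa using h2.eq v u

/-- Both sides are minus the integral of `f` against the mixed second derivative of `g`. -/
theorem integral_fderiv_mul_fderiv_comm (hf : ContDiff ℝ ((⊤ : ℕ∞) : WithTop ℕ∞) f)
    (hg : ContDiff ℝ ((⊤ : ℕ∞) : WithTop ℕ∞) g) (hfc : HasCompactSupport f) (u v : Vec N) :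
    ∫ y, fderiv ℝ f y u * fderiv ℝ g y v = ∫ y, fderiv ℝ f y v * fderiv ℝ g y u := by
  have hf1 : ContDiff ℝ 1 f := hf.of_le (by norm_cast)
  have key : ∀ u v : Vec N, ∫ y, fderiv ℝ f y u * fderiv ℝ g y v =
      -∫ y, fderiv ℝ (fun y => fderiv ℝ g y v) y u * f y := by
    intro u v
    rw [← integral_mul_fderiv ((contDiff_fderiv_apply hg v).of_le (by norm_cast)) hf1 hfc u]
    simp_rw [mul_comm]
  rw [key, key]
  simp_rw [fderiv_fderiv_comm hg u v]

end ByParts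

section Components

variable (φ : 𝓓(Ω.toOpens, Vec N))

theorem contDiff_component (i : Fin N) :
    ContDiff ℝ ((⊤ : ℕ∞) : WithTop ℕ∞) fun y => φ y i :=
  (EuclideanSpace.proj (𝕜 := ℝ) i).contDiff.comp φ.contDiff

theorem hasCompactSupport_component (i : Fin N) : HasCompactSupport fun y => φ y i :=
  φ.hasCompactSupport.comp_left (g := fun z : Vec N => z i) (by simp)

theorem classicalGrad_component (y : Vec N) (j i : Fin N) :
    classicalGrad φ y j i = fderiv ℝ (fun y => φ y i) y (basisVec j) := by
  have h1 : HasFDerivAt φ (fderiv ℝ φ y) y := (φ.contDiff.differentiable (by simp) y).hasFDerivAt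
  have h2 := (EuclideanSpace.proj (𝕜 := ℝ) i).hasFDerivAt.comp y h1
  have h3 : HasFDerivAt (fun y => φ y i) _ y := h2
  rw [h3.fderiv]
  rfl

theorem field_eq_zero_of_notMem {y : Vec N} (hy : y ∉ (Ω.toOpens : Set (Vec N))) : φ y = 0 :=
  image_eq_zero_of_notMem_tsupport fun h => hy (φ.tsupport_subset h)

theorem classicalGrad_eq_zero_of_notMem {y : Vec N} (hy : y ∉ (Ω.toOpens : Set (Vec N))) :
    classicalGrad φ y = 0 := by
  have h0 : fderiv ℝ φ y = 0 := image_eq_zero_of_notMem_tsupport fun h =>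
    hy (φ.tsupport_subset (tsupport_fderiv_subset ℝ h))
  ext j i
  simp [classicalGrad, h0]

end Components

/-- The test field `φ v` for a scalar test function `φ` and a constant vector `v`. -/
def smulTest {φ : Vec N → ℝ} (hφ : ContDiff ℝ ((⊤ : ℕ∞) : WithTop ℕ∞) φ) (hφc : HasCompactSupport φ)
    (hφs : tsupport φ ⊆ (Ω.toOpens : Set (Vec N))) (v : Vec N) : 𝓓(Ω.toOpens, Vec N) where
  toFun y := φ y • v
  contDiff' := hφ.smul contDiff_const
  hasCompactSupport' := hφc.smul_right
  tsupport_subset' := (tsupport_smul_subset_left φ _).trans hφs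

/-- The gradient of a scalar test function as a test field. -/
def gradTest {φ : Vec N → ℝ} (hφ : ContDiff ℝ ((⊤ : ℕ∞) : WithTop ℕ∞) φ) (hφc : HasCompactSupport φ)
    (hφs : tsupport φ ⊆ (Ω.toOpens : Set (Vec N))) : 𝓓(Ω.toOpens, Vec N) where
  toFun y := WithLp.toLp 2 fun i => fderiv ℝ φ y (basisVec i)
  contDiff' := (PiLp.contDiff_toLp (p := 2)).comp
    (contDiff_pi.2 fun i => contDiff_fderiv_apply hφ (basisVec i))
  hasCompactSupport' := (hφc.fderiv (𝕜 := ℝ)).comp_left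
    (g := fun L : Vec N →L[ℝ] ℝ => (WithLp.toLp 2 fun i => L (basisVec i) : Vec N)) (by ext; simp)
  tsupport_subset' := by
    refine Set.Subset.trans ?_ ((tsupport_fderiv_subset ℝ).trans hφs)
    refine closure_mono fun y hy => ?_
    contrapose! hy
    simp only [Function.mem_support, ne_eq, not_not] at hy ⊢
    ext i
    simp [hy]

section ScalarTest

variable {φ : Vec N → ℝ} (hφ : ContDiff ℝ ((⊤ : ℕ∞) : WithTop ℕ∞) φ) (hφc : HasCompactSupport φ)
  (hφs : tsupport φ ⊆ (Ω.toOpens : Set (Vec N)))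

theorem classicalGrad_smulTest (v y : Vec N) (j i : Fin N) :
    classicalGrad (smulTest hφ hφc hφs v) y j i = fderiv ℝ φ y (basisVec j) * v i := by
  rw [classicalGrad_component]
  change fderiv ℝ (fun y => φ y * v i) y (basisVec j) = _
  rw [fderiv_mul_const (hφ.differentiable (by simp) y)]
  simp [mul_comm]

theorem fderiv_eq_sum_basisVec (φ : Vec N → ℝ) (y v : Vec N) :
    fderiv ℝ φ y v = ∑ i, fderiv ℝ φ y (basisVec i) * v i := by
  conv_lhs => rw [← (EuclideanSpace.basisFun (Fin N) ℝ).sum_repr v]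
  simp [mul_comm]

theorem trace_classicalGrad_smulTest (v y : Vec N) :
    ∑ i, classicalGrad (smulTest hφ hφc hφs v) y i i = fderiv ℝ φ y v := by
  rw [fderiv_eq_sum_basisVec]
  exact Finset.sum_congr rfl fun i _ => classicalGrad_smulTest hφ hφc hφs v y i i

theorem classicalGrad_gradTest (y : Vec N) (j i : Fin N) :
    classicalGrad (gradTest hφ hφc hφs) y j i =
      fderiv ℝ (fun y => fderiv ℝ φ y (basisVec i)) y (basisVec j) := by
  rw [classicalGrad_component]
  rfl

theorem trace_classicalGrad_gradTest (y : Vec N) :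
    ∑ i, classicalGrad (gradTest hφ hφc hφs) y i i = lap φ y :=
  Finset.sum_congr rfl fun i _ => classicalGrad_gradTest hφ hφc hφs y i i

include hφ hφc hφs in
theorem lap_eq_zero_of_notMem {y : Vec N} (hy : y ∉ (Ω.toOpens : Set (Vec N))) : lap φ y = 0 := by
  rw [← trace_classicalGrad_gradTest hφ hφc hφs, classicalGrad_eq_zero_of_notMem _ hy]
  simp

end ScalarTest

end

section

variable {N : ℕ} {Ω : BoundedLipschitzDomain N}

/-! ### Estimate of the pressure by its gradient -/

theorem lintegral_enorm_sq_Lp {α F : Type*} [MeasurableSpace α] {μ : Measure α}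
    [NormedAddCommGroup F] (g : Lp F 2 μ) : ∫⁻ x, ‖g x‖ₑ ^ 2 ∂μ = ENNReal.ofReal (‖g‖ ^ 2) := by
  have h2 : eLpNorm g 2 μ ^ 2 = ∫⁻ x, ‖g x‖ₑ ^ 2 ∂μ := by
    have := eLpNorm_nnreal_pow_eq_lintegral (μ := μ) (f := (g : α → F)) (p := 2) (by norm_num)
    simpa using this
  rw [← h2, Lp.norm_def, ENNReal.ofReal_pow ENNReal.toReal_nonneg,
    ENNReal.ofReal_toReal (Lp.eLpNorm_ne_top g)]

theorem integral_vol_eq {f : Vec N → ℝ} (hf : ∀ y, y ∉ (Ω.toOpens : Set (Vec N)) → f y = 0) :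
    ∫ y, f y ∂(vol Ω) = ∫ y, f y :=
  setIntegral_eq_integral_of_forall_compl_eq_zero hf

section

variable {φ : Vec N → ℝ} (hφ : ContDiff ℝ ((⊤ : ℕ∞) : WithTop ℕ∞) φ) (hφc : HasCompactSupport φ)
  (hφs : tsupport φ ⊆ (Ω.toOpens : Set (Vec N)))

include hφ hφc hφs in
-- A gradient field has no curl: for smooth `ψ`, exchanging `∂ᵢ` and `∂ⱼ` by parts turns `∫ ∂ⱼ∂ᵢφ
-- ∂ⱼψᵢ` into `∫ ∂ⱼ∂ⱼφ ∂ᵢψᵢ`. Density extends the identity to `H¹₀`.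
theorem inner_gradTest (w : H10 Ω) :
    inner ℝ (H10.ofTest (gradTest hφ hφc hφs)) w =
      inner ℝ (divL Ω (H10.ofTest (gradTest hφ hφc hφs))) (divL Ω w) := by
  refine H10.induction_ofTest (P := fun w => inner ℝ (H10.ofTest (gradTest hφ hφc hφs)) w =
      inner ℝ (divL Ω (H10.ofTest (gradTest hφ hφc hφs))) (divL Ω w))
    (isClosed_eq (continuous_const.inner continuous_id)
      (continuous_const.inner (divL Ω).continuous)) (fun ψ => ?_) w
  have hL : inner ℝ (H10.ofTest (gradTest hφ hφc hφs)) (H10.ofTest ψ) =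
      ∫ y, inner ℝ (classicalGrad (gradTest hφ hφc hφs) y) (classicalGrad ψ y) := by
    refine Eq.trans ?_ (integral_vol_eq (Ω := Ω) fun y hy => ?_)
    · rw [H10.inner_def]
      refine integral_congr_ae ?_
      filter_upwards [H10.grad_ofTest (gradTest hφ hφc hφs), H10.grad_ofTest ψ] with y h1 h2
      rw [h1, h2]
    · rw [classicalGrad_eq_zero_of_notMem _ hy, inner_zero_left]
  have hR : inner ℝ (divL Ω (H10.ofTest (gradTest hφ hφc hφs))) (divL Ω (H10.ofTest ψ)) =
      ∫ y, lap φ y * ∑ i, classicalGrad ψ y i i := by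
    refine Eq.trans ?_ (integral_vol_eq (Ω := Ω) fun y hy => ?_)
    · rw [L2.inner_def]
      refine integral_congr_ae ?_
      filter_upwards [divL_ofTest (gradTest hφ hφc hφs), divL_ofTest ψ] with y h1 h2
      rw [h1, h2, trace_classicalGrad_gradTest, RCLike.inner_apply, conj_trivial, mul_comm]
    · rw [lap_eq_zero_of_notMem hφ hφc hφs hy, zero_mul]
  rw [hL, hR]
  have hint : ∀ (i j k l : Fin N), Integrable fun y =>
      fderiv ℝ (fun y => fderiv ℝ φ y (basisVec i)) y (basisVec j) *
        fderiv ℝ (fun y => ψ y k) y (basisVec l) := fun i j k l => by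
    have c1 := (contDiff_fderiv_apply (contDiff_fderiv_apply hφ (basisVec i)) (basisVec j)).continuous
    have c2 := (contDiff_fderiv_apply (contDiff_component ψ k) (basisVec l)).continuous
    exact (c1.mul c2).integrable_of_hasCompactSupport
      (((hasCompactSupport_component ψ k).fderiv_apply (𝕜 := ℝ) _).mul_left)
  calc _ = ∫ y, ∑ j, ∑ i, fderiv ℝ (fun y => fderiv ℝ φ y (basisVec i)) y (basisVec j) *
        fderiv ℝ (fun y => ψ y i) y (basisVec j) := by
        refine integral_congr_ae (Eventually.of_forall fun y => ?_)
        simp only [PiLp.inner_apply, classicalGrad_gradTest, classicalGrad_component ψ,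
          RCLike.inner_apply, conj_trivial]
        exact Finset.sum_congr rfl fun j _ => Finset.sum_congr rfl fun i _ => mul_comm _ _
    _ = ∑ j, ∑ i, ∫ y, fderiv ℝ (fun y => fderiv ℝ φ y (basisVec i)) y (basisVec j) *
        fderiv ℝ (fun y => ψ y i) y (basisVec j) := by
        rw [integral_finsetSum _ fun j _ => integrable_finsetSum _ fun i _ => hint i j i j]
        exact Finset.sum_congr rfl fun j _ => integral_finsetSum _ fun i _ => hint i j i j
    _ = ∑ j, ∑ i, ∫ y, fderiv ℝ (fun y => fderiv ℝ φ y (basisVec j)) y (basisVec j) *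
        fderiv ℝ (fun y => ψ y i) y (basisVec i) := by
        refine Finset.sum_congr rfl fun j _ => Finset.sum_congr rfl fun i _ => ?_
        simp_rw [fderiv_fderiv_comm hφ (basisVec i) (basisVec j)]
        exact integral_fderiv_mul_fderiv_comm (contDiff_fderiv_apply hφ _) (contDiff_component ψ i)
          (hφc.fderiv_apply (𝕜 := ℝ) _) _ _
    _ = ∫ y, ∑ j, ∑ i, fderiv ℝ (fun y => fderiv ℝ φ y (basisVec j)) y (basisVec j) *
        fderiv ℝ (fun y => ψ y i) y (basisVec i) := by
        rw [integral_finsetSum _ fun j _ => integrable_finsetSum _ fun i _ => hint j j i i]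
        exact Finset.sum_congr rfl fun j _ => (integral_finsetSum _ fun i _ => hint j j i i).symm
    _ = _ := by
        refine integral_congr_ae (Eventually.of_forall fun y => ?_)
        simp only [lap, classicalGrad_component, Finset.sum_mul_sum]

end

/-- The extension by zero of a square integrable function on `Ω`. -/
def zeroExt (h : Lp ℝ 2 (vol Ω)) : Vec N → ℝ := (Ω.toOpens : Set (Vec N)).indicator h

theorem integrable_zeroExt (h : Lp ℝ 2 (vol Ω)) : Integrable (zeroExt h) := by
  rw [zeroExt, integrable_indicator_iff Ω.toOpens.isOpen.measurableSet]
  exact (Lp.memLp h).integrable (by norm_num)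

theorem integral_zeroExt_mul (h : Lp ℝ 2 (vol Ω)) (f : Vec N → ℝ) :
    ∫ y, zeroExt h y * f y = ∫ y, h y * f y ∂(vol Ω) := by
  rw [← integral_indicator Ω.toOpens.isOpen.measurableSet]
  refine integral_congr_ae (Eventually.of_forall fun y => ?_)
  by_cases hy : y ∈ (Ω.toOpens : Set (Vec N)) <;> simp [zeroExt, hy]

theorem integral_zeroExt_mul_div (h : Lp ℝ 2 (vol Ω)) (φ : 𝓓(Ω.toOpens, Vec N)) :
    ∫ y, zeroExt h y * ∑ i, classicalGrad φ y i i = inner ℝ h (divL Ω (H10.ofTest φ)) := by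
  rw [integral_zeroExt_mul, L2.inner_def]
  refine integral_congr_ae ?_
  filter_upwards [divL_ofTest φ] with y hy
  rw [hy, RCLike.inner_apply, conj_trivial, mul_comm]

/-- The Riesz representative of the gradient of `p`. -/
def gradAdj (Ω : BoundedLipschitzDomain N) : Lp ℝ 2 (vol Ω) →L[ℝ] H10 Ω :=
  ContinuousLinearMap.adjoint (divL Ω)

theorem inner_gradAdj (p : Lp ℝ 2 (vol Ω)) (v : H10 Ω) :
    inner ℝ (gradAdj Ω p) v = inner ℝ p (divL Ω v) :=
  ContinuousLinearMap.adjoint_inner_left _ _ _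

/-- The harmonic part of `p`. -/
def harmonicPart (p : Lp ℝ 2 (vol Ω)) : Lp ℝ 2 (vol Ω) := p - divL Ω (gradAdj Ω p)

/-- Formally `w = gradAdj Ω p` solves `Δw = ∇p`, so `Δ(p - div w) = 0`. Weakly, `⟨p, Δφ⟩` and `⟨div
w, Δφ⟩` both equal `⟨w, ∇φ⟩`, the latter by `inner_gradTest`. -/
theorem weaklyHarmonicOn_harmonicPart (p : Lp ℝ 2 (vol Ω)) :
    WeaklyHarmonicOn (Ω.toOpens : Set (Vec N)) (zeroExt (harmonicPart p)) := by
  intro φ hφ hφc hφs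
  have h1 := integral_zeroExt_mul_div (harmonicPart p) (gradTest hφ hφc hφs)
  simp_rw [trace_classicalGrad_gradTest] at h1
  rw [h1, harmonicPart, inner_sub_left, ← inner_gradAdj,
    real_inner_comm (divL Ω (H10.ofTest _)), ← inner_gradTest, real_inner_comm, sub_self]

theorem norm_le_norm_entry (A : Mat N) (j i : Fin N) : |A j i| ≤ ‖A‖ :=
  (PiLp.norm_apply_le (A j) i).trans (PiLp.norm_apply_le A j)

/-- The definition of `w` trades `p` for `∇w`: the harmonic part, tested against a divergence, sees
only the gradient of `w` on the support of the test field. -/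
theorem integral_harmonicPart_mul_div (p : Lp ℝ 2 (vol Ω)) (φ : 𝓓(Ω.toOpens, Vec N)) :
    ∫ y, zeroExt (harmonicPart p) y * ∑ i, classicalGrad φ y i i =
      ∫ y, (inner ℝ ((gradAdj Ω p).grad y) (classicalGrad φ y) -
        (∑ i, (gradAdj Ω p).grad y i i) * ∑ i, classicalGrad φ y i i) ∂(vol Ω) := by
  set w := gradAdj Ω p with hw
  rw [integral_zeroExt_mul_div, harmonicPart, inner_sub_left, ← inner_gradAdj, ← hw,
    H10.inner_def, L2.inner_def, ← integral_sub]
  · refine integral_congr_ae ?_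
    filter_upwards [H10.grad_ofTest φ, divL_ofTest φ, divL_apply_ae w] with y h1 h2 h3
    rw [h1, h2, h3, RCLike.inner_apply, conj_trivial, mul_comm (∑ i, classicalGrad φ y i i)]
  · exact L2.integrable_inner _ _
  · exact L2.integrable_inner _ _

/-- The square of the gradient of `w`, extended by zero. -/
def gradSq (w : H10 Ω) : Vec N → ℝ≥0∞ := (Ω.toOpens : Set (Vec N)).indicator fun y => ‖w.grad y‖ₑ ^ 2

theorem measurable_gradSq (w : H10 Ω) : Measurable (gradSq w) :=
  ((Lp.stronglyMeasurable w.grad).enorm.pow_const 2).indicator Ω.toOpens.isOpen.measurableSet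

theorem lintegral_gradSq (w : H10 Ω) : ∫⁻ y, gradSq w y = ENNReal.ofReal (‖w‖ ^ 2) := by
  rw [gradSq, lintegral_indicator Ω.toOpens.isOpen.measurableSet, lintegral_enorm_sq_Lp,
    H10.norm_grad]

theorem abs_trace_le (A : Mat N) : |∑ i, A i i| ≤ N * ‖A‖ := by
  refine (Finset.abs_sum_le_sum_abs _ _).trans
    ((Finset.sum_le_sum fun i _ => norm_le_norm_entry A i i).trans_eq ?_)
  simp

theorem abs_inner_classicalGrad_smulTest_le {φ : Vec N → ℝ}
    (hφ : ContDiff ℝ ((⊤ : ℕ∞) : WithTop ℕ∞) φ) (hφc : HasCompactSupport φ)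
    (hφs : tsupport φ ⊆ (Ω.toOpens : Set (Vec N))) (v y : Vec N) (A : Mat N) :
    |inner ℝ A (classicalGrad (smulTest hφ hφc hφs v) y)| ≤ N * (‖A‖ * (‖fderiv ℝ φ y‖ * ‖v‖)) := by
  have e : inner ℝ A (classicalGrad (smulTest hφ hφc hφs v) y) =
      ∑ j, fderiv ℝ φ y (basisVec j) * inner ℝ (A j) v := by
    rw [PiLp.inner_apply]
    refine Finset.sum_congr rfl fun j _ => ?_
    rw [PiLp.inner_apply, PiLp.inner_apply, Finset.mul_sum]
    refine Finset.sum_congr rfl fun i _ => ?_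
    rw [classicalGrad_smulTest]
    simp only [RCLike.inner_apply, conj_trivial]
    ring
  rw [e]
  refine (Finset.abs_sum_le_sum_abs _ _).trans ((Finset.sum_le_sum (g := fun _ =>
    ‖A‖ * (‖fderiv ℝ φ y‖ * ‖v‖)) fun j _ => ?_).trans_eq (by simp))
  rw [abs_mul]
  have h1 : |fderiv ℝ φ y (basisVec j)| ≤ ‖fderiv ℝ φ y‖ := by
    simpa using (fderiv ℝ φ y).le_opNorm (basisVec j)
  have h2 : |inner ℝ (A j) v| ≤ ‖A‖ * ‖v‖ :=
    (abs_real_inner_le_norm _ _).trans (by gcongr; exact PiLp.norm_apply_le A j)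
  calc _ ≤ ‖fderiv ℝ φ y‖ * (‖A‖ * ‖v‖) := by gcongr
    _ = _ := by ring

/-- Test with the field `φ v`. The terms with `∇w` and with `div w` are each at most `N |∇w| |∇φ|
|v|`, whence the constant `(2N)²` after Cauchy–Schwarz on the ball. -/
theorem localDualGradientBound_harmonicPart (p : Lp ℝ 2 (vol Ω)) :
    LocalDualGradientBound (Ω.toOpens : Set (Vec N)) ((2 * N) ^ 2)
      (zeroExt (harmonicPart p)) (gradSq (gradAdj Ω p)) := by
  intro x r φ v hφ hφc hφb hb
  have hφs := hφb.trans hb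
  set w := gradAdj Ω p with hw
  have h1 := integral_harmonicPart_mul_div p (smulTest hφ hφc hφs v)
  simp_rw [trace_classicalGrad_smulTest] at h1
  have hgm : Measurable fun y => ‖w.grad y‖ₑ := (Lp.stronglyMeasurable w.grad).enorm
  have hfm : Measurable fun y => ‖fderiv ℝ φ y‖ₑ := (measurable_fderiv ℝ φ).enorm
  have hpt : ∀ y, ‖inner ℝ (w.grad y) (classicalGrad (smulTest hφ hφc hφs v) y) -
      (∑ i, w.grad y i i) * fderiv ℝ φ y v‖ₑ ≤ 2 * N * ‖v‖ₑ * (‖w.grad y‖ₑ * ‖fderiv ℝ φ y‖ₑ) := by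
    intro y
    have e : 2 * (N : ℝ≥0∞) * ‖v‖ₑ * (‖w.grad y‖ₑ * ‖fderiv ℝ φ y‖ₑ) =
        ENNReal.ofReal (2 * N * ‖v‖ * (‖w.grad y‖ * ‖fderiv ℝ φ y‖)) := by
      rw [ENNReal.ofReal_mul (by positivity), ENNReal.ofReal_mul (by positivity),
        ENNReal.ofReal_mul (by positivity), ENNReal.ofReal_mul (by positivity), ofReal_norm,
        ofReal_norm, ofReal_norm]
      simp
    rw [e, ← ofReal_norm]
    refine ENNReal.ofReal_le_ofReal ((norm_sub_le _ _).trans ?_)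
    have a1 := abs_inner_classicalGrad_smulTest_le hφ hφc hφs v y (w.grad y)
    have a2 : ‖(∑ i, w.grad y i i) * fderiv ℝ φ y v‖ ≤
        (N * ‖w.grad y‖) * (‖fderiv ℝ φ y‖ * ‖v‖) := by
      rw [norm_mul]
      gcongr
      · exact abs_trace_le _
      · exact (fderiv ℝ φ y).le_opNorm v
    rw [Real.norm_eq_abs (inner _ _ _)]
    linarith
  have h0 : ∀ y, y ∉ Metric.ball x r → ‖fderiv ℝ φ y‖ₑ = 0 := fun y hy => by
    have : fderiv ℝ φ y = 0 := image_eq_zero_of_notMem_tsupport fun h =>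
      hy (hφb (tsupport_fderiv_subset ℝ h))
    rw [← ofReal_norm, this, norm_zero, ENNReal.ofReal_zero]
  have h2 : ∫⁻ y, ‖w.grad y‖ₑ * ‖fderiv ℝ φ y‖ₑ ∂(vol Ω) ≤
      ∫⁻ y in Metric.ball x r, ‖w.grad y‖ₑ * ‖fderiv ℝ φ y‖ₑ := by
    refine (setLIntegral_le_lintegral _ _).trans ?_
    rw [← lintegral_indicator Metric.isOpen_ball.measurableSet]
    refine lintegral_mono fun y => ?_
    by_cases hy : y ∈ Metric.ball x r
    · rw [Set.indicator_of_mem hy]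
    · rw [h0 y hy, mul_zero]; exact zero_le
  have h3 : ‖∫ y, zeroExt (harmonicPart p) y * fderiv ℝ φ y v‖ₑ ≤
      2 * N * ‖v‖ₑ * ∫⁻ y in Metric.ball x r, ‖w.grad y‖ₑ * ‖fderiv ℝ φ y‖ₑ := by
    rw [h1]
    calc _ ≤ ∫⁻ y, 2 * N * ‖v‖ₑ * (‖w.grad y‖ₑ * ‖fderiv ℝ φ y‖ₑ) ∂(vol Ω) :=
          (enorm_integral_le_lintegral_enorm _).trans (lintegral_mono hpt)
      _ ≤ _ := by
          rw [lintegral_const_mul _ (by fun_prop)]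
          gcongr
  have h4 : ∫⁻ y in Metric.ball x r, ‖w.grad y‖ₑ ^ 2 = ∫⁻ y in Metric.ball x r, gradSq w y := by
    refine setLIntegral_congr_fun Metric.isOpen_ball.measurableSet fun y hy => ?_
    rw [gradSq, Set.indicator_of_mem (hb hy)]
  calc _ ≤ (2 * N * ‖v‖ₑ * ∫⁻ y in Metric.ball x r, ‖w.grad y‖ₑ * ‖fderiv ℝ φ y‖ₑ) ^ 2 := by gcongr
    _ = (2 * N) ^ 2 * ‖v‖ₑ ^ 2 *
        (∫⁻ y in Metric.ball x r, ‖w.grad y‖ₑ * ‖fderiv ℝ φ y‖ₑ) ^ 2 := by ring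
    _ ≤ (2 * N) ^ 2 * ‖v‖ₑ ^ 2 * ((∫⁻ y in Metric.ball x r, ‖w.grad y‖ₑ ^ 2) *
        ∫⁻ y in Metric.ball x r, ‖fderiv ℝ φ y‖ₑ ^ 2) := by
        gcongr
        exact sq_lintegral_mul_le _ hgm.aemeasurable hfm.aemeasurable
    _ ≤ (2 * N) ^ 2 * ‖v‖ₑ ^ 2 * ((∫⁻ y in Metric.ball x r, gradSq w y) *
        ∫⁻ y, ‖fderiv ℝ φ y‖ₑ ^ 2) := by
        rw [h4]
        gcongr
        exact Measure.restrict_le_self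
    _ = _ := by push_cast; ring

/-- The average of a square integrable function is the constant closest to it. -/
theorem norm_le_norm_sub_const {g : Lp ℝ 2 (vol Ω)} (hg : ∫ y, g y ∂(vol Ω) = 0) (c : ℝ) :
    ‖g‖ ≤ ‖g - Lp.const 2 (vol Ω) c‖ := by
  have h0 : inner ℝ (Lp.const 2 (vol Ω) c) g = 0 := by
    rw [L2.inner_def]
    have : ∀ᵐ y ∂(vol Ω), inner ℝ (Lp.const 2 (vol Ω) c y) (g y) = g y * c := by
      filter_upwards [Lp.coeFn_const 2 (vol Ω) c] with y hy
      rw [hy]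
      simp
    rw [integral_congr_ae this, integral_mul_const, hg, zero_mul]
  refine abs_le_of_sq_le_sq' ?_ (norm_nonneg _) |>.2
  rw [norm_sub_sq_real, real_inner_comm, h0]
  nlinarith [sq_nonneg ‖Lp.const 2 (vol Ω) c‖]

theorem integral_divL (u : H10 Ω) : ∫ y, divL Ω u y ∂(vol Ω) = 0 := by
  have key : ∀ u : H10 Ω, ∫ y, divL Ω u y ∂(vol Ω) = inner ℝ (Lp.const 2 (vol Ω) (1 : ℝ)) (divL Ω u) := by
    intro u
    rw [L2.inner_def]
    refine integral_congr_ae ?_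
    filter_upwards [Lp.coeFn_const 2 (vol Ω) (1 : ℝ)] with y hy
    rw [hy]
    simp
  rw [key]
  refine H10.induction_ofTest (P := fun u => inner ℝ (Lp.const 2 (vol Ω) (1 : ℝ)) (divL Ω u) = 0)
    (isClosed_eq (continuous_const.inner (divL Ω).continuous) continuous_const) (fun φ => ?_) u
  rw [← key, integral_congr_ae (divL_ofTest φ), integral_vol_eq fun y hy => by
    rw [classicalGrad_eq_zero_of_notMem _ hy]; simp]
  simp_rw [classicalGrad_component]
  have hi : ∀ i : Fin N, ContDiff ℝ 1 fun y => φ y i := fun i =>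
    (contDiff_component φ i).of_le (by norm_cast)
  rw [integral_finsetSum _ fun i _ => (continuous_fderiv_apply (hi i) _).integrable_of_hasCompactSupport
    ((hasCompactSupport_component φ i).fderiv_apply (𝕜 := ℝ) _)]
  refine Finset.sum_eq_zero fun i _ => ?_
  have := integral_mul_fderiv (f := fun _ => 1) contDiff_const (hi i)
    (hasCompactSupport_component φ i) (basisVec i)
  simpa using this

/-- The `L²` norm of a function of vanishing average on a Lipschitz domain is controlled by the norm
of its gradient in `H⁻¹`. -/
theorem exists_norm_le_norm_gradAdj (Ω : BoundedLipschitzDomain N) :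
    ∃ C : ℝ, 0 ≤ C ∧ ∀ p : Lp ℝ 2 (vol Ω), ∫ y, p y ∂(vol Ω) = 0 → ‖p‖ ≤ C * ‖gradAdj Ω p‖ := by
  obtain ⟨C₀, hC₀⟩ := exists_interiorGradientBound N ((2 * N) ^ 2)
  obtain ⟨x₀, hx₀⟩ := Ω.connected.nonempty
  obtain ⟨C, hC⟩ := exists_l2OscillationBound Ω C₀ hx₀
  have hopen : IsOpen (Ω.toOpens : Set (Vec N)) := Ω.toOpens.isOpen
  -- The two summands bound the two parts of `p = h + div w`; for the harmonic part, the integral of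
  -- `W = |∇w|²` is `‖w‖²`.
  refine ⟨Real.sqrt C + ‖divL Ω‖, by positivity, fun p hp => ?_⟩
  set w := gradAdj Ω p with hw
  set h := harmonicPart p with hh
  set H := harmonicRep (Ω.toOpens : Set (Vec N)) (zeroExt h) with hH
  have hint := integrable_zeroExt h
  have hwh := weaklyHarmonicOn_harmonicPart p
  have h1 : InteriorGradientBound (Ω.toOpens : Set (Vec N)) C₀ H (gradSq w) :=
    hC₀ _ _ _ hopen hwh hint (measurable_gradSq w) (localDualGradientBound_harmonicPart p)
  have h2 := hC H (gradSq w) ‖w‖ h1 (norm_nonneg _) (lintegral_gradSq w).le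
  rw [Set.inter_self] at h2
  have h3 : ‖h - Lp.const 2 (vol Ω) (H x₀)‖ ^ 2 ≤ C * ‖w‖ ^ 2 := by
    rw [← ENNReal.ofReal_le_ofReal_iff (by positivity), ← lintegral_enorm_sq_Lp,
      ENNReal.ofReal_mul (by positivity), ENNReal.ofReal_coe_nnreal]
    refine le_trans (lintegral_mono_ae ?_) h2
    have hae := (ae_restrict_iff' hopen.measurableSet).mpr (hwh.ae_eq_harmonicRep hopen hint)
    filter_upwards [Lp.coeFn_sub h (Lp.const 2 (vol Ω) (H x₀)), Lp.coeFn_const 2 (vol Ω) (H x₀),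
      hae, ae_restrict_mem hopen.measurableSet] with y e1 e2 e3 e4
    have e5 : H y = h y := by rw [hH, ← e3, zeroExt, Set.indicator_of_mem e4]
    rw [e1, Pi.sub_apply, e2, e5, Function.const_apply]
  -- Both `p` and divergences have vanishing average, hence so does `h`; the constant `H x₀` may
  -- then be dropped without increasing the norm.
  have h4 : ∫ y, h y ∂(vol Ω) = 0 := by
    have e : ∀ᵐ y ∂(vol Ω), h y = p y - divL Ω w y := Lp.coeFn_sub p (divL Ω w)
    rw [integral_congr_ae e, integral_sub ((Lp.memLp p).integrable (by norm_num))
      ((Lp.memLp (divL Ω w)).integrable (by norm_num)), hp, integral_divL, sub_zero]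
  have h5 : ‖h‖ ≤ Real.sqrt C * ‖w‖ := by
    refine (norm_le_norm_sub_const h4 (H x₀)).trans
      (abs_le_of_sq_le_sq' ?_ (by positivity)).2
    rw [mul_pow, Real.sq_sqrt (NNReal.coe_nonneg C)]
    exact h3
  have h6 : p = h + divL Ω w := by rw [hh, harmonicPart, sub_add_cancel]
  calc ‖p‖ = ‖h + divL Ω w‖ := by rw [← h6]
    _ ≤ ‖h‖ + ‖divL Ω w‖ := norm_add_le _ _
    _ ≤ Real.sqrt C * ‖w‖ + ‖divL Ω‖ * ‖w‖ := add_le_add h5 ((divL Ω).le_opNorm w)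
    _ = _ := by ring

end

section

variable {N : ℕ}

/-! ### The pressure -/

theorem integral_eq_inner_const {Ω : BoundedLipschitzDomain N} (p : Lp ℝ 2 (vol Ω)) :
    ∫ y, p y ∂(vol Ω) = inner ℝ (Lp.const 2 (vol Ω) (1 : ℝ)) p := by
  rw [L2.inner_def]
  refine integral_congr_ae ?_
  filter_upwards [Lp.coeFn_const 2 (vol Ω) (1 : ℝ)] with y hy
  rw [hy]
  simp

variable (Ω : BoundedLipschitzDomain N)

/-- The square integrable functions of vanishing average. -/
def meanZero : Submodule ℝ (Lp ℝ 2 (vol Ω)) :=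
  LinearMap.ker (innerSL ℝ (Lp.const 2 (vol Ω) (1 : ℝ)) : Lp ℝ 2 (vol Ω) →ₗ[ℝ] ℝ)

variable {Ω}

theorem mem_meanZero {p : Lp ℝ 2 (vol Ω)} : p ∈ meanZero Ω ↔ ∫ y, p y ∂(vol Ω) = 0 := by
  rw [integral_eq_inner_const]; rfl

instance : CompleteSpace (meanZero Ω) :=
  (ContinuousLinearMap.isClosed_ker (innerSL ℝ (Lp.const 2 (vol Ω) (1 : ℝ)))).completeSpace_coe

/-- On functions of vanishing average the gradient is bounded below, and an operator on a complete
space that is bounded below has closed range. -/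
theorem isClosed_range_gradAdj :
    IsClosed (LinearMap.range ((gradAdj Ω ∘L (meanZero Ω).subtypeL :
      meanZero Ω →L[ℝ] H10 Ω) : meanZero Ω →ₗ[ℝ] H10 Ω) : Set (H10 Ω)) := by
  obtain ⟨C, hC0, hC⟩ := exists_norm_le_norm_gradAdj Ω
  set A := gradAdj Ω ∘L (meanZero Ω).subtypeL with hA
  have hanti : AntilipschitzWith (Real.toNNReal C) A := by
    refine A.antilipschitz_of_bound fun p => ?_
    rw [Real.coe_toNNReal C hC0]
    exact hC p (mem_meanZero.mp p.2)
  exact hanti.isClosed_range A.uniformContinuous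

/-- De Rham's theorem: a functional in `H⁻¹` vanishing on solenoidal fields is the gradient of
a pressure. -/
theorem exists_pressure (G : HNegOne Ω) (hG : ∀ v ∈ Solenoidal Ω, G v = 0) :
    ∃ p : Lp ℝ 2 (vol Ω), ∫ y, p y ∂(vol Ω) = 0 ∧ ∀ v, G v = inner ℝ p (divL Ω v) := by
  set A := gradAdj Ω ∘L (meanZero Ω).subtypeL with hA
  set R : Submodule ℝ (H10 Ω) := LinearMap.range (A : meanZero Ω →ₗ[ℝ] H10 Ω) with hR
  have : CompleteSpace R := isClosed_range_gradAdj.completeSpace_coe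
  set g := (InnerProductSpace.toDual ℝ (H10 Ω)).symm G with hg
  have hgG : ∀ v, inner ℝ g v = G v := fun v => InnerProductSpace.toDual_symm_apply
  -- A closed subspace is its own double orthogonal complement. If `z` is orthogonal to `R`, then
  -- `div z` is orthogonal to all functions of vanishing average. It is itself one of them, so `div
  -- z = 0` and `G z = 0`.
  have hgR : g ∈ R := by
    rw [← Submodule.orthogonal_orthogonal R, Submodule.mem_orthogonal]
    intro z hz
    have h1 : ∀ p ∈ meanZero Ω, inner ℝ p (divL Ω z) = 0 := fun p hp => by
      rw [← inner_gradAdj]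
      exact (Submodule.mem_orthogonal R z).mp hz _ ⟨⟨p, hp⟩, rfl⟩
    have h2 : divL Ω z = 0 := inner_self_eq_zero.mp (h1 _ (mem_meanZero.mpr (integral_divL z)))
    rw [real_inner_comm, hgG]
    exact hG z h2
  obtain ⟨p, hp⟩ := hgR
  refine ⟨p, mem_meanZero.mp p.2, fun v => ?_⟩
  rw [← inner_gradAdj, ← hgG, ← hp]
  rfl

theorem eq_zero_of_inner_divL_eq_zero {p : Lp ℝ 2 (vol Ω)} (hp : ∫ y, p y ∂(vol Ω) = 0)
    (h : ∀ v, inner ℝ p (divL Ω v) = 0) : p = 0 := by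
  obtain ⟨C, hC0, hC⟩ := exists_norm_le_norm_gradAdj Ω
  have h0 : gradAdj Ω p = 0 := by
    refine (inner_self_eq_zero (𝕜 := ℝ)).mp ?_
    rw [inner_gradAdj]; exact h _
  have := hC p hp
  rw [h0, norm_zero, mul_zero] at this
  exact norm_le_zero_iff.mp this

end

section

variable {N : ℕ} {Ω : BoundedLipschitzDomain N}

/-! ### The embedding of `H¹₀` into `L⁴` -/

theorem norm_fderiv_le_norm_classicalGrad (φ : Vec N → Vec N) (y : Vec N) :
    ‖fderiv ℝ φ y‖ ≤ N * ‖classicalGrad φ y‖ := by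
  refine ContinuousLinearMap.opNorm_le_bound _ (by positivity) fun v => ?_
  have e : fderiv ℝ φ y v = ∑ j, v j • classicalGrad φ y j := by
    conv_lhs => rw [← (EuclideanSpace.basisFun (Fin N) ℝ).sum_repr v]
    simp [classicalGrad]
  rw [e]
  refine (norm_sum_le _ _).trans ((Finset.sum_le_sum (g := fun _ =>
    ‖classicalGrad φ y‖ * ‖v‖) fun j _ => ?_).trans_eq (by simp [mul_assoc]))
  rw [norm_smul, mul_comm]
  gcongr
  · exact PiLp.norm_apply_le (classicalGrad φ y) j
  · exact PiLp.norm_apply_le v j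

theorem eLpNorm_vol_eq {F : Type*} [NormedAddCommGroup F] {f : Vec N → F} (p : ℝ≥0∞)
    (hf : ∀ y, y ∉ (Ω.toOpens : Set (Vec N)) → f y = 0) :
    eLpNorm f p (vol Ω) = eLpNorm f p volume := by
  rw [← eLpNorm_indicator_eq_eLpNorm_restrict Ω.toOpens.isOpen.measurableSet]
  congr 1
  ext y
  by_cases hy : y ∈ (Ω.toOpens : Set (Vec N)) <;> simp [hy, hf]

theorem eLpNorm_fderiv_two_le (φ : 𝓓(Ω.toOpens, Vec N)) :
    eLpNorm (fderiv ℝ φ) 2 (vol Ω) ≤ (N : ℝ≥0) * ENNReal.ofReal ‖H10.ofTest φ‖ := by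
  have h1 : eLpNorm (fderiv ℝ φ) 2 (vol Ω) ≤ (N : ℝ≥0) • eLpNorm (classicalGrad φ) 2 (vol Ω) :=
    eLpNorm_le_nnreal_smul_eLpNorm_of_ae_le_mul
      (Eventually.of_forall fun y => norm_fderiv_le_norm_classicalGrad φ y) 2
  have h2 : ENNReal.ofReal ‖H10.ofTest φ‖ = eLpNorm (classicalGrad φ) 2 (vol Ω) := by
    rw [← H10.norm_grad, Lp.norm_def, ENNReal.ofReal_toReal (Lp.eLpNorm_ne_top _)]
    exact eLpNorm_congr_ae (H10.grad_ofTest φ)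
  rw [h2]
  exact h1

theorem fderiv_eq_zero_of_notMem (φ : 𝓓(Ω.toOpens, Vec N)) {y : Vec N}
    (hy : y ∉ (Ω.toOpens : Set (Vec N))) : fderiv ℝ φ y = 0 :=
  image_eq_zero_of_notMem_tsupport fun h => hy (φ.tsupport_subset (tsupport_fderiv_subset ℝ h))

theorem eLpNorm_fderiv_le_two (φ : 𝓓(Ω.toOpens, Vec N)) {p : ℝ≥0∞} (hp : p ≤ 2) :
    eLpNorm (fderiv ℝ φ) p volume ≤ eLpNorm (fderiv ℝ φ) 2 (vol Ω) *
      (vol Ω) Set.univ ^ (1 / p.toReal - 1 / (2 : ℝ≥0∞).toReal) := by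
  rw [← eLpNorm_vol_eq (Ω := Ω) p fun y hy => fderiv_eq_zero_of_notMem φ hy]
  exact eLpNorm_le_eLpNorm_mul_rpow_measure_univ hp
    (φ.contDiff.continuous_fderiv (by simp)).aestronglyMeasurable

theorem exists_sobolev_test_of_two_le (hN : 2 ≤ N) (hN4 : N ≤ 4) (Ω : BoundedLipschitzDomain N) :
    ∃ C : ℝ≥0∞, C ≠ ∞ ∧ ∀ φ : 𝓓(Ω.toOpens, Vec N),
      eLpNorm φ 4 (vol Ω) ≤ C * ENNReal.ofReal ‖H10.ofTest φ‖ := by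
  have hN0 : (0 : ℝ≥0) < N := by exact_mod_cast (by omega : 0 < N)
  have hN2' : (2 : ℝ≥0) ≤ N := by exact_mod_cast hN
  have hN4' : (N : ℝ≥0) ≤ 4 := by exact_mod_cast hN4
  -- The exponent whose Sobolev conjugate is 4. The condition `p ≤ 2` is exactly `N ≤ 4`; it lets
  -- the `L²` norm of the gradient control the `L^p` norm on a set of finite measure.
  set p : ℝ≥0 := 4 * N / (4 + N) with hp
  have hp1 : 1 ≤ p := by
    rw [hp, one_le_div (by positivity), ← NNReal.coe_le_coe]
    have : (2 : ℝ) ≤ N := by exact_mod_cast hN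
    push_cast; linarith
  have hp2 : p ≤ 2 := by
    rw [hp, div_le_iff₀ (by positivity), ← NNReal.coe_le_coe]
    have : (N : ℝ) ≤ 4 := by exact_mod_cast hN4
    push_cast; linarith
  have hpN : p < N := by
    rw [hp, div_lt_iff₀ (by positivity), ← NNReal.coe_lt_coe]
    have : (2 : ℝ) ≤ N := by exact_mod_cast hN
    push_cast; nlinarith
  have hpq : (p : ℝ)⁻¹ - (N : ℝ)⁻¹ ≤ ((4 : ℝ≥0) : ℝ)⁻¹ := by
    have : (0 : ℝ) < N := by exact_mod_cast hN0
    rw [hp]; push_cast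
    refine le_of_eq ?_
    field_simp
    ring
  set C₁ := eLpNormLESNormFDerivOfLeConst (Vec N) (volume : Measure (Vec N))
    (Ω.toOpens : Set (Vec N)) p 4
  set C₂ := (vol Ω) Set.univ ^ (1 / (p : ℝ≥0∞).toReal - 1 / (2 : ℝ≥0∞).toReal)
  have hC₂ : C₂ ≠ ∞ := by
    refine (ENNReal.rpow_lt_top_of_nonneg ?_ (measure_ne_top _ _)).ne
    rw [sub_nonneg]
    simp only [ENNReal.toReal_ofNat, ENNReal.coe_toReal]
    exact one_div_le_one_div_of_le (by positivity) (by exact_mod_cast hp2)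
  refine ⟨C₁ * ((N : ℝ≥0) * C₂), ENNReal.mul_ne_top ENNReal.coe_ne_top
    (ENNReal.mul_ne_top ENNReal.coe_ne_top hC₂), fun φ => ?_⟩
  have hsupp : Function.support φ ⊆ (Ω.toOpens : Set (Vec N)) :=
    (subset_tsupport _).trans φ.tsupport_subset
  have h1 := eLpNorm_le_eLpNorm_fderiv_of_le (volume : Measure (Vec N)) (φ.contDiff.of_le
    (by norm_cast)) hsupp hp1 (by simpa using hpN) (q := 4) (by simpa using hpq) Ω.bounded
  calc eLpNorm φ 4 (vol Ω) ≤ eLpNorm φ 4 volume := eLpNorm_mono_measure _ Measure.restrict_le_self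
    _ ≤ C₁ * eLpNorm (fderiv ℝ φ) p volume := by exact_mod_cast h1
    _ ≤ C₁ * (((N : ℝ≥0) * ENNReal.ofReal ‖H10.ofTest φ‖) * C₂) := by
        gcongr
        refine (eLpNorm_fderiv_le_two φ (by exact_mod_cast hp2)).trans ?_
        gcongr
        exact eLpNorm_fderiv_two_le φ
    _ = _ := by ring

/-- For `N = 1` the exponent of the general case would be `4/5 < 1`. Instead, the fundamental
theorem of calculus bounds the supremum by the `L¹` norm of the derivative. -/
theorem exists_sobolev_test_one (Ω : BoundedLipschitzDomain 1) :
    ∃ C : ℝ≥0∞, C ≠ ∞ ∧ ∀ φ : 𝓓(Ω.toOpens, Vec 1),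
      eLpNorm φ 4 (vol Ω) ≤ C * ENNReal.ofReal ‖H10.ofTest φ‖ := by
  set c : ℝ≥0∞ := (vol Ω) Set.univ with hc
  have hct : c ≠ ∞ := measure_ne_top _ _
  refine ⟨c ^ (1 / (1 : ℝ≥0∞).toReal - 1 / (2 : ℝ≥0∞).toReal) * c ^ (1 / (4 : ℝ≥0∞).toReal),
    ENNReal.mul_ne_top (ENNReal.rpow_lt_top_of_nonneg (by norm_num) hct).ne
      (ENNReal.rpow_lt_top_of_nonneg (by norm_num) hct).ne, fun φ => ?_⟩
  let e : ℝ ≃ₗᵢ[ℝ] Vec 1 := (OrthonormalBasis.singleton (Fin 1) ℝ).repr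
  have hφ1 : ContDiff ℝ 1 φ := φ.contDiff.of_le (by norm_cast)
  have hpt : ∀ x, ‖φ x‖ₑ ≤ eLpNorm (fderiv ℝ φ) 1 volume := fun x => by
    have h1 := HasCompactSupport.enorm_le_lintegral_Ici_deriv
      (hφ1.comp e.toContinuousLinearEquiv.contDiff)
      (φ.hasCompactSupport.comp_homeomorph e.toHomeomorph) (e.symm x)
    have h2 : (φ ∘ e) (e.symm x) = φ x := by simp
    rw [← h2, eLpNorm_one_eq_lintegral_enorm, ← e.measurePreserving.lintegral_comp_emb
      e.toHomeomorph.measurableEmbedding]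
    refine h1.trans ((setLIntegral_le_lintegral _ _).trans (lintegral_mono fun t => ?_))
    have h3 : HasDerivAt (φ ∘ e) (fderiv ℝ φ (e t) (e 1)) t :=
      (hφ1.differentiable one_ne_zero (e t)).hasFDerivAt.comp_hasDerivAt t
        (e.toContinuousLinearEquiv : ℝ →L[ℝ] Vec 1).hasDerivAt
    change ‖deriv (φ ∘ e) t‖ₑ ≤ _
    rw [h3.deriv]
    refine ((fderiv ℝ φ (e t)).le_opENorm _).trans_eq ?_
    rw [← ofReal_norm (e 1), e.norm_map]
    simp
  have hsup : eLpNorm φ ∞ (vol Ω) ≤ eLpNorm (fderiv ℝ φ) 1 volume :=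
    eLpNormEssSup_le_of_ae_enorm_bound (Eventually.of_forall hpt)
  have h4 := eLpNorm_le_eLpNorm_mul_rpow_measure_univ (μ := vol Ω) (p := 4) (q := ∞) le_top
    φ.continuous.aestronglyMeasurable (f := φ)
  calc eLpNorm φ 4 (vol Ω) ≤ eLpNorm φ ∞ (vol Ω) * c ^ (1 / (4 : ℝ≥0∞).toReal) := by
        simpa [hc] using h4
    _ ≤ (ENNReal.ofReal ‖H10.ofTest φ‖ * c ^ (1 / (1 : ℝ≥0∞).toReal - 1 / (2 : ℝ≥0∞).toReal)) *
          c ^ (1 / (4 : ℝ≥0∞).toReal) := by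
        gcongr
        refine hsup.trans ((eLpNorm_fderiv_le_two φ (by norm_num)).trans ?_)
        gcongr
        simpa using eLpNorm_fderiv_two_le φ
    _ = _ := by ring

/-- Test fields approximating `u` in `H¹₀` have fields converging in `L²`. Along a subsequence
converging almost everywhere, Fatou's lemma passes the `L⁴` bound to the limit. -/
theorem exists_sobolev (hN : 1 ≤ N) (hN4 : N ≤ 4) (Ω : BoundedLipschitzDomain N) :
    ∃ C : ℝ≥0∞, C ≠ ∞ ∧ ∀ u : H10 Ω, eLpNorm u.field 4 (vol Ω) ≤ C * ENNReal.ofReal ‖u‖ := by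
  obtain ⟨C, hC, h⟩ : ∃ C : ℝ≥0∞, C ≠ ∞ ∧ ∀ φ : 𝓓(Ω.toOpens, Vec N),
      eLpNorm φ 4 (vol Ω) ≤ C * ENNReal.ofReal ‖H10.ofTest φ‖ := by
    rcases hN.eq_or_lt with rfl | hN
    · exact exists_sobolev_test_one Ω
    · exact exists_sobolev_test_of_two_le hN hN4 Ω
  refine ⟨C, hC, fun u => ?_⟩
  obtain ⟨v, hv, hvu⟩ := mem_closure_iff_seq_limit.mp (H10.denseRange_ofTest u)
  have h1 : Tendsto (fun n => (v n).field) atTop (𝓝 u.field) :=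
    (H10.fieldL.continuous.tendsto u).comp hvu
  obtain ⟨ns, hns, hae⟩ := (tendstoInMeasure_of_tendsto_Lp h1).exists_seq_tendsto_ae
  have h2 : ∀ n, eLpNorm (v n).field 4 (vol Ω) ≤ C * ENNReal.ofReal ‖v n‖ := fun n => by
    obtain ⟨φ, hφ⟩ := hv n
    rw [← hφ, eLpNorm_congr_ae (H10.field_ofTest φ)]
    exact h φ
  have h3 : Tendsto (fun n => C * ENNReal.ofReal ‖v (ns n)‖) atTop
      (𝓝 (C * ENNReal.ofReal ‖u‖)) :=
    ENNReal.Tendsto.const_mul (ENNReal.tendsto_ofReal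
      ((hvu.comp hns.tendsto_atTop).norm)) (Or.inr hC)
  refine (Lp.eLpNorm_lim_le_liminf_eLpNorm
    (fun n => (Lp.aestronglyMeasurable (v (ns n)).field)) _ hae).trans ?_
  rw [← h3.liminf_eq]
  exact liminf_le_liminf (Eventually.of_forall fun n => h2 (ns n))

/-! ### The convective term -/

theorem norm_tensor (a b : Vec N) : ‖tensor a b‖ = ‖a‖ * ‖b‖ := by
  have h : ‖tensor a b‖ ^ 2 = (‖a‖ * ‖b‖) ^ 2 := by
    rw [PiLp.norm_sq_eq_of_L2, mul_pow, EuclideanSpace.real_norm_sq_eq a, Finset.sum_mul]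
    refine Finset.sum_congr rfl fun j _ => ?_
    simp [tensor, norm_smul, mul_pow]
  exact (sq_eq_sq₀ (norm_nonneg _) (by positivity)).mp h

theorem continuous_tensor : Continuous fun z : Vec N × Vec N => tensor z.1 z.2 :=
  (PiLp.continuous_toLp 2 _).comp (continuous_pi fun j =>
    (((EuclideanSpace.proj (𝕜 := ℝ) j).continuous.comp continuous_fst).smul continuous_snd))

theorem eLpNorm_tensor_le {f g : Vec N → Vec N} (hf : AEStronglyMeasurable f (vol Ω))
    (hg : AEStronglyMeasurable g (vol Ω)) :
    eLpNorm (fun x => tensor (f x) (g x)) 2 (vol Ω) ≤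
      eLpNorm f 4 (vol Ω) * eLpNorm g 4 (vol Ω) := by
  have : ENNReal.HolderTriple 4 4 2 := ⟨by
    rw [← two_mul, show (4 : ℝ≥0∞) = 2 * 2 by norm_num, ENNReal.mul_inv (by simp) (by simp),
      ← mul_assoc, ENNReal.mul_inv_cancel (by simp) (by simp), one_mul]⟩
  have h := eLpNorm_le_eLpNorm_mul_eLpNorm'_of_norm (p := 4) (q := 4) (r := 2) hf hg tensor 1
    (Eventually.of_forall fun x => by simp [norm_tensor])
  simpa using h

/-- Hölder's inequality with exponents 4, 4, 2 and the `L⁴` embedding make the convective tensor a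
bounded bilinear map into `L²`. -/
theorem exists_tensorL (hN : 1 ≤ N) (hN4 : N ≤ 4) (Ω : BoundedLipschitzDomain N) :
    ∃ T : H10 Ω →L[ℝ] H10 Ω →L[ℝ] Lp (Mat N) 2 (vol Ω),
      ∀ u v, T u v =ᵐ[vol Ω] fun x => tensor (u.field x) (v.field x) := by
  obtain ⟨C, hC, h⟩ := exists_sobolev hN hN4 Ω
  have hbd : ∀ u v : H10 Ω, eLpNorm (fun x => tensor (u.field x) (v.field x)) 2 (vol Ω) ≤
      C * C * (ENNReal.ofReal ‖u‖ * ENNReal.ofReal ‖v‖) := fun u v => by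
    refine (eLpNorm_tensor_le (Lp.aestronglyMeasurable _) (Lp.aestronglyMeasurable _)).trans
      ((mul_le_mul' (h u) (h v)).trans_eq ?_)
    ring
  have hmem : ∀ u v : H10 Ω, MemLp (fun x => tensor (u.field x) (v.field x)) 2 (vol Ω) :=
    fun u v => ⟨continuous_tensor.comp_aestronglyMeasurable
      ((Lp.aestronglyMeasurable _).prodMk (Lp.aestronglyMeasurable _)),
      (hbd u v).trans_lt (ENNReal.mul_lt_top (ENNReal.mul_lt_top hC.lt_top hC.lt_top)
        (ENNReal.mul_lt_top ENNReal.ofReal_lt_top ENNReal.ofReal_lt_top))⟩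
  have hadd : ∀ u v : H10 Ω, (u + v).field =ᵐ[vol Ω] fun x => u.field x + v.field x :=
    fun u v => Lp.coeFn_add u.field v.field
  have hsmul : ∀ (c : ℝ) (u : H10 Ω), (c • u).field =ᵐ[vol Ω] fun x => c • u.field x :=
    fun c u => Lp.coeFn_smul c u.field
  refine ⟨LinearMap.mkContinuous₂ (LinearMap.mk₂ ℝ (fun u v => (hmem u v).toLp _) ?_ ?_ ?_ ?_)
    (C * C).toReal fun u v => ?_, fun u v => (hmem u v).coeFn_toLp⟩
  · intro u v w
    rw [← MemLp.toLp_add]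
    refine MemLp.toLp_congr _ _ ?_
    filter_upwards [hadd u v] with x hx
    rw [hx, Pi.add_apply]
    ext j i
    simp [tensor, add_mul]
  · intro c u w
    rw [← MemLp.toLp_const_smul]
    refine MemLp.toLp_congr _ _ ?_
    filter_upwards [hsmul c u] with x hx
    rw [hx, Pi.smul_apply]
    ext j i
    simp [tensor, mul_assoc]
  · intro u v w
    rw [← MemLp.toLp_add]
    refine MemLp.toLp_congr _ _ ?_
    filter_upwards [hadd v w] with x hx
    rw [hx, Pi.add_apply]
    ext j i
    simp [tensor]
  · intro c u w
    rw [← MemLp.toLp_const_smul]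
    refine MemLp.toLp_congr _ _ ?_
    filter_upwards [hsmul c w] with x hx
    rw [hx, Pi.smul_apply]
    ext j i
    simp [tensor]
    ring
  · rw [LinearMap.mk₂_apply, Lp.norm_toLp]
    refine (ENNReal.toReal_mono ?_ (hbd u v)).trans_eq ?_
    · exact ENNReal.mul_ne_top (ENNReal.mul_ne_top hC hC)
        (ENNReal.mul_ne_top ENNReal.ofReal_ne_top ENNReal.ofReal_ne_top)
    · rw [ENNReal.toReal_mul (a := C * C), ENNReal.toReal_mul (a := ENNReal.ofReal ‖u‖),
        ENNReal.toReal_ofReal (norm_nonneg _), ENNReal.toReal_ofReal (norm_nonneg _), mul_assoc]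

/-- A solenoidal field is orthogonal to gradients of test functions. -/
theorem inner_field_gradTest {χ : Vec N → ℝ} (hχ : ContDiff ℝ ((⊤ : ℕ∞) : WithTop ℕ∞) χ)
    (hχc : HasCompactSupport χ) (hχs : tsupport χ ⊆ (Ω.toOpens : Set (Vec N))) (u : H10 Ω) :
    inner ℝ u.field (H10.ofTest (gradTest hχ hχc hχs)).field =
      -inner ℝ (divL Ω u) ((hχ.continuous.memLp_of_hasCompactSupport hχc :
        MemLp χ 2 (vol Ω)).toLp χ) := by
  set X := (hχ.continuous.memLp_of_hasCompactSupport hχc : MemLp χ 2 (vol Ω)).toLp χ with hX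
  have hXae : X =ᵐ[vol Ω] χ := MemLp.coeFn_toLp _
  have hχ1 : ContDiff ℝ 1 χ := hχ.of_le (by norm_cast)
  refine H10.induction_ofTest (P := fun u =>
    inner ℝ u.field (H10.ofTest (gradTest hχ hχc hχs)).field = -inner ℝ (divL Ω u) X)
    (isClosed_eq (H10.fieldL.continuous.inner continuous_const)
      ((divL Ω).continuous.inner continuous_const).neg) (fun φ => ?_) u
  have hφ1 : ∀ i, ContDiff ℝ 1 fun y => φ y i := fun i => (contDiff_component φ i).of_le (by norm_cast)
  have hL : inner ℝ (H10.ofTest φ).field (H10.ofTest (gradTest hχ hχc hχs)).field =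
      ∫ y, ∑ i, φ y i * fderiv ℝ χ y (basisVec i) := by
    refine Eq.trans ?_ (integral_vol_eq (Ω := Ω) fun y hy => ?_)
    · rw [L2.inner_def]
      refine integral_congr_ae ?_
      filter_upwards [H10.field_ofTest φ, H10.field_ofTest (gradTest hχ hχc hχs)] with y h1 h2
      rw [h1, h2, PiLp.inner_apply]
      refine Finset.sum_congr rfl fun i _ => ?_
      simp only [RCLike.inner_apply, conj_trivial]
      exact mul_comm _ _
    · simp [field_eq_zero_of_notMem φ hy]
  have hR : inner ℝ (divL Ω (H10.ofTest φ)) X =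
      ∫ y, ∑ i, fderiv ℝ (fun y => φ y i) y (basisVec i) * χ y := by
    refine Eq.trans ?_ (integral_vol_eq (Ω := Ω) fun y hy => ?_)
    · rw [L2.inner_def]
      refine integral_congr_ae ?_
      filter_upwards [divL_ofTest φ, hXae] with y h1 h2
      rw [h1, h2, ← Finset.sum_mul]
      simp only [classicalGrad_component, RCLike.inner_apply, conj_trivial]
      exact mul_comm _ _
    · have : χ y = 0 := image_eq_zero_of_notMem_tsupport fun h => hy (hχs h)
      simp [this]
  rw [hL, hR, integral_finsetSum, integral_finsetSum, ← Finset.sum_neg_distrib]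
  · exact Finset.sum_congr rfl fun i _ => integral_mul_fderiv (hφ1 i) hχ1 hχc _
  · exact fun i _ => ((continuous_fderiv_apply (hφ1 i) _).mul
      hχ.continuous).integrable_of_hasCompactSupport hχc.mul_left
  · exact fun i _ => ((hφ1 i).continuous.mul
      (continuous_fderiv_apply hχ1 _)).integrable_of_hasCompactSupport
        (hasCompactSupport_component φ i).mul_right

/-- For smooth `v`, `χ = |v|²/2` is a test function and `(u ⊗ v) : ∇v = u · ∇χ`, whose integral
vanishes since `div u = 0`. Density is needed in `v` alone, over all of `H¹₀`, so no approximation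
by smooth solenoidal fields enters. -/
theorem inner_tensorL_grad_self {T : H10 Ω →L[ℝ] H10 Ω →L[ℝ] Lp (Mat N) 2 (vol Ω)}
    (hT : ∀ u v, T u v =ᵐ[vol Ω] fun x => tensor (u.field x) (v.field x)) {u : H10 Ω}
    (hu : u ∈ Solenoidal Ω) (v : H10 Ω) : inner ℝ (T u v) v.grad = 0 := by
  refine H10.induction_ofTest (P := fun v => inner ℝ (T u v) v.grad = 0)
    (isClosed_eq ((T u).continuous.inner H10.gradL.continuous) continuous_const) (fun ψ => ?_) v
  have hψ1 : ∀ i, ContDiff ℝ 1 fun y => ψ y i := fun i => (contDiff_component ψ i).of_le (by norm_cast)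
  set χ : Vec N → ℝ := fun y => 1 / 2 * ‖ψ y‖ ^ 2 with hχd
  have hχ : ContDiff ℝ ((⊤ : ℕ∞) : WithTop ℕ∞) χ := contDiff_const.mul (ψ.contDiff.norm_sq ℝ)
  have hsub : Function.support χ ⊆ Function.support ψ := fun y hy => by
    contrapose! hy
    simp only [Function.mem_support, ne_eq, not_not] at hy ⊢
    simp [hχd, hy]
  have hχc : HasCompactSupport χ := ψ.hasCompactSupport.mono hsub
  have hχs : tsupport χ ⊆ (Ω.toOpens : Set (Vec N)) := (closure_mono hsub).trans ψ.tsupport_subset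
  have h1 := inner_field_gradTest hχ hχc hχs u
  rw [show divL Ω u = 0 from hu, inner_zero_left, neg_zero] at h1
  rw [← h1, L2.inner_def, L2.inner_def]
  refine integral_congr_ae ?_
  filter_upwards [hT u (H10.ofTest ψ), H10.field_ofTest ψ, H10.grad_ofTest ψ,
    H10.field_ofTest (gradTest hχ hχc hχs)] with y e1 e2 e3 e4
  rw [e1, e2, e3, e4, PiLp.inner_apply, PiLp.inner_apply]
  refine Finset.sum_congr rfl fun j _ => ?_
  have e5 : fderiv ℝ χ y (basisVec j) = inner ℝ (ψ y) (fderiv ℝ ψ y (basisVec j)) := by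
    have := ((ψ.contDiff.differentiable (by simp) y).hasFDerivAt.norm_sq).const_mul (1 / 2)
    have h6 : HasFDerivAt χ _ y := this
    rw [h6.fderiv]
    simp
  change inner ℝ (u.field y j • ψ y) (fderiv ℝ ψ y (basisVec j)) =
    inner ℝ (u.field y j) (fderiv ℝ χ y (basisVec j))
  rw [e5, inner_smul_left, RCLike.inner_apply, conj_trivial]
  exact mul_comm _ _

end

section

variable {N : ℕ} {Ω : BoundedLipschitzDomain N}

/-! ### The Navier–Stokes system as a quadratic equation in `𝔻` -/

theorem H10.inner_grad (u v : H10 Ω) : inner ℝ u.grad v.grad = inner ℝ u v :=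
  H10.gradL.inner_map_map u v

theorem Solenoidal.divL_eq_zero (v : Solenoidal Ω) : divL Ω v.1 = 0 := v.2

theorem exists_pos_bound_bilinear {H : Type*} [NormedAddCommGroup H] [NormedSpace ℝ H]
    (B : H →L[ℝ] H →L[ℝ] H) : ∃ K : ℝ, 0 < K ∧ ∀ u v, ‖B u v‖ ≤ K * ‖u‖ * ‖v‖ :=
  ⟨‖B‖ + 1, by positivity, fun u v => (B.le_opNorm₂ u v).trans (by gcongr; simp)⟩

/-- The adjoint of `∇ : 𝔻 → L²`. -/
def gradAdjSol (Ω : BoundedLipschitzDomain N) : Lp (Mat N) 2 (vol Ω) →L[ℝ] Solenoidal Ω :=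
  ContinuousLinearMap.adjoint (H10.gradL.toContinuousLinearMap ∘L (Solenoidal Ω).subtypeL)

theorem inner_gradAdjSol (A : Lp (Mat N) 2 (vol Ω)) (w : Solenoidal Ω) :
    inner ℝ (gradAdjSol Ω A) w = inner ℝ A w.1.grad :=
  ContinuousLinearMap.adjoint_inner_left _ _ _

/-- The bilinear map `B` on `𝔻` with `⟨B(u, v), w⟩ = ∫ (u ⊗ v) : ∇w`. -/
def convection (T : H10 Ω →L[ℝ] H10 Ω →L[ℝ] Lp (Mat N) 2 (vol Ω)) :
    Solenoidal Ω →L[ℝ] Solenoidal Ω →L[ℝ] Solenoidal Ω :=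
  (ContinuousLinearMap.compL ℝ (Solenoidal Ω) (Lp (Mat N) 2 (vol Ω)) (Solenoidal Ω)
    (gradAdjSol Ω)) ∘L (T.bilinearComp (Solenoidal Ω).subtypeL (Solenoidal Ω).subtypeL)

theorem inner_convection (T : H10 Ω →L[ℝ] H10 Ω →L[ℝ] Lp (Mat N) 2 (vol Ω))
    (u v w : Solenoidal Ω) : inner ℝ (convection T u v) w = inner ℝ (T u.1 v.1) w.1.grad :=
  inner_gradAdjSol (T u.1 v.1) w

/-- The Riesz representative of the restriction of `f` to `𝔻`. -/
def forceSol (f : HNegOne Ω) : Solenoidal Ω :=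
  (InnerProductSpace.toDual ℝ (Solenoidal Ω)).symm (f ∘L (Solenoidal Ω).subtypeL)

theorem inner_forceSol (f : HNegOne Ω) (w : Solenoidal Ω) : inner ℝ (forceSol f) w = f w.1 :=
  InnerProductSpace.toDual_symm_apply

theorem norm_forceSol_le (f : HNegOne Ω) : ‖forceSol f‖ ≤ ‖f‖ := by
  rw [forceSol, LinearIsometryEquiv.norm_map]
  refine ContinuousLinearMap.opNorm_le_bound _ f.opNorm_nonneg fun w => ?_
  exact f.le_opNorm w.1

variable {T : H10 Ω →L[ℝ] H10 Ω →L[ℝ] Lp (Mat N) 2 (vol Ω)}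

/-- The linear part of the functional is `-⟨X(u), V⟩`; completing the square gives existence and
uniqueness of the residual at once and identifies it as `X(u)`. -/
theorem residualFunctional_eq (hT : ∀ u v, T u v =ᵐ[vol Ω] fun x => tensor (u.field x) (v.field x))
    (ν : ℝ) (f : HNegOne Ω) (u V : Solenoidal Ω) :
    residualFunctional ν f u V =
      1 / 2 * ‖V - quadResidual ν (forceSol f) (convection T) u‖ ^ 2 -
        1 / 2 * ‖quadResidual ν (forceSol f) (convection T) u‖ ^ 2 := by
  have h1 : ∫ x, (1 / 2 * ‖V.1.grad x‖ ^ 2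
      + inner ℝ (ν • u.1.grad x - tensor (u.1.field x) (u.1.field x)) (V.1.grad x)) ∂(vol Ω) =
      1 / 2 * inner ℝ V.1.grad V.1.grad + (ν * inner ℝ u.1.grad V.1.grad -
        inner ℝ (T u.1 u.1) V.1.grad) := by
    have i1 := L2.integrable_inner (𝕜 := ℝ) V.1.grad V.1.grad
    have i2 := L2.integrable_inner (𝕜 := ℝ) u.1.grad V.1.grad
    have i3 := L2.integrable_inner (𝕜 := ℝ) (T u.1 u.1) V.1.grad
    rw [L2.inner_def, L2.inner_def, L2.inner_def, ← integral_const_mul, ← integral_const_mul,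
      ← integral_sub (i2.const_mul ν) i3]
    refine Eq.trans ?_ (integral_add (i1.const_mul _) ((i2.const_mul ν).sub i3))
    refine integral_congr_ae ?_
    filter_upwards [hT u.1 u.1] with x hx
    rw [hx, inner_sub_left, inner_smul_left, real_inner_self_eq_norm_sq]
    rfl
  have h2 : inner ℝ V (quadResidual ν (forceSol f) (convection T) u) =
      f V - ν * inner ℝ u.1.grad V.1.grad + inner ℝ (T u.1 u.1) V.1.grad := by
    rw [real_inner_comm, quadResidual, inner_add_left, inner_sub_left, inner_forceSol,
      inner_convection, inner_smul_left, H10.inner_grad]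
    rfl
  rw [residualFunctional, h1, norm_sub_sq_real, h2, real_inner_self_eq_norm_sq, H10.norm_grad,
    ← Submodule.norm_coe]
  ring

theorem isResidual_iff (hT : ∀ u v, T u v =ᵐ[vol Ω] fun x => tensor (u.field x) (v.field x))
    (ν : ℝ) (f : HNegOne Ω) (u U : Solenoidal Ω) :
    IsResidual ν f u U ↔ U = quadResidual ν (forceSol f) (convection T) u := by
  simp only [IsResidual, residualFunctional_eq hT]
  set X := quadResidual ν (forceSol f) (convection T) u
  constructor
  · intro h
    have h1 := h X
    rw [sub_self, norm_zero] at h1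
    have h2 : ‖U - X‖ ^ 2 = 0 := le_antisymm (by linarith) (sq_nonneg _)
    exact sub_eq_zero.mp (norm_eq_zero.mp (pow_eq_zero_iff two_ne_zero |>.mp h2))
  · rintro rfl V
    rw [sub_self, norm_zero]
    linarith [sq_nonneg ‖V - X‖]

theorem residual_eq (hT : ∀ u v, T u v =ᵐ[vol Ω] fun x => tensor (u.field x) (v.field x))
    (ν : ℝ) (f : HNegOne Ω) (u : Solenoidal Ω) :
    residual ν f u = quadResidual ν (forceSol f) (convection T) u :=
  (isResidual_iff hT ν f u _).mp
    (Classical.epsilon_spec (p := IsResidual ν f u) ⟨_, (isResidual_iff hT ν f u _).mpr rfl⟩)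

theorem energy_eq (hT : ∀ u v, T u v =ᵐ[vol Ω] fun x => tensor (u.field x) (v.field x))
    (ν : ℝ) (f : HNegOne Ω) :
    energy ν f = fun u => 1 / 2 * ‖quadResidual ν (forceSol f) (convection T) u‖ ^ 2 := by
  ext u
  rw [energy, ← H10.norm_sq_eq, residual_eq hT, Submodule.norm_coe]

theorem isWeakSolution_iff (hT : ∀ u v, T u v =ᵐ[vol Ω] fun x => tensor (u.field x) (v.field x))
    (ν : ℝ) (f : HNegOne Ω) (u : Solenoidal Ω) (p : Lp ℝ 2 (vol Ω)) :
    IsWeakSolution ν f u p ↔ ∫ x, p x ∂(vol Ω) = 0 ∧ ∀ v : H10 Ω,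
      ν * inner ℝ u.1 v - inner ℝ (T u.1 u.1) v.grad - inner ℝ p (divL Ω v) = f v := by
  refine and_congr_right fun _ => forall_congr' fun v => ?_
  have i1 := L2.integrable_inner (𝕜 := ℝ) u.1.grad v.grad
  have i2 := L2.integrable_inner (𝕜 := ℝ) (T u.1 u.1) v.grad
  have i3 := L2.integrable_inner (𝕜 := ℝ) p (divL Ω v)
  rw [← H10.inner_grad, L2.inner_def, L2.inner_def, L2.inner_def, ← integral_const_mul,
    ← integral_sub (i1.const_mul ν) i2]
  refine Eq.congr (Eq.trans (integral_congr_ae ?_)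
    (integral_sub ((i1.const_mul ν).sub i2) i3)) rfl
  filter_upwards [hT u.1 u.1] with x hx
  rw [RCLike.inner_apply, conj_trivial, mul_comm (divL Ω v x), hx]

theorem quadResidual_eq_zero_iff (ν : ℝ) (f : HNegOne Ω) (u : Solenoidal Ω) :
    quadResidual ν (forceSol f) (convection T) u = 0 ↔
      ∀ w : Solenoidal Ω, ν * inner ℝ u.1 w.1 - inner ℝ (T u.1 u.1) w.1.grad = f w.1 := by
  have h : ∀ w, inner ℝ (quadResidual ν (forceSol f) (convection T) u) w =
      f w.1 - (ν * inner ℝ u.1 w.1 - inner ℝ (T u.1 u.1) w.1.grad) := fun w => by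
    rw [quadResidual, inner_add_left, inner_sub_left, inner_forceSol, inner_convection,
      inner_smul_left, conj_trivial, Submodule.coe_inner]
    ring
  rw [ext_iff_inner_right ℝ]
  refine forall_congr' fun w => ?_
  rw [h, inner_zero_left, sub_eq_zero, eq_comm]

theorem IsWeakSolution.quadResidual_eq_zero
    (hT : ∀ u v, T u v =ᵐ[vol Ω] fun x => tensor (u.field x) (v.field x))
    {ν : ℝ} {f : HNegOne Ω} {u : Solenoidal Ω} {p : Lp ℝ 2 (vol Ω)} (h : IsWeakSolution ν f u p) :
    quadResidual ν (forceSol f) (convection T) u = 0 := by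
  rw [quadResidual_eq_zero_iff]
  intro w
  have := ((isWeakSolution_iff hT ν f u p).mp h).2 w.1
  rwa [Solenoidal.divL_eq_zero, inner_zero_right, sub_zero] at this

theorem exists_isWeakSolution_of_quadResidual_eq_zero
    (hT : ∀ u v, T u v =ᵐ[vol Ω] fun x => tensor (u.field x) (v.field x))
    {ν : ℝ} {f : HNegOne Ω} {u : Solenoidal Ω}
    (h : quadResidual ν (forceSol f) (convection T) u = 0) : ∃ p, IsWeakSolution ν f u p := by
  rw [quadResidual_eq_zero_iff] at h
  -- The defect of the momentum equation without pressure vanishes on `𝔻`, so it is a pressure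
  -- gradient.
  let G : HNegOne Ω := ν • innerSL ℝ u.1 -
    innerSL ℝ (T u.1 u.1) ∘L H10.gradL.toContinuousLinearMap - f
  have hG : ∀ v, G v = ν * inner ℝ u.1 v - inner ℝ (T u.1 u.1) v.grad - f v := fun v => rfl
  obtain ⟨p, hp0, hp⟩ := exists_pressure G fun v hv => by rw [hG, h ⟨v, hv⟩, sub_self]
  refine ⟨p, (isWeakSolution_iff hT ν f u p).mpr ⟨hp0, fun v => ?_⟩⟩
  rw [← hp, hG]
  ring

/-- The pressure of a weak solution is determined by its velocity. -/
theorem IsWeakSolution.pressure_unique {ν : ℝ} {f : HNegOne Ω} {u : Solenoidal Ω}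
    (hT : ∀ u v, T u v =ᵐ[vol Ω] fun x => tensor (u.field x) (v.field x))
    {p q : Lp ℝ 2 (vol Ω)} (hp : IsWeakSolution ν f u p) (hq : IsWeakSolution ν f u q) : p = q := by
  rw [isWeakSolution_iff hT] at hp hq
  refine sub_eq_zero.mp (eq_zero_of_inner_divL_eq_zero ?_ fun v => ?_)
  · rw [integral_eq_inner_const, inner_sub_right, ← integral_eq_inner_const,
      ← integral_eq_inner_const, hp.1, hq.1, sub_self]
  · rw [inner_sub_left]
    linarith [hp.2 v, hq.2 v]

end

end SteadyNS

end

/-! ### The theorem for the Navier–Stokes system -/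

theorem mainTheorem9 (N : ℕ) (hN : 1 ≤ N) (hN4 : N ≤ 4) (Ω : SteadyNS.BoundedLipschitzDomain N) :
    (∀ (ν : ℝ) (f : SteadyNS.HNegOne Ω) (u : SteadyNS.Solenoidal Ω), 0 < ν →
      ∃! U : SteadyNS.Solenoidal Ω, SteadyNS.IsResidual ν f u U) ∧
    ∃ δ : ℝ, 0 < δ ∧ ∀ (ν : ℝ) (f : SteadyNS.HNegOne Ω), 0 < ν → ‖f‖ / ν ^ 2 ≤ δ →
      ∃ (c : ℝ≥0∞) (C : ℝ),
        SteadyNS.IsErrorFunctionalWith (SteadyNS.energy ν f) c C ∧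
        ∃ (u : SteadyNS.Solenoidal Ω) (p : Lp ℝ 2 (SteadyNS.vol Ω)),
          SteadyNS.IsWeakSolution ν f u p ∧
          (∀ (u' : SteadyNS.Solenoidal Ω) (p' : Lp ℝ 2 (SteadyNS.vol Ω)),
            SteadyNS.IsWeakSolution ν f u' p' → u' = u ∧ p' = p) ∧
          ∀ v : SteadyNS.Solenoidal Ω, ENNReal.ofReal (SteadyNS.energy ν f v) ≤ c →
            ‖u - v‖ ^ 2 ≤ C * SteadyNS.energy ν f v := by
  open SteadyNS in
  obtain ⟨T, hT⟩ := exists_tensorL hN hN4 Ω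
  refine ⟨fun ν f u _ => ⟨_, (isResidual_iff hT ν f u _).mpr rfl,
    fun U hU => (isResidual_iff hT ν f u U).mp hU⟩, ?_⟩
  set B := convection T with hBdef
  obtain ⟨K, hK, hB⟩ := exists_pos_bound_bilinear B
  have hB0 : ∀ u v, inner ℝ (B u v) v = 0 := fun u v => by
    rw [hBdef, inner_convection, inner_tensorL_grad_self hT u.2]
  -- `K` bounds `B`, which is built from `Ω` alone, so this `δ` does not depend on `ν` or `f`.
  refine ⟨1 / (8 * K), by positivity, fun ν f hν hf => ?_⟩
  have hF : ‖forceSol f‖ ≤ ν ^ 2 / (8 * K) := (norm_forceSol_le f).trans <| by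
    rw [div_le_iff₀ (by positivity)] at hf
    exact hf.trans_eq (by ring)
  have hE := isErrorFunctionalWith_quadResidual hν hK hB hB0 hF
  rw [← energy_eq hT] at hE
  have hzero : ∀ u, quadResidual ν (forceSol f) B u = 0 → energy ν f u = 0 := fun u hu => by
    rw [energy_eq hT]
    simp [← hBdef, hu]
  obtain ⟨u, hu⟩ := exists_quadResidual_eq_zero hν hK hB hF
  obtain ⟨p, hp⟩ := exists_isWeakSolution_of_quadResidual_eq_zero hT hu
  have hstab : ∀ v, ENNReal.ofReal (energy ν f v) ≤
      ENNReal.ofReal (1 / 2 * (ν ^ 2 / (8 * K)) ^ 2) →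
      ‖u - v‖ ^ 2 ≤ 16 / ν ^ 2 * energy ν f v := fun v hv => by
    have := hE.coercive u v (by simp [hzero u hu]) hv
    rwa [hzero u hu, zero_add] at this
  refine ⟨_, _, hE, u, p, hp, fun u' p' h' => ?_, hstab⟩
  have h0 := hzero u' (h'.quadResidual_eq_zero hT)
  -- Every weak solution has zero energy and so lies below the threshold; stability gives distance
  -- zero from `u`, with no smallness assumed on `u'`.
  have h1 := hstab u' (by simp [h0])
  rw [h0, mul_zero] at h1
  have huu : u = u' := sub_eq_zero.mp (norm_eq_zero.mp
    (pow_eq_zero_iff two_ne_zero |>.mp (le_antisymm h1 (sq_nonneg _))))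
  subst huu
  exact ⟨rfl, h'.pressure_unique hT hp⟩
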